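/- Work over $\mathbb{C}$, with $\otimes=\otimes_{\mathbb C}$ and Sweedler notation $\Delta(c)=c_{(1)}\otimes c_{(2)}$. Let $H$ be a Hopf algebra with antipode $S$ and let $C$ be a right $H$-module coalgebra with action $\triangleleft$. Let $I=\mathrm{span}\{c\triangleleft h-\varepsilon(h)c : c\in C,\ h\in H\}$, which is a coideal, let $D=C/I$ be the quotient coalgebra and $\pi:C\to D$ the projection. $C$ is a $D$-bicomodule via $\pi$. For a right comodule $X$ and a left comodule $Y$, $X\,\square\,Y\subseteq X\otimes Y$ denotes the cotensor product (the equalizer of the two coactions). Assume that $C\twoheadrightarrow D$ is a (right) Hopf–Galois coextension $C(D)^H$, i.e. that the canonical map $$\beta:C\otimes H\to C\,\square_D\,C,\qquad \beta(c\otimes h)=c_{(1)}\otimes c_{(2)}\triangleleft h$$ is bijective, and put $\kappa=(\varepsilon\otimes \mathrm{id}_H)\circ\beta^{-1}:C\,\square_D\,C\to H$. Let $D^e=D\otimes D_{\mathrm{cop}}$ coact on $D$ from the right by $d\mapsto d_{(2)}\otimes(d_{(3)}\otimes d_{(1)})$ and on $C^{\square_D(n+1)}$ from the left by $$c_0\otimes\cdots\otimes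 c_n\mapsto(\pi(c_{0(1)})\otimes\pi(c_{n(2)}))\otimes c_{0(2)}\otimes c_1\otimes\cdots\otimes c_{n-1}\otimes c_{n(1)}$$ (for $n=0$: $c\mapsto(\pi(c_{(1)})\otimes\pi(c_{(3)}))\otimes c_{(2)}$). Let $\widetilde M=D\,\square_{D^e}\,C$. Then $\xi(d\otimes c)=\varepsilon(d)c$ is an isomorphism from $\widetilde M$ onto $C^D=\{c: \pi(c_{(1)})\otimes c_{(2)}=\pi(c_{(2)})\otimes c_{(1)}\}$, with inverse $c\mapsto\pi(c_{(1)})\otimes c_{(2)}$. On $\widetilde M$ consider the right action and left coaction of $H$ $$(d\otimes c)\triangleleft h=d\otimes c\triangleleft h,\qquad d\otimes c\mapsto m_{(-1)}\otimes m_{(0)}=\kappa(c_{(4)}\otimes c_{(1)})\otimes\varepsilon(d)\,\pi(c_{(2)})\otimes c_{(3)},$$ the latter corresponding under $\xi$ to $c\mapsto\kappa(c_{(3)}\otimes c_{(1)})\otimes c_{(2)}$ on $C^D$. **Proposition.** (a) $\widetilde M$ is a right-left SAYD module over $H$: it is a right module and a left comodule, $(m\triangleleft h)_{(-1)}\otimes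 (m\triangleleft h)_{(0)}=S(h_{(3)})m_{(-1)}h_{(1)}\otimes m_{(0)}\triangleleft h_{(2)}$, and $m_{(0)}\triangleleft m_{(-1)}=m$. (b) The spaces $\mathcal C^n(H,\widetilde M)=H^{\otimes n}\otimes\widetilde M$ form a cocyclic module with $$\delta_i(h_1\otimes\cdots\otimes h_n\otimes m)=h_1\otimes\cdots\otimes h_i\otimes1\otimes h_{i+1}\otimes\cdots\otimes h_n\otimes m\quad(0\le i\le n),$$ $$\delta_{n+1}(h_1\otimes\cdots\otimes h_n\otimes m)=h_{1(1)}\otimes\cdots\otimes h_{n(1)}\otimes S(h_{1(2)}\cdots h_{n(2)})m_{(-1)}\otimes m_{(0)},$$ $\sigma_i:\mathcal C^{n+1}\to\mathcal C^n$ multiplying $h_{i+1}$ and $h_{i+2}$ for $0\le i<n$ and applying $\varepsilon$ to $h_{n+1}$ for $i=n$, and $$\tau_n(h_1\otimes\cdots\otimes h_n\otimes m)=h_{2(1)}\otimes\cdots\otimes h_{n(1)}\otimes S(h_{1(2)}\cdots h_{n(2)})m_{(-1)}\otimes m_{(0)}\triangleleft h_{1(1)}\qquad(\tau_0=\mathrm{id}).$$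 (c) The spaces $\mathcal C^n(C,C^D)=D\,\square_{D^e}\,C^{\square_D(n+1)}$ form a cocyclic module with the following (well-defined) operators: $$\delta_i(d\otimes c_0\otimes\cdots\otimes c_n)=d\otimes c_0\otimes\cdots\otimes\Delta(c_i)\otimes\cdots\otimes c_n\quad(0\le i\le n),$$ $$\delta_{n+1}(d\otimes c_0\otimes\cdots\otimes c_n)=\varepsilon(d)\pi(c_{0(2)})\otimes c_{0(3)}\otimes c_1\otimes\cdots\otimes c_n\otimes c_{0(1)},$$ $$\sigma_i(d\otimes c_0\otimes\cdots\otimes c_{n+1})=d\otimes c_0\otimes\cdots\otimes\varepsilon(c_{i+1})\otimes\cdots\otimes c_{n+1}\quad(0\le i\le n),$$ $$\tau_n(d\otimes c_0\otimes\cdots\otimes c_n)=\varepsilon(d)\pi(c_{1(1)})\otimes c_{1(2)}\otimes c_2\otimes\cdots\otimes c_n\otimes c_0\qquad(\tau_0=\mathrm{id}).$$ (d) The maps $\omega_n:\mathcal C^n(H,\widetilde M)\to\mathcal C^n(C,C^D)$, $$\omega_n(h_0\otimes\cdots\otimes h_{n-1}\otimes d\otimes c)=d\otimes c_{(1)}\otimes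 c_{(2)}\triangleleft h_{0(1)}\otimes c_{(3)}\triangleleft h_{0(2)}h_{1(1)}\otimes\cdots\otimes c_{(n+1)}\triangleleft h_{0(n)}h_{1(n-1)}\cdots h_{n-2(2)}h_{n-1},$$ are well defined and form an isomorphism of cocyclic modules: they are bijective and commute with all $\delta_i$, $\sigma_i$ and $\tau_n$. Moreover, if $H^{\otimes(n+1)}$ carries the diagonal right coaction of $H$, the map $\varphi_n:H^{\otimes(n+1)}\,\square_H\,\widetilde M\to H^{\otimes n}\otimes\widetilde M$, $h_0\otimes\cdots\otimes h_n\otimes m\mapsto\varepsilon(h_n)\,h_0\otimes\cdots\otimes h_{n-1}\otimes m$, is bijective, so that $\omega_n\circ\varphi_n$ gives the same isomorphism on the model $H^{\otimes(n+1)}\,\square_H\,\widetilde M$. (e) Consequently $\omega$ induces isomorphisms $HC^n(H,\widetilde M)\cong HC^n(C,C^D)$ for all $n\ge 0$, where $HC^*$ of a cocyclic module denotes the cohomology of its subcomplex of cyclic cochains $\{x:\tau_nx=(-1)^nx\}$ with differential $b=\sum_i(-1)^i\delta_i$. -/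

import Mathlib

open TensorProduct Coalgebra

noncomputable section

namespace CocycHopf

/-- The cotensor product `X □_E Y ⊆ X ⊗ Y` of a right coaction `ρ` on `X` and a left coaction `l` on
`Y`, the equalizer of `ρ ⊗ Y` and `X ⊗ l`. -/
def cotensor {X E Y : Type*} [AddCommGroup X] [Module ℂ X] [AddCommGroup E] [Module ℂ E]
    [AddCommGroup Y] [Module ℂ Y] (ρ : X →ₗ[ℂ] X ⊗[ℂ] E) (l : Y →ₗ[ℂ] E ⊗[ℂ] Y) :
    Submodule ℂ (X ⊗[ℂ] Y) :=
  LinearMap.eqLocus ((TensorProduct.assoc ℂ X E Y).toLinearMap ∘ₗ ρ.rTensor Y) (l.lTensor X)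

section TensorPowers

variable {V : Type*} [AddCommGroup V] [Module ℂ V]

/-- The identification `V ⊗ V^{⊗n} ≃ V^{⊗(n+1)}`, `v ⊗ (w₁ ⊗ ⋯ ⊗ wₙ) ↦ v ⊗ w₁ ⊗ ⋯ ⊗ wₙ`. -/
def cons (n : ℕ) : V ⊗[ℂ] (⨂[ℂ]^n V) ≃ₗ[ℂ] ⨂[ℂ]^(n + 1) V :=
  (TensorProduct.congr (PiTensorProduct.subsingletonEquiv (s := fun _ : Fin 1 => V) 0).symm
      (LinearEquiv.refl ℂ _)) ≪≫ₗ
    TensorPower.mulEquiv ≪≫ₗ TensorPower.cast ℂ V (Nat.add_comm 1 n)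

theorem cons_tmul_tprod (n : ℕ) (v : V) (w : Fin n → V) :
    cons n (v ⊗ₜ[ℂ] PiTensorProduct.tprod ℂ w) =
      PiTensorProduct.tprod ℂ (Fin.cons v w : Fin (n + 1) → V) := by
  simp only [cons, LinearEquiv.trans_apply, TensorProduct.congr_tmul, LinearEquiv.refl_apply]
  rw [PiTensorProduct.subsingletonEquiv_symm_apply]
  rw [TensorPower.mulEquiv, LinearEquiv.trans_apply]
  rw [PiTensorProduct.tmulEquiv_apply, PiTensorProduct.reindex_tprod, TensorPower.cast_tprod]
  congr 1
  funext i
  refine Fin.cases ?_ (fun j => ?_) i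
  · rfl
  · simp only [Function.comp, Fin.cons_succ]
    have : Fin.cast (Nat.add_comm 1 n).symm j.succ = Fin.natAdd 1 j := by
      ext; simp [Nat.add_comm]
    rw [this, finSumFinEquiv_symm_apply_natAdd]
    rfl

/-- The identification `V^{⊗n} ⊗ V ≃ V^{⊗(n+1)}`, `(w₁ ⊗ ⋯ ⊗ wₙ) ⊗ v ↦ w₁ ⊗ ⋯ ⊗ wₙ ⊗ v`. -/
def snoc (n : ℕ) : (⨂[ℂ]^n V) ⊗[ℂ] V ≃ₗ[ℂ] ⨂[ℂ]^(n + 1) V :=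
  (TensorProduct.congr (LinearEquiv.refl ℂ _)
      (PiTensorProduct.subsingletonEquiv (s := fun _ : Fin 1 => V) 0).symm) ≪≫ₗ
    TensorPower.mulEquiv

theorem snoc_tprod_tmul (n : ℕ) (v : V) (w : Fin n → V) :
    snoc n (PiTensorProduct.tprod ℂ w ⊗ₜ[ℂ] v) =
      PiTensorProduct.tprod ℂ (Fin.snoc w v : Fin (n + 1) → V) := by
  simp only [snoc, LinearEquiv.trans_apply, TensorProduct.congr_tmul, LinearEquiv.refl_apply]
  rw [PiTensorProduct.subsingletonEquiv_symm_apply]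
  rw [TensorPower.mulEquiv, LinearEquiv.trans_apply]
  rw [PiTensorProduct.tmulEquiv_apply, PiTensorProduct.reindex_tprod]
  congr 1
  funext i
  refine Fin.lastCases ?_ (fun j => ?_) i
  · have : Fin.last n = Fin.natAdd n (0 : Fin 1) := by ext; simp
    rw [Fin.snoc_last, this, finSumFinEquiv_symm_apply_natAdd]
    rfl
  · rw [Fin.snoc_castSucc]
    have : j.castSucc = Fin.castAdd 1 j := rfl
    rw [this, finSumFinEquiv_symm_apply_castAdd]
    rfl

/-- The rotation `v₀ ⊗ v₁ ⊗ ⋯ ⊗ vₙ ↦ v₁ ⊗ ⋯ ⊗ vₙ ⊗ v₀`. -/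
def rotate (n : ℕ) : (⨂[ℂ]^(n + 1) V) →ₗ[ℂ] ⨂[ℂ]^(n + 1) V :=
  (snoc n).toLinearMap ∘ₗ (TensorProduct.comm ℂ V (⨂[ℂ]^n V)).toLinearMap ∘ₗ
    (cons n).symm.toLinearMap

end TensorPowers
section lift
variable {X M V W : Type*} [AddCommGroup X] [Module ℂ X] [AddCommGroup M] [Module ℂ M]
  [AddCommGroup V] [Module ℂ V] [AddCommGroup W] [Module ℂ W]

/-- Over a field `M ⊗ -` preserves equalizers: a map into `M ⊗ V` that is equalized by `M ⊗ f` and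
`M ⊗ g` corestricts to `M ⊗ Eq(f, g)`. -/
def liftEq (f g : V →ₗ[ℂ] W) (φ : X →ₗ[ℂ] M ⊗[ℂ] V)
    (h : ∀ x, f.lTensor M (φ x) = g.lTensor M (φ x)) :
    X →ₗ[ℂ] M ⊗[ℂ] LinearMap.eqLocus f g :=
  (LinearMap.tensorEqLocusEquiv ℂ M f g).symm.toLinearMap ∘ₗ φ.codRestrict _ h

theorem lTensor_subtype_liftEq (f g : V →ₗ[ℂ] W) (φ : X →ₗ[ℂ] M ⊗[ℂ] V)
    (h : ∀ x, f.lTensor M (φ x) = g.lTensor M (φ x)) (x : X) :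
    (LinearMap.eqLocus f g).subtype.lTensor M (liftEq f g φ h x) = φ x :=
  LinearMap.lTensor_eqLocus_subtype_tensoreqLocusEquiv_symm ℂ M f g ⟨φ x, h x⟩

end lift

section PositionMaps

variable {V : Type*} [AddCommGroup V] [Module ℂ V]

/-- For `f : V → E ⊗ V`, the map `V^{⊗n} → E ⊗ V^{⊗n}` that applies `f` to the `i`-th tensor factor
and moves the new factor in `E` to the front. -/
def coactAt {E : Type*} [AddCommGroup E] [Module ℂ E] (f : V →ₗ[ℂ] E ⊗[ℂ] V) :
    (n : ℕ) → Fin n → (⨂[ℂ]^n V) →ₗ[ℂ] E ⊗[ℂ] (⨂[ℂ]^n V)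
  | 0, i => i.elim0
  | n + 1, i => Fin.cases
      ((cons n).toLinearMap.lTensor E ∘ₗ (TensorProduct.assoc ℂ E V (⨂[ℂ]^n V)).toLinearMap ∘ₗ
        f.rTensor (⨂[ℂ]^n V) ∘ₗ (cons n).symm.toLinearMap)
      (fun j => (cons n).toLinearMap.lTensor E ∘ₗ
        (TensorProduct.leftComm ℂ V E (⨂[ℂ]^n V)).toLinearMap ∘ₗ
        (coactAt f n j).lTensor V ∘ₗ (cons n).symm.toLinearMap) i

section Coalgebra

variable [Coalgebra ℂ V]

/-- `V^{⊗n} → V^{⊗(n+1)}`, applying `Δ` to the `i`-th tensor factor. -/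
def comulAt : (n : ℕ) → Fin n → (⨂[ℂ]^n V) →ₗ[ℂ] ⨂[ℂ]^(n + 1) V
  | 0, i => i.elim0
  | n + 1, i => Fin.cases
      ((cons (n + 1)).toLinearMap ∘ₗ (cons n).toLinearMap.lTensor V ∘ₗ
        (TensorProduct.assoc ℂ V V (⨂[ℂ]^n V)).toLinearMap ∘ₗ
        (comul (R := ℂ)).rTensor (⨂[ℂ]^n V) ∘ₗ (cons n).symm.toLinearMap)
      (fun j => (cons (n + 1)).toLinearMap ∘ₗ (comulAt n j).lTensor V ∘ₗ
        (cons n).symm.toLinearMap) i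

/-- `V^{⊗(n+1)} → V^{⊗n}`, `v ⊗ w ↦ ε(v) w`. -/
def counitHead (n : ℕ) : (⨂[ℂ]^(n + 1) V) →ₗ[ℂ] ⨂[ℂ]^n V :=
  (TensorProduct.lid ℂ (⨂[ℂ]^n V)).toLinearMap ∘ₗ
    (counit (R := ℂ)).rTensor (⨂[ℂ]^n V) ∘ₗ (cons n).symm.toLinearMap

/-- `V^{⊗(n+1)} → V^{⊗n}`, applying `ε` to the `i`-th tensor factor. -/
def counitAt : (n : ℕ) → Fin (n + 1) → (⨂[ℂ]^(n + 1) V) →ₗ[ℂ] ⨂[ℂ]^n V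
  | 0, _ => counitHead 0
  | n + 1, i => Fin.cases (counitHead (n + 1))
      (fun j => (cons n).toLinearMap ∘ₗ (counitAt n j).lTensor V ∘ₗ
        (cons (n + 1)).symm.toLinearMap) i

/-- `V^{⊗(n+1)} → V^{⊗n}`, applying `ε` to the last tensor factor. -/
def counitLast (n : ℕ) : (⨂[ℂ]^(n + 1) V) →ₗ[ℂ] ⨂[ℂ]^n V :=
  (TensorProduct.rid ℂ (⨂[ℂ]^n V)).toLinearMap ∘ₗ
    (counit (R := ℂ)).lTensor (⨂[ℂ]^n V) ∘ₗ (snoc n).symm.toLinearMap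

/-- The iterated comultiplication `V → V^{⊗n}`, `v ↦ v₁ ⊗ ⋯ ⊗ vₙ` (it is `ε` for `n = 0` and the
identity for `n = 1`). -/
def itComul : (n : ℕ) → V →ₗ[ℂ] ⨂[ℂ]^n V
  | 0 => LinearMap.toSpanSingleton ℂ (⨂[ℂ]^0 V) (PiTensorProduct.tprod ℂ Fin.elim0) ∘ₗ
      (counit (R := ℂ))
  | n + 1 => (cons n).toLinearMap ∘ₗ (itComul n).lTensor V ∘ₗ comul (R := ℂ)

end Coalgebra

section Algebra

variable {H : Type*} [Ring H] [Algebra ℂ H]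

/-- `H^{⊗n} → H^{⊗(n+1)}`, `x ↦ 1 ⊗ x`. -/
def oneHead (n : ℕ) : (⨂[ℂ]^n H) →ₗ[ℂ] ⨂[ℂ]^(n + 1) H :=
  (cons n).toLinearMap ∘ₗ TensorProduct.mk ℂ H (⨂[ℂ]^n H) 1

/-- `H^{⊗n} → H^{⊗(n+1)}`, inserting `1` so that it becomes the `i`-th tensor factor. -/
def insertOneAt : (n : ℕ) → Fin (n + 1) → (⨂[ℂ]^n H) →ₗ[ℂ] ⨂[ℂ]^(n + 1) H
  | 0, _ => oneHead 0
  | n + 1, i => Fin.cases (oneHead (n + 1))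
      (fun j => (cons (n + 1)).toLinearMap ∘ₗ (insertOneAt n j).lTensor H ∘ₗ
        (cons n).symm.toLinearMap) i

/-- `H^{⊗(n+1)} → H^{⊗n}`, multiplying the `i`-th tensor factor with the next one. -/
def mulAt : (n : ℕ) → Fin n → (⨂[ℂ]^(n + 1) H) →ₗ[ℂ] ⨂[ℂ]^n H
  | 0, i => i.elim0
  | n + 1, i => Fin.cases
      ((cons n).toLinearMap ∘ₗ (LinearMap.mul' ℂ H).rTensor (⨂[ℂ]^n H) ∘ₗ
        (TensorProduct.assoc ℂ H H (⨂[ℂ]^n H)).symm.toLinearMap ∘ₗ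
        (cons n).symm.toLinearMap.lTensor H ∘ₗ (cons (n + 1)).symm.toLinearMap)
      (fun j => (cons n).toLinearMap ∘ₗ (mulAt n j).lTensor H ∘ₗ
        (cons (n + 1)).symm.toLinearMap) i

end Algebra

end PositionMaps

section Cocyclic

/-- The data of a cocyclic vector space: spaces with cofaces `δ n i : Xⁿ → Xⁿ⁺¹` (`0 ≤ i ≤ n + 1`),
codegeneracies `σ n i : Xⁿ⁺¹ → Xⁿ` (`0 ≤ i ≤ n`) and cyclic operators `τ n : Xⁿ → Xⁿ`. -/
structure CocyclicData where
  obj : ℕ → Type*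
  [acg : ∀ n, AddCommGroup (obj n)]
  [mod : ∀ n, Module ℂ (obj n)]
  δ : ∀ n, Fin (n + 2) → obj n →ₗ[ℂ] obj (n + 1)
  σ : ∀ n, Fin (n + 1) → obj (n + 1) →ₗ[ℂ] obj n
  τ : ∀ n, obj n →ₗ[ℂ] obj n

attribute [instance] CocyclicData.acg CocyclicData.mod

namespace CocyclicData

/-- The identities of a cocyclic module. -/
structure IsCocyclic (X : CocyclicData) : Prop where
  δ_comp_δ : ∀ (n : ℕ) (i j : Fin (n + 2)), i ≤ j →
    X.δ (n + 1) j.succ ∘ₗ X.δ n i = X.δ (n + 1) i.castSucc ∘ₗ X.δ n j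
  σ_comp_δ_of_le : ∀ (n : ℕ) (i : Fin (n + 2)) (j : Fin (n + 1)), i ≤ j.castSucc →
    X.σ (n + 1) j.succ ∘ₗ X.δ (n + 1) i.castSucc = X.δ n i ∘ₗ X.σ n j
  σ_comp_δ_self : ∀ (n : ℕ) (i : Fin (n + 1)), X.σ n i ∘ₗ X.δ n i.castSucc = LinearMap.id
  σ_comp_δ_succ : ∀ (n : ℕ) (i : Fin (n + 1)), X.σ n i ∘ₗ X.δ n i.succ = LinearMap.id
  σ_comp_δ_of_gt : ∀ (n : ℕ) (i : Fin (n + 2)) (j : Fin (n + 1)), j.castSucc < i →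
    X.σ (n + 1) j.castSucc ∘ₗ X.δ (n + 1) i.succ = X.δ n i ∘ₗ X.σ n j
  σ_comp_σ : ∀ (n : ℕ) (i j : Fin (n + 1)), i ≤ j →
    X.σ n j ∘ₗ X.σ (n + 1) i.castSucc = X.σ n i ∘ₗ X.σ (n + 1) j.succ
  τ_comp_δ_succ : ∀ (n : ℕ) (i : Fin (n + 1)),
    X.τ (n + 1) ∘ₗ X.δ n i.succ = X.δ n i.castSucc ∘ₗ X.τ n
  τ_comp_δ_zero : ∀ n : ℕ, X.τ (n + 1) ∘ₗ X.δ n 0 = X.δ n (Fin.last (n + 1))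
  τ_comp_σ_succ : ∀ (n : ℕ) (j : Fin (n + 1)),
    X.τ (n + 1) ∘ₗ X.σ (n + 1) j.succ = X.σ (n + 1) j.castSucc ∘ₗ X.τ (n + 2)
  τ_comp_σ_zero : ∀ n : ℕ,
    X.τ n ∘ₗ X.σ n 0 = X.σ n (Fin.last n) ∘ₗ X.τ (n + 1) ∘ₗ X.τ (n + 1)
  τ_pow : ∀ n : ℕ, X.τ n ^ (n + 1) = LinearMap.id

/-- A family of linear maps is an isomorphism of cocyclic modules when its members are bijective and
commute with all cofaces, codegeneracies and cyclic operators. -/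
structure IsIso (X Y : CocyclicData) (f : ∀ n, X.obj n →ₗ[ℂ] Y.obj n) : Prop where
  bijective : ∀ n, Function.Bijective (f n)
  comm_δ : ∀ (n : ℕ) (i : Fin (n + 2)), f (n + 1) ∘ₗ X.δ n i = Y.δ n i ∘ₗ f n
  comm_σ : ∀ (n : ℕ) (i : Fin (n + 1)), f n ∘ₗ X.σ n i = Y.σ n i ∘ₗ f (n + 1)
  comm_τ : ∀ n : ℕ, f n ∘ₗ X.τ n = Y.τ n ∘ₗ f n

variable (X : CocyclicData)

/-- The Hochschild differential `b = ∑ (-1)ⁱ δᵢ`. -/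
def b (n : ℕ) : X.obj n →ₗ[ℂ] X.obj (n + 1) := ∑ i : Fin (n + 2), (-1 : ℂ) ^ (i : ℕ) • X.δ n i

/-- The cyclic cochains: those `x` with `τₙ x = (-1)ⁿ x`. -/
def cyclicCochains (n : ℕ) : Submodule ℂ (X.obj n) :=
  LinearMap.eqLocus (X.τ n) ((-1 : ℂ) ^ n • LinearMap.id)

/-- The cyclic cocycles. -/
def cocycles (n : ℕ) : Submodule ℂ (X.obj n) := X.cyclicCochains n ⊓ LinearMap.ker (X.b n)

/-- The coboundaries of cyclic cochains. -/
def coboundaries : (n : ℕ) → Submodule ℂ (X.obj n)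
  | 0 => ⊥
  | n + 1 => (X.cyclicCochains n).map (X.b n)

/-- Cyclic cohomology: the cohomology of the complex of cyclic cochains with differential `b`. -/
abbrev HC (n : ℕ) : Type _ := X.cocycles n ⧸ (X.coboundaries n).comap (X.cocycles n).subtype

end CocyclicData

end Cocyclic

section HopfSide

variable {H M : Type*} [Ring H] [HopfAlgebra ℂ H] [AddCommGroup M] [Module ℂ M]

/-- `(g ⊗ m) ⊗ (h₁ ⊗ h₂ ⊗ h₃) ↦ S(h₃) g h₁ ⊗ m ◁ h₂`. -/
def aydMap (act : M ⊗[ℂ] H →ₗ[ℂ] M) :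
    (H ⊗[ℂ] M) ⊗[ℂ] (H ⊗[ℂ] (H ⊗[ℂ] H)) →ₗ[ℂ] H ⊗[ℂ] M :=
  (TensorProduct.comm ℂ M H).toLinearMap ∘ₗ
    (LinearMap.mul' ℂ H ∘ₗ (HopfAlgebra.antipode ℂ).rTensor H).lTensor M ∘ₗ
    (TensorProduct.assoc ℂ M H H).toLinearMap ∘ₗ
    (TensorProduct.comm ℂ H (M ⊗[ℂ] H)).toLinearMap ∘ₗ
    TensorProduct.map (LinearMap.mul' ℂ H)
      (act.rTensor H ∘ₗ (TensorProduct.assoc ℂ M H H).symm.toLinearMap) ∘ₗ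
    (TensorProduct.tensorTensorTensorComm ℂ H M H (H ⊗[ℂ] H)).toLinearMap

/-- `act` and `ρ` make `M` a right-left stable anti-Yetter-Drinfeld module over the Hopf algebra
`H`: a right module and a left comodule with `ρ(m ◁ h) = S(h₃) m₋₁ h₁ ⊗ m₀ ◁ h₂` and
`m₀ ◁ m₋₁ = m`. -/
structure IsSAYD (act : M ⊗[ℂ] H →ₗ[ℂ] M) (ρ : M →ₗ[ℂ] H ⊗[ℂ] M) : Prop where
  act_one : ∀ m : M, act (m ⊗ₜ[ℂ] (1 : H)) = m
  act_mul : ∀ (m : M) (h k : H), act (m ⊗ₜ[ℂ] (h * k)) = act (act (m ⊗ₜ[ℂ] h) ⊗ₜ[ℂ] k)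
  coassoc : ∀ m : M, TensorProduct.assoc ℂ H H M ((comul (R := ℂ)).rTensor M (ρ m)) =
    ρ.lTensor H (ρ m)
  counit : ∀ m : M, TensorProduct.lid ℂ M ((counit (R := ℂ)).rTensor M (ρ m)) = m
  anti_yetter_drinfeld : ∀ (m : M) (h : H), ρ (act (m ⊗ₜ[ℂ] h)) =
    aydMap act (ρ m ⊗ₜ[ℂ] (comul (R := ℂ)).lTensor H (comul (R := ℂ) h))
  stable : ∀ m : M, act (TensorProduct.comm ℂ H M (ρ m)) = m

/-- The diagonal right coaction of `H` on `H^{⊗n}`,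
`h₁ ⊗ ⋯ ⊗ hₙ ↦ h₁₁ ⊗ ⋯ ⊗ hₙ₁ ⊗ h₁₂ ⋯ hₙ₂`. -/
def diagCoact : (n : ℕ) → (⨂[ℂ]^n H) →ₗ[ℂ] (⨂[ℂ]^n H) ⊗[ℂ] H
  | 0 => (TensorProduct.mk ℂ (⨂[ℂ]^0 H) H).flip 1
  | n + 1 => TensorProduct.map (cons n).toLinearMap (LinearMap.mul' ℂ H) ∘ₗ
      (TensorProduct.tensorTensorTensorComm ℂ H H (⨂[ℂ]^n H) H).toLinearMap ∘ₗ
      TensorProduct.map (comul (R := ℂ)) (diagCoact n) ∘ₗ (cons n).symm.toLinearMap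

/-- `h₁ ⊗ ⋯ ⊗ hₙ ⊗ m ↦ h₁₁ ⊗ ⋯ ⊗ hₙ₁ ⊗ S(h₁₂ ⋯ hₙ₂) m₋₁ ⊗ m₀`. -/
def appendCoact (ρ : M →ₗ[ℂ] H ⊗[ℂ] M) (n : ℕ) :
    (⨂[ℂ]^n H) ⊗[ℂ] M →ₗ[ℂ] (⨂[ℂ]^(n + 1) H) ⊗[ℂ] M :=
  (snoc n).toLinearMap.rTensor M ∘ₗ (TensorProduct.assoc ℂ (⨂[ℂ]^n H) H M).symm.toLinearMap ∘ₗ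
    ((LinearMap.mul' ℂ H ∘ₗ (HopfAlgebra.antipode ℂ).rTensor H).rTensor M ∘ₗ
      (TensorProduct.assoc ℂ H H M).symm.toLinearMap ∘ₗ ρ.lTensor H).lTensor (⨂[ℂ]^n H) ∘ₗ
    (TensorProduct.assoc ℂ (⨂[ℂ]^n H) H M).toLinearMap ∘ₗ (diagCoact n).rTensor M

/-- `h₁ ⊗ h₂ ⊗ ⋯ ⊗ hₙ₊₁ ⊗ m ↦ h₂ ⊗ ⋯ ⊗ hₙ₊₁ ⊗ m ◁ h₁`. -/
def actByFirst (act : M ⊗[ℂ] H →ₗ[ℂ] M) (n : ℕ) :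
    (⨂[ℂ]^(n + 1) H) ⊗[ℂ] M →ₗ[ℂ] (⨂[ℂ]^n H) ⊗[ℂ] M :=
  (act ∘ₗ (TensorProduct.comm ℂ H M).toLinearMap).lTensor (⨂[ℂ]^n H) ∘ₗ
    (TensorProduct.leftComm ℂ H (⨂[ℂ]^n H) M).toLinearMap ∘ₗ
    (TensorProduct.assoc ℂ H (⨂[ℂ]^n H) M).toLinearMap ∘ₗ (cons n).symm.toLinearMap.rTensor M

/-- The cocyclic module `Cⁿ(H, M) = H^{⊗n} ⊗ M` of a Hopf algebra `H` with coefficients in `M`: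
`δᵢ` (`i ≤ n`) inserts `1` after the first `i` factors, the last coface is `appendCoact`, `σᵢ`
(`i < n`) multiplies the factors `hᵢ₊₁` and `hᵢ₊₂`, the last codegeneracy applies `ε` to the last
factor of `H^{⊗(n+1)}`, and
`τₙ(h₁ ⊗ ⋯ ⊗ hₙ ⊗ m) = h₂₁ ⊗ ⋯ ⊗ hₙ₁ ⊗ S(h₁₂ ⋯ hₙ₂) m₋₁ ⊗ m₀ ◁ h₁₁`. -/
abbrev hopfCyclic (act : M ⊗[ℂ] H →ₗ[ℂ] M) (ρ : M →ₗ[ℂ] H ⊗[ℂ] M) : CocyclicData where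
  obj n := (⨂[ℂ]^n H) ⊗[ℂ] M
  δ n := Fin.lastCases (appendCoact ρ n) (fun i => (insertOneAt n i).rTensor M)
  σ n := Fin.lastCases ((counitLast n).rTensor M) (fun i => (mulAt n i).rTensor M)
  τ n := actByFirst act n ∘ₗ appendCoact ρ n

/-- The map `H^{⊗(n+1)} □_H M → H^{⊗n} ⊗ M`,
`h₀ ⊗ ⋯ ⊗ hₙ ⊗ m ↦ ε(hₙ) h₀ ⊗ ⋯ ⊗ hₙ₋₁ ⊗ m`, where `H^{⊗(n+1)}` carries the diagonal coaction. -/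
def phi (ρ : M →ₗ[ℂ] H ⊗[ℂ] M) (n : ℕ) :
    cotensor (diagCoact (H := H) (n + 1)) ρ →ₗ[ℂ] (⨂[ℂ]^n H) ⊗[ℂ] M :=
  (counitLast n).rTensor M ∘ₗ (cotensor (diagCoact (H := H) (n + 1)) ρ).subtype

/-- `H^{⊗n} → H^{⊗n}`, `h₀ ⊗ h₁ ⊗ ⋯ ⊗ hₙ₋₁ ↦ h₀₁ ⊗ h₀₂ h₁₁ ⊗ ⋯ ⊗ h₀ₙ h₁₍ₙ₋₁₎ ⋯ hₙ₋₁`. -/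
def cumulProd : (n : ℕ) → (⨂[ℂ]^n H) →ₗ[ℂ] ⨂[ℂ]^n H
  | 0 => LinearMap.id
  | n + 1 => (cons n).toLinearMap ∘ₗ
      (LinearMap.mul' ℂ (⨂[ℂ]^n H) ∘ₗ TensorProduct.map (itComul n) (cumulProd n)).lTensor H ∘ₗ
      (TensorProduct.assoc ℂ H H (⨂[ℂ]^n H)).toLinearMap ∘ₗ
      (comul (R := ℂ)).rTensor (⨂[ℂ]^n H) ∘ₗ (cons n).symm.toLinearMap

end HopfSide

/-- A right action `c ⊗ h ↦ c ◁ h` of the Hopf algebra `H` that makes the coalgebra `C` a right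
`H`-module coalgebra. -/
structure RightModuleCoalgebra (H C : Type*) [Ring H] [HopfAlgebra ℂ H]
    [AddCommGroup C] [Module ℂ C] [Coalgebra ℂ C] where
  act : C ⊗[ℂ] H →ₗ[ℂ] C
  act_one : ∀ c : C, act (c ⊗ₜ[ℂ] (1 : H)) = c
  act_mul : ∀ (c : C) (h k : H), act (c ⊗ₜ[ℂ] (h * k)) = act (act (c ⊗ₜ[ℂ] h) ⊗ₜ[ℂ] k)
  counit_act : ∀ (c : C) (h : H),
    counit (R := ℂ) (act (c ⊗ₜ[ℂ] h)) = counit (R := ℂ) c * counit (R := ℂ) h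
  comul_act : ∀ (c : C) (h : H), comul (R := ℂ) (act (c ⊗ₜ[ℂ] h)) =
    TensorProduct.map act act (TensorProduct.tensorTensorTensorComm ℂ C C H H
      (comul (R := ℂ) c ⊗ₜ[ℂ] comul (R := ℂ) h))

namespace RightModuleCoalgebra

variable {H C : Type*} [Ring H] [HopfAlgebra ℂ H] [AddCommGroup C] [Module ℂ C] [Coalgebra ℂ C]
  (A : RightModuleCoalgebra H C)

/-- The coideal `I` spanned by the elements `c ◁ h - ε(h) c`. -/
def coideal : Submodule ℂ C :=
  Submodule.span ℂ {x | ∃ (c : C) (h : H), x = A.act (c ⊗ₜ[ℂ] h) - counit (R := ℂ) h • c}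

theorem mkQ_act (c : C) (h : H) :
    A.coideal.mkQ (A.act (c ⊗ₜ[ℂ] h)) = counit (R := ℂ) h • A.coideal.mkQ c := by
  rw [← map_smul, ← sub_eq_zero, ← map_sub, Submodule.mkQ_apply, Submodule.Quotient.mk_eq_zero]
  exact Submodule.subset_span ⟨c, h, rfl⟩

instance isCoideal : A.coideal.IsCoideal where
  counit_eq_zero := by
    intro x hx
    induction hx using Submodule.span_induction with
    | mem x hx =>
      obtain ⟨c, h, rfl⟩ := hx
      simp [A.counit_act, mul_comm]
    | zero => simp
    | add x y _ _ hx hy => simp [hx, hy]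
    | smul a x _ hx => simp [hx]
  map_mkQ_comul_eq_zero := by
    intro x hx
    induction hx using Submodule.span_induction with
    | mem x hx =>
      obtain ⟨c, h, rfl⟩ := hx
      have key : ∀ (x : C ⊗[ℂ] C) (y : H ⊗[ℂ] H),
          TensorProduct.map A.coideal.mkQ A.coideal.mkQ
            (TensorProduct.map A.act A.act
              (TensorProduct.tensorTensorTensorComm ℂ C C H H (x ⊗ₜ[ℂ] y))) =
          counit (R := ℂ) (TensorProduct.lid ℂ H ((counit (R := ℂ)).rTensor H y)) •
            TensorProduct.map A.coideal.mkQ A.coideal.mkQ x := by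
        intro x y
        induction x with
        | zero => simp
        | add x x' hx hx' => simp only [TensorProduct.add_tmul, map_add, hx, hx', smul_add]
        | tmul c c' =>
          induction y with
          | zero => simp
          | add y y' hy hy' => simp only [TensorProduct.tmul_add, map_add, hy, hy', add_smul]
          | tmul h h' =>
            simp only [TensorProduct.tensorTensorTensorComm_tmul, TensorProduct.map_tmul,
              A.mkQ_act, LinearMap.rTensor_tmul, TensorProduct.lid_tmul, map_smul, smul_eq_mul,
              TensorProduct.smul_tmul_smul]
      rw [map_sub, map_sub, A.comul_act, key, rTensor_counit_comul]
      simp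
    | zero => simp
    | add x y _ _ hx hy => simp [hx, hy]
    | smul a x _ hx => simp [hx]

/-- The coalgebra `D = C / I`. -/
abbrev D : Type _ := C ⧸ A.coideal

/-- The projection `π : C → D`. -/
def proj : C →ₗ[ℂ] A.D := A.coideal.mkQ

theorem proj_act (c : C) (h : H) :
    A.proj (A.act (c ⊗ₜ[ℂ] h)) = counit (R := ℂ) h • A.proj c := A.mkQ_act c h

theorem comul_comp_proj : comul ∘ₗ A.proj = TensorProduct.map A.proj A.proj ∘ₗ comul := rfl

theorem counit_comp_proj : counit ∘ₗ A.proj = (counit : C →ₗ[ℂ] ℂ) := rfl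

/-- The left `D`-coaction on `C`, `c ↦ π(c₁) ⊗ c₂`. -/
def coL : C →ₗ[ℂ] A.D ⊗[ℂ] C := A.proj.rTensor C ∘ₗ comul

/-- The right `D`-coaction on `C`, `c ↦ c₁ ⊗ π(c₂)`. -/
def coR : C →ₗ[ℂ] C ⊗[ℂ] A.D := A.proj.lTensor C ∘ₗ comul

/-- The right `D`-coaction with the factor in `D` written first, `c ↦ π(c₂) ⊗ c₁`. -/
def coR' : C →ₗ[ℂ] A.D ⊗[ℂ] C := (TensorProduct.comm ℂ C A.D).toLinearMap ∘ₗ A.coR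

theorem coL_act (c : C) (h : H) : A.coL (A.act (c ⊗ₜ[ℂ] h)) =
    A.act.lTensor A.D (TensorProduct.assoc ℂ A.D C H (A.coL c ⊗ₜ[ℂ] h)) := by
  have key : ∀ (x : C ⊗[ℂ] C) (y : H ⊗[ℂ] H),
      A.proj.rTensor C (TensorProduct.map A.act A.act
          (TensorProduct.tensorTensorTensorComm ℂ C C H H (x ⊗ₜ[ℂ] y))) =
      A.act.lTensor A.D (TensorProduct.assoc ℂ A.D C H (A.proj.rTensor C x ⊗ₜ[ℂ]
        TensorProduct.lid ℂ H ((counit (R := ℂ)).rTensor H y))) := by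
    intro x y
    induction x with
    | zero => simp
    | add x x' hx hx' => simp only [TensorProduct.add_tmul, map_add, hx, hx']
    | tmul c c' =>
      induction y with
      | zero => simp
      | add y y' hy hy' => simp only [TensorProduct.tmul_add, map_add, hy, hy']
      | tmul h h' =>
        simp [A.proj_act, TensorProduct.smul_tmul']
  rw [coL, LinearMap.comp_apply, A.comul_act, key, rTensor_counit_comul]
  simp

theorem coR'_act (c : C) (h : H) : A.coR' (A.act (c ⊗ₜ[ℂ] h)) =
    A.act.lTensor A.D (TensorProduct.assoc ℂ A.D C H (A.coR' c ⊗ₜ[ℂ] h)) := by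
  have key : ∀ (x : C ⊗[ℂ] C) (y : H ⊗[ℂ] H),
      TensorProduct.comm ℂ C A.D (A.proj.lTensor C (TensorProduct.map A.act A.act
          (TensorProduct.tensorTensorTensorComm ℂ C C H H (x ⊗ₜ[ℂ] y)))) =
      A.act.lTensor A.D (TensorProduct.assoc ℂ A.D C H
        (TensorProduct.comm ℂ C A.D (A.proj.lTensor C x) ⊗ₜ[ℂ]
        TensorProduct.rid ℂ H ((counit (R := ℂ)).lTensor H y))) := by
    intro x y
    induction x with
    | zero => simp
    | add x x' hx hx' => simp only [TensorProduct.add_tmul, map_add, hx, hx']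
    | tmul c c' =>
      induction y with
      | zero => simp
      | add y y' hy hy' => simp only [TensorProduct.tmul_add, map_add, hy, hy']
      | tmul h h' => simp [A.proj_act]
  rw [coR', coR, LinearMap.comp_apply, LinearMap.comp_apply, A.comul_act, LinearEquiv.coe_coe, key,
    lTensor_counit_comul]
  simp

/-- The cotensor product `C □_D C`. -/
def cotensorSq : Submodule ℂ (C ⊗[ℂ] C) := cotensor A.coR A.coL

/-- `c ⊗ h ↦ c₁ ⊗ c₂ ◁ h`, with values in `C ⊗ C`. -/
def betaAmb : C ⊗[ℂ] H →ₗ[ℂ] C ⊗[ℂ] C :=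
  A.act.lTensor C ∘ₗ (TensorProduct.assoc ℂ C C H).toLinearMap ∘ₗ (comul (R := ℂ)).rTensor H

theorem assoc_coR_comul (c : C) : TensorProduct.assoc ℂ C A.D C (A.coR.rTensor C (comul c)) =
    A.coL.lTensor C (comul (R := ℂ) c) := by
  have : (TensorProduct.assoc ℂ C A.D C).toLinearMap ∘ₗ A.coR.rTensor C ∘ₗ comul =
      A.coL.lTensor C ∘ₗ comul (R := ℂ) := by
    simp only [coR, coL, coassoc_simps]
  exact LinearMap.congr_fun this c

theorem betaAmb_mem (x : C ⊗[ℂ] H) : A.betaAmb x ∈ A.cotensorSq := by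
  induction x with
  | zero => simp
  | add x y hx hy => rw [map_add]; exact add_mem hx hy
  | tmul c h =>
    change TensorProduct.assoc ℂ C A.D C (A.coR.rTensor C (A.betaAmb (c ⊗ₜ[ℂ] h))) =
      A.coL.lTensor C (A.betaAmb (c ⊗ₜ[ℂ] h))
    have h1 : ∀ x : C ⊗[ℂ] C, A.coL.lTensor C (A.act.lTensor C
        (TensorProduct.assoc ℂ C C H (x ⊗ₜ[ℂ] h))) =
        (A.act.lTensor A.D).lTensor C ((TensorProduct.assoc ℂ A.D C H).toLinearMap.lTensor C
          (TensorProduct.assoc ℂ C (A.D ⊗[ℂ] C) H (A.coL.lTensor C x ⊗ₜ[ℂ] h))) := by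
      intro x
      induction x with
      | zero => simp
      | add x x' hx hx' => simp only [TensorProduct.add_tmul, map_add, hx, hx']
      | tmul c c' => simp [A.coL_act]
    have h2 : ∀ x : C ⊗[ℂ] C, TensorProduct.assoc ℂ C A.D C (A.coR.rTensor C (A.act.lTensor C
        (TensorProduct.assoc ℂ C C H (x ⊗ₜ[ℂ] h)))) =
        (A.act.lTensor A.D).lTensor C ((TensorProduct.assoc ℂ A.D C H).toLinearMap.lTensor C
          (TensorProduct.assoc ℂ C (A.D ⊗[ℂ] C) H
            (TensorProduct.assoc ℂ C A.D C (A.coR.rTensor C x) ⊗ₜ[ℂ] h))) := by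
      intro x
      induction x with
      | zero => simp
      | add x x' hx hx' => simp only [TensorProduct.add_tmul, map_add, hx, hx']
      | tmul c c' =>
        simp only [TensorProduct.assoc_tmul, LinearMap.lTensor_tmul, LinearMap.rTensor_tmul]
        induction A.coR c with
        | zero => simp
        | add x x' hx hx' => simp only [TensorProduct.add_tmul, map_add, hx, hx']
        | tmul d e => simp
    simp only [betaAmb, LinearMap.comp_apply, LinearMap.rTensor_tmul, LinearEquiv.coe_coe]
    rw [h1, h2, A.assoc_coR_comul]

/-- The canonical (Galois) map `β : C ⊗ H → C □_D C`, `c ⊗ h ↦ c₁ ⊗ c₂ ◁ h`. -/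
def beta : C ⊗[ℂ] H →ₗ[ℂ] A.cotensorSq := A.betaAmb.codRestrict _ A.betaAmb_mem

/-- `C ↠ D` is a Hopf-Galois coextension: the canonical map is bijective. -/
def IsHopfGalois : Prop := Function.Bijective A.beta

variable {A} in
/-- `κ = (ε ⊗ id) ∘ β⁻¹ : C □_D C → H`. -/
def kappa (hA : A.IsHopfGalois) : A.cotensorSq →ₗ[ℂ] H :=
  (TensorProduct.lid ℂ H).toLinearMap ∘ₗ (counit (R := ℂ)).rTensor H ∘ₗ
    (LinearEquiv.ofBijective A.beta hA).symm.toLinearMap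

/-- `C^D`, the space of those `c` with `π(c₁) ⊗ c₂ = π(c₂) ⊗ c₁`. -/
def invariants : Submodule ℂ C := LinearMap.eqLocus A.coL A.coR'

/-- The right coaction of `D^e = D ⊗ D_cop` on `D`, `d ↦ d₂ ⊗ (d₃ ⊗ d₁)`. -/
def coDe : A.D →ₗ[ℂ] A.D ⊗[ℂ] (A.D ⊗[ℂ] A.D) :=
  (TensorProduct.assoc ℂ A.D A.D A.D).toLinearMap ∘ₗ
    (TensorProduct.comm ℂ A.D (A.D ⊗[ℂ] A.D)).toLinearMap ∘ₗ comul.lTensor A.D ∘ₗ comul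

/-- The left coaction of `D^e = D ⊗ D_cop` on `C`, `c ↦ (π(c₁) ⊗ π(c₃)) ⊗ c₂`. -/
def coCe : C →ₗ[ℂ] (A.D ⊗[ℂ] A.D) ⊗[ℂ] C :=
  (TensorProduct.assoc ℂ A.D A.D C).symm.toLinearMap ∘ₗ
    TensorProduct.map A.proj (A.proj.rTensor C ∘ₗ (TensorProduct.comm ℂ C C).toLinearMap) ∘ₗ
    comul.lTensor C ∘ₗ comul

/-- `M̃ = D □_{D^e} C`. -/
def tildeM : Submodule ℂ (A.D ⊗[ℂ] C) := cotensor A.coDe A.coCe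

/-- `d ⊗ v ↦ ε(d) v` -/
def epsD (V : Type*) [AddCommGroup V] [Module ℂ V] : A.D ⊗[ℂ] V →ₗ[ℂ] V :=
  (TensorProduct.lid ℂ V).toLinearMap ∘ₗ (counit (R := ℂ)).rTensor V

/-- `d ⊗ (d' ⊗ d'') ⊗ v ↦ ε(d) ε(d'') d' ⊗ v`. -/
def contrL : A.D ⊗[ℂ] ((A.D ⊗[ℂ] A.D) ⊗[ℂ] C) →ₗ[ℂ] A.D ⊗[ℂ] C :=
  A.epsD (A.D ⊗[ℂ] C) ∘ₗ
    (((TensorProduct.rid ℂ A.D).toLinearMap ∘ₗ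
      (counit (R := ℂ)).lTensor A.D).rTensor C).lTensor A.D

/-- `d ⊗ (d' ⊗ d'') ⊗ v ↦ ε(d) ε(d') d'' ⊗ v`. -/
def contrR : A.D ⊗[ℂ] ((A.D ⊗[ℂ] A.D) ⊗[ℂ] C) →ₗ[ℂ] A.D ⊗[ℂ] C :=
  A.epsD (A.D ⊗[ℂ] C) ∘ₗ ((A.epsD A.D).rTensor C).lTensor A.D

theorem epsD_tmul {V : Type*} [AddCommGroup V] [Module ℂ V] (d : A.D) (v : V) :
    A.epsD V (d ⊗ₜ[ℂ] v) = counit (R := ℂ) d • v := by simp [epsD]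

theorem epsD_coL (c : C) : A.epsD C (A.coL c) = c := by
  have : ∀ x : C ⊗[ℂ] C, A.epsD C (A.proj.rTensor C x) =
      TensorProduct.lid ℂ C ((counit (R := ℂ)).rTensor C x) := by
    intro x
    induction x with
    | zero => simp
    | add x x' hx hx' => simp only [map_add, hx, hx']
    | tmul c c' => rw [LinearMap.rTensor_tmul, epsD_tmul]; simp; rfl
  rw [coL, LinearMap.comp_apply, this, rTensor_counit_comul]; simp

theorem coL_epsD (x : A.D ⊗[ℂ] C) (hx : x ∈ A.tildeM) : A.coL (A.epsD C x) = x := by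
  have h1 : A.contrL ∘ₗ ((TensorProduct.assoc ℂ A.D (A.D ⊗[ℂ] A.D) C).toLinearMap ∘ₗ
      A.coDe.rTensor C) = LinearMap.id := by
    refine TensorProduct.ext' fun d c => ?_
    have key : ∀ s : A.D ⊗[ℂ] A.D, A.contrL (TensorProduct.assoc ℂ A.D (A.D ⊗[ℂ] A.D) C
        (TensorProduct.assoc ℂ A.D A.D A.D (TensorProduct.comm ℂ A.D (A.D ⊗[ℂ] A.D)
          (comul.lTensor A.D s)) ⊗ₜ[ℂ] c)) =
        TensorProduct.lid ℂ A.D ((counit (R := ℂ)).rTensor A.D s) ⊗ₜ[ℂ] c := by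
      intro s
      induction s with
      | zero => simp
      | add x y hx hy => simp only [TensorProduct.add_tmul, map_add, hx, hy]
      | tmul a b =>
        have : ∀ t : A.D ⊗[ℂ] A.D, A.contrL (TensorProduct.assoc ℂ A.D (A.D ⊗[ℂ] A.D) C
            (TensorProduct.assoc ℂ A.D A.D A.D (TensorProduct.comm ℂ A.D (A.D ⊗[ℂ] A.D)
              (a ⊗ₜ[ℂ] t)) ⊗ₜ[ℂ] c)) =
            (counit (R := ℂ) a • TensorProduct.lid ℂ A.D ((counit (R := ℂ)).rTensor A.D t))
              ⊗ₜ[ℂ] c := by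
          intro t
          induction t with
          | zero => simp
          | add x y hx hy =>
            simp only [TensorProduct.tmul_add, TensorProduct.add_tmul, map_add, hx, hy, smul_add]
          | tmul p q =>
            simp [contrL, epsD, TensorProduct.smul_tmul', smul_smul, mul_comm]
        rw [LinearMap.lTensor_tmul, this, rTensor_counit_comul]
        simp
    have := key (comul d)
    rw [rTensor_counit_comul] at this
    simpa [coDe] using this
  have h2 : A.contrL ∘ₗ A.coCe.lTensor A.D = A.coL ∘ₗ A.epsD C := by
    refine TensorProduct.ext' fun d c => ?_
    have key : ∀ s : C ⊗[ℂ] C, A.contrL (d ⊗ₜ[ℂ] (TensorProduct.assoc ℂ A.D A.D C).symm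
        (TensorProduct.map A.proj (A.proj.rTensor C ∘ₗ (TensorProduct.comm ℂ C C).toLinearMap)
          (comul.lTensor C s))) = counit (R := ℂ) d • A.proj.rTensor C s := by
      intro s
      induction s with
      | zero => simp
      | add x y hx hy => simp only [TensorProduct.tmul_add, map_add, hx, hy, smul_add]
      | tmul a b =>
        have : ∀ t : C ⊗[ℂ] C, A.contrL (d ⊗ₜ[ℂ] (TensorProduct.assoc ℂ A.D A.D C).symm
            (TensorProduct.map A.proj (A.proj.rTensor C ∘ₗ
              (TensorProduct.comm ℂ C C).toLinearMap) (a ⊗ₜ[ℂ] t))) =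
            counit (R := ℂ) d • (A.proj a ⊗ₜ[ℂ]
              TensorProduct.rid ℂ C ((counit (R := ℂ)).lTensor C t)) := by
          intro t
          induction t with
          | zero => simp
          | add x y hx hy =>
            simp only [TensorProduct.tmul_add, map_add, hx, hy, smul_add]
          | tmul p q =>
            have : counit (R := ℂ) (A.proj q) = counit (R := ℂ) q := rfl
            simp [contrL, epsD, this, TensorProduct.smul_tmul, smul_comm (counit (R := ℂ) q)]
        rw [LinearMap.lTensor_tmul, this, lTensor_counit_comul]
        simp
    simpa [coCe, coL, epsD] using key (comul c)
  have h := congrArg A.contrL (show _ = _ from hx)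
  exact (LinearMap.congr_fun h2 x).symm.trans (h.symm.trans (LinearMap.congr_fun h1 x))

theorem coR'_epsD (x : A.D ⊗[ℂ] C) (hx : x ∈ A.tildeM) : A.coR' (A.epsD C x) = x := by
  have h1 : A.contrR ∘ₗ ((TensorProduct.assoc ℂ A.D (A.D ⊗[ℂ] A.D) C).toLinearMap ∘ₗ
      A.coDe.rTensor C) = LinearMap.id := by
    refine TensorProduct.ext' fun d c => ?_
    have key : ∀ s : A.D ⊗[ℂ] A.D, A.contrR (TensorProduct.assoc ℂ A.D (A.D ⊗[ℂ] A.D) C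
        (TensorProduct.assoc ℂ A.D A.D A.D (TensorProduct.comm ℂ A.D (A.D ⊗[ℂ] A.D)
          (comul.lTensor A.D s)) ⊗ₜ[ℂ] c)) =
        TensorProduct.rid ℂ A.D ((counit (R := ℂ)).lTensor A.D s) ⊗ₜ[ℂ] c := by
      intro s
      induction s with
      | zero => simp
      | add x y hx hy => simp only [TensorProduct.add_tmul, map_add, hx, hy]
      | tmul a b =>
        have : ∀ t : A.D ⊗[ℂ] A.D, A.contrR (TensorProduct.assoc ℂ A.D (A.D ⊗[ℂ] A.D) C
            (TensorProduct.assoc ℂ A.D A.D A.D (TensorProduct.comm ℂ A.D (A.D ⊗[ℂ] A.D)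
              (a ⊗ₜ[ℂ] t)) ⊗ₜ[ℂ] c)) =
            (counit (R := ℂ) (TensorProduct.lid ℂ A.D ((counit (R := ℂ)).rTensor A.D t)) • a)
              ⊗ₜ[ℂ] c := by
          intro t
          induction t with
          | zero => simp
          | add x y hx hy =>
            simp only [TensorProduct.tmul_add, TensorProduct.add_tmul, map_add, hx, hy, add_smul]
          | tmul p q =>
            simp [contrR, epsD, TensorProduct.smul_tmul', smul_smul]
        rw [LinearMap.lTensor_tmul, this, rTensor_counit_comul]
        simp
    have := key (comul d)
    rw [lTensor_counit_comul] at this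
    simpa [coDe] using this
  have h2 : A.contrR ∘ₗ A.coCe.lTensor A.D = A.coR' ∘ₗ A.epsD C := by
    refine TensorProduct.ext' fun d c => ?_
    have key : ∀ s : C ⊗[ℂ] C, A.contrR (d ⊗ₜ[ℂ] (TensorProduct.assoc ℂ A.D A.D C).symm
        (TensorProduct.map A.proj (A.proj.rTensor C ∘ₗ (TensorProduct.comm ℂ C C).toLinearMap)
          (comul.lTensor C s))) = counit (R := ℂ) d •
          A.coR' (TensorProduct.lid ℂ C ((counit (R := ℂ)).rTensor C s)) := by
      intro s
      induction s with
      | zero => simp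
      | add x y hx hy => simp only [TensorProduct.tmul_add, map_add, hx, hy, smul_add]
      | tmul a b =>
        have : ∀ t : C ⊗[ℂ] C, A.contrR (d ⊗ₜ[ℂ] (TensorProduct.assoc ℂ A.D A.D C).symm
            (TensorProduct.map A.proj (A.proj.rTensor C ∘ₗ
              (TensorProduct.comm ℂ C C).toLinearMap) (a ⊗ₜ[ℂ] t))) =
            counit (R := ℂ) d • counit (R := ℂ) a •
              TensorProduct.comm ℂ C A.D (A.proj.lTensor C t) := by
          intro t
          induction t with
          | zero => simp
          | add x y hx hy =>
            simp only [TensorProduct.tmul_add, map_add, hx, hy, smul_add]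
          | tmul p q =>
            have : counit (R := ℂ) (A.proj a) = counit (R := ℂ) a := rfl
            simp [contrR, epsD, this, TensorProduct.smul_tmul']
        rw [LinearMap.lTensor_tmul, this]
        simp [coR', coR]
    have := key (comul c)
    rw [rTensor_counit_comul] at this
    simpa [coCe, epsD] using this
  have h := congrArg A.contrR (show _ = _ from hx)
  exact (LinearMap.congr_fun h2 x).symm.trans (h.symm.trans (LinearMap.congr_fun h1 x))

/-- The iterated comultiplication `c ↦ c₁ ⊗ c₂ ⊗ c₃`. -/
def comul3 : C →ₗ[ℂ] C ⊗[ℂ] (C ⊗[ℂ] C) := comul.lTensor C ∘ₗ comul (R := ℂ)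

theorem lTensor_comul3 (c : C) : (comul3 : C →ₗ[ℂ] _).lTensor C (comul (R := ℂ) c) =
    (TensorProduct.assoc ℂ C C C).toLinearMap.lTensor C
      (TensorProduct.assoc ℂ C (C ⊗[ℂ] C) C (comul3.rTensor C (comul (R := ℂ) c))) := by
  have : (comul3 : C →ₗ[ℂ] _).lTensor C ∘ₗ comul =
      (TensorProduct.assoc ℂ C C C).toLinearMap.lTensor C ∘ₗ
      (TensorProduct.assoc ℂ C (C ⊗[ℂ] C) C).toLinearMap ∘ₗ comul3.rTensor C ∘ₗ comul := by
    simp only [comul3, coassoc_simps]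
  exact LinearMap.congr_fun this c

theorem coDe_proj (c : C) : A.coDe (A.proj c) = TensorProduct.assoc ℂ A.D A.D A.D
    (TensorProduct.comm ℂ A.D (A.D ⊗[ℂ] A.D)
      (TensorProduct.map A.proj (TensorProduct.map A.proj A.proj) (comul3 c))) := by
  have : A.coDe ∘ₗ A.proj = (TensorProduct.assoc ℂ A.D A.D A.D).toLinearMap ∘ₗ
      (TensorProduct.comm ℂ A.D (A.D ⊗[ℂ] A.D)).toLinearMap ∘ₗ
      TensorProduct.map A.proj (TensorProduct.map A.proj A.proj) ∘ₗ comul3 := by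
    simp only [coDe, comul3, coassoc_simps, comul_comp_proj]
  exact LinearMap.congr_fun this c

/-- `d ⊗ c ⊗ c' ⊗ c'' ↦ π(c) ⊗ (π(c') ⊗ d) ⊗ c''`. -/
def rot : A.D ⊗[ℂ] (C ⊗[ℂ] (C ⊗[ℂ] C)) →ₗ[ℂ] A.D ⊗[ℂ] ((A.D ⊗[ℂ] A.D) ⊗[ℂ] C) :=
  (((TensorProduct.comm ℂ A.D A.D).toLinearMap.rTensor C) ∘ₗ
      (TensorProduct.assoc ℂ A.D A.D C).symm.toLinearMap).lTensor A.D ∘ₗ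
    (TensorProduct.leftComm ℂ A.D A.D (A.D ⊗[ℂ] C)).toLinearMap ∘ₗ
     (TensorProduct.map A.proj (A.proj.rTensor C)).lTensor A.D

theorem rTensor_proj_comm {V W : Type*} [AddCommGroup V] [Module ℂ V] [AddCommGroup W]
    [Module ℂ W] (f : V →ₗ[ℂ] W) (x : C ⊗[ℂ] V) :
    f.lTensor A.D (A.proj.rTensor V x) = A.proj.rTensor W (f.lTensor C x) := by
  rw [← LinearMap.comp_apply, ← LinearMap.comp_apply, LinearMap.lTensor_comp_rTensor,
    LinearMap.rTensor_comp_lTensor]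

theorem coL_mem (c : C) (hc : c ∈ A.invariants) : A.coL c ∈ A.tildeM := by
  have h1 : TensorProduct.assoc ℂ A.D (A.D ⊗[ℂ] A.D) C (A.coDe.rTensor C (A.coL c)) =
      A.rot (comul3.lTensor A.D (A.coL c)) := by
    have e1 : ∀ s : C ⊗[ℂ] C, A.coDe.rTensor C (A.proj.rTensor C s) =
        ((TensorProduct.assoc ℂ A.D A.D A.D).toLinearMap ∘ₗ
          (TensorProduct.comm ℂ A.D (A.D ⊗[ℂ] A.D)).toLinearMap ∘ₗ
          TensorProduct.map A.proj (TensorProduct.map A.proj A.proj)).rTensor C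
            (comul3.rTensor C s) := by
      intro s
      rw [← LinearMap.comp_apply, ← LinearMap.comp_apply, ← LinearMap.rTensor_comp,
        ← LinearMap.rTensor_comp]
      congr 2
      ext c
      exact A.coDe_proj c
    rw [coL, LinearMap.comp_apply, e1, A.rTensor_proj_comm, lTensor_comul3]
    generalize comul3.rTensor C (comul (R := ℂ) c) = U
    induction U with
    | zero => simp
    | add x y hx hy => simp only [map_add, hx, hy]
    | tmul x d =>
      induction x with
      | zero => simp
      | add x y hx hy => simp only [TensorProduct.add_tmul, map_add, hx, hy]
      | tmul a y =>
        induction y with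
        | zero => simp
        | add x y hx hy =>
          simp only [TensorProduct.tmul_add, TensorProduct.add_tmul, map_add, hx, hy]
        | tmul b b' => simp [rot]
  have h2 : A.coCe.lTensor A.D (A.coL c) = A.rot (comul3.lTensor A.D (A.coR' c)) := by
    have e1 : ∀ s : C ⊗[ℂ] C, comul3.lTensor A.D (TensorProduct.comm ℂ C A.D
        (A.proj.lTensor C s)) =
        TensorProduct.comm ℂ _ A.D (A.proj.lTensor _ (comul3.rTensor C s)) := by
      intro s
      induction s with
      | zero => simp
      | add x y hx hy => simp only [map_add, hx, hy]
      | tmul a b => simp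
    have e2 : A.coCe = ((TensorProduct.assoc ℂ A.D A.D C).symm.toLinearMap ∘ₗ
      TensorProduct.map A.proj (A.proj.rTensor C ∘ₗ (TensorProduct.comm ℂ C C).toLinearMap)) ∘ₗ
        comul3 := rfl
    rw [coR', coR, LinearMap.comp_apply, LinearMap.comp_apply, LinearEquiv.coe_coe, e1, coL,
      LinearMap.comp_apply, e2, LinearMap.lTensor_comp, LinearMap.comp_apply,
      A.rTensor_proj_comm, lTensor_comul3]
    generalize comul3.rTensor C (comul (R := ℂ) c) = U
    induction U with
    | zero => simp
    | add x y hx hy => simp only [map_add, hx, hy]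
    | tmul x d =>
      induction x with
      | zero => simp
      | add x y hx hy => simp only [TensorProduct.add_tmul, map_add, hx, hy]
      | tmul a y =>
        induction y with
        | zero => simp
        | add x y hx hy =>
          simp only [TensorProduct.tmul_add, TensorProduct.add_tmul, map_add, hx, hy]
        | tmul b b' => simp [rot]
  exact h1.trans ((congrArg (fun z => A.rot (comul3.lTensor A.D z))
    (show A.coL c = A.coR' c from hc)).trans h2.symm)

/-- The isomorphism `ξ : D □_{D^e} C ≃ C^D`, `d ⊗ c ↦ ε(d) c`, with inverse
`c ↦ π(c₁) ⊗ c₂`. -/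
def xi : A.tildeM ≃ₗ[ℂ] A.invariants where
  toLinearMap := (A.epsD C ∘ₗ A.tildeM.subtype).codRestrict A.invariants fun x =>
    (A.coL_epsD x x.2).trans (A.coR'_epsD x x.2).symm
  invFun c := ⟨A.coL c, A.coL_mem c c.2⟩
  left_inv x := Subtype.ext (A.coL_epsD x x.2)
  right_inv c := Subtype.ext (A.epsD_coL c)

/-! ### action -/

theorem act_mem (c : C) (hc : c ∈ A.invariants) (h : H) :
    A.act (c ⊗ₜ[ℂ] h) ∈ A.invariants := by
  change A.coL _ = A.coR' _
  rw [A.coL_act, A.coR'_act, show A.coL c = A.coR' c from hc]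

theorem act_tilde_mem (x : A.tildeM ⊗[ℂ] H) :
    A.act.lTensor A.D (TensorProduct.assoc ℂ A.D C H (A.tildeM.subtype.rTensor H x)) ∈
      A.tildeM := by
  induction x with
  | zero => simp
  | add x y hx hy => simp only [map_add]; exact add_mem hx hy
  | tmul m h =>
    have := A.coL_mem _ (A.act_mem _ (A.xi m).2 h)
    rw [A.coL_act, show A.coL (A.xi m) = m from A.coL_epsD m m.2] at this
    exact this

/-- The right action `(d ⊗ c) ◁ h = d ⊗ c ◁ h` of `H` on `M̃`. -/
def tildeAct : A.tildeM ⊗[ℂ] H →ₗ[ℂ] A.tildeM :=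
  (A.act.lTensor A.D ∘ₗ (TensorProduct.assoc ℂ A.D C H).toLinearMap ∘ₗ
    A.tildeM.subtype.rTensor H).codRestrict A.tildeM A.act_tilde_mem

/-! ### The left coaction of `H` on `C^D` and on `M̃` -/

/-- `c ↦ c₂ ⊗ c₃ ⊗ c₁` -/
def comulRot : C →ₗ[ℂ] C ⊗[ℂ] (C ⊗[ℂ] C) :=
  (TensorProduct.assoc ℂ C C C).toLinearMap ∘ₗ
    (TensorProduct.comm ℂ C (C ⊗[ℂ] C)).toLinearMap ∘ₗ comul3

theorem assoc_rTensor_comul (c : C) :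
    TensorProduct.assoc ℂ C C C (comul.rTensor C (comul (R := ℂ) c)) =
      comul.lTensor C (comul (R := ℂ) c) := coassoc_apply c

theorem comulRot_eq (c : C) : comulRot c = TensorProduct.assoc ℂ C C C
    (comul.rTensor C (TensorProduct.comm ℂ C C (comul (R := ℂ) c))) := by
  have : ∀ s : C ⊗[ℂ] C, TensorProduct.comm ℂ C (C ⊗[ℂ] C) (comul.lTensor C s) =
      comul.rTensor C (TensorProduct.comm ℂ C C s) := by
    intro s
    induction s with
    | zero => simp
    | add x y hx hy => simp only [map_add, hx, hy]
    | tmul a b => simp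
  simp [comulRot, comul3, this]

/-- For `c ∈ C^D`, `c₂ ⊗ c₁ ∈ C □_D C`. -/
theorem comm_comul_mem (c : C) (hc : c ∈ A.invariants) :
    TensorProduct.comm ℂ C C (comul (R := ℂ) c) ∈ A.cotensorSq := by
  let P : C ⊗[ℂ] (C ⊗[ℂ] C) →ₗ[ℂ] C ⊗[ℂ] (A.D ⊗[ℂ] C) := (A.proj.rTensor C).lTensor C ∘ₗ
    (TensorProduct.assoc ℂ C C C).toLinearMap ∘ₗ (TensorProduct.comm ℂ C (C ⊗[ℂ] C)).toLinearMap
  let Q : (C ⊗[ℂ] C) ⊗[ℂ] C →ₗ[ℂ] C ⊗[ℂ] (A.D ⊗[ℂ] C) := (A.proj.rTensor C).lTensor C ∘ₗ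
    (TensorProduct.comm ℂ (C ⊗[ℂ] C) C).toLinearMap
  let R : A.D ⊗[ℂ] C →ₗ[ℂ] C ⊗[ℂ] (A.D ⊗[ℂ] C) :=
    (TensorProduct.leftComm ℂ A.D C C).toLinearMap ∘ₗ
      ((TensorProduct.comm ℂ C C).toLinearMap ∘ₗ comul (R := ℂ)).lTensor A.D
  have e1 : ∀ s : C ⊗[ℂ] C, TensorProduct.assoc ℂ C A.D C
      (A.coR.rTensor C (TensorProduct.comm ℂ C C s)) = P (comul.lTensor C s) := by
    intro s
    induction s with
    | zero => simp
    | add x y hx hy => simp only [map_add, hx, hy]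
    | tmul a b =>
      simp only [TensorProduct.comm_tmul, LinearMap.rTensor_tmul, LinearMap.lTensor_tmul, coR,
        LinearMap.comp_apply]
      induction comul (R := ℂ) b with
      | zero => simp
      | add x y hx hy => simp only [TensorProduct.tmul_add, TensorProduct.add_tmul, map_add, hx, hy]
      | tmul b b' => simp [P]
  have e2 : ∀ s : C ⊗[ℂ] C, R (TensorProduct.comm ℂ C A.D (A.proj.lTensor C s)) =
      P (TensorProduct.assoc ℂ C C C (comul.rTensor C s)) := by
    intro s
    induction s with
    | zero => simp
    | add x y hx hy => simp only [map_add, hx, hy]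
    | tmul a b =>
      simp only [TensorProduct.comm_tmul, LinearMap.rTensor_tmul, LinearMap.lTensor_tmul, R,
        LinearMap.comp_apply]
      induction comul (R := ℂ) a with
      | zero => simp
      | add x y hx hy => simp only [TensorProduct.tmul_add, TensorProduct.add_tmul, map_add, hx, hy]
      | tmul b b' => simp [P]
  have e3 : ∀ s : C ⊗[ℂ] C, A.coL.lTensor C (TensorProduct.comm ℂ C C s) =
      Q (comul.rTensor C s) := by
    intro s
    induction s with
    | zero => simp
    | add x y hx hy => simp only [map_add, hx, hy]
    | tmul a b => simp [Q, coL]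
  have e4 : ∀ s : C ⊗[ℂ] C, R (A.proj.rTensor C s) =
      Q ((TensorProduct.assoc ℂ C C C).symm (comul.lTensor C s)) := by
    intro s
    induction s with
    | zero => simp
    | add x y hx hy => simp only [map_add, hx, hy]
    | tmul a b =>
      simp only [LinearMap.rTensor_tmul, LinearMap.lTensor_tmul, R, LinearMap.comp_apply]
      induction comul (R := ℂ) b with
      | zero => simp
      | add x y hx hy => simp only [TensorProduct.tmul_add, map_add, hx, hy]
      | tmul b b' => simp [Q]
  change TensorProduct.assoc ℂ C A.D C (A.coR.rTensor C _) = A.coL.lTensor C _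
  rw [e1, e3, ← assoc_rTensor_comul, ← e2]
  change R (A.coR' c) = _
  rw [show A.coR' c = A.coL c from hc.symm]
  have h4 := e4 (comul c)
  rw [← assoc_rTensor_comul, LinearEquiv.symm_apply_apply] at h4
  exact h4

/-- The Galois map is left `C`-colinear. -/
theorem betaAmb_colinear (z : C ⊗[ℂ] H) :
    TensorProduct.assoc ℂ C C C (comul.rTensor C (A.betaAmb z)) =
      A.betaAmb.lTensor C (TensorProduct.assoc ℂ C C H (comul.rTensor H z)) := by
  induction z with
  | zero => simp
  | add x y hx hy => simp only [map_add, hx, hy]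
  | tmul c h =>
    let R : C ⊗[ℂ] (C ⊗[ℂ] C) →ₗ[ℂ] C ⊗[ℂ] (C ⊗[ℂ] C) :=
      (A.act.lTensor C ∘ₗ (TensorProduct.assoc ℂ C C H).toLinearMap ∘ₗ
        (TensorProduct.mk ℂ (C ⊗[ℂ] C) H).flip h).lTensor C
    have e1 : ∀ s : C ⊗[ℂ] C, TensorProduct.assoc ℂ C C C (comul.rTensor C
        (A.act.lTensor C (TensorProduct.assoc ℂ C C H (s ⊗ₜ[ℂ] h)))) =
        R (TensorProduct.assoc ℂ C C C (comul.rTensor C s)) := by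
      intro s
      induction s with
      | zero => simp
      | add x y hx hy => simp only [TensorProduct.add_tmul, map_add, hx, hy]
      | tmul a b =>
        simp only [LinearMap.rTensor_tmul, LinearMap.lTensor_tmul, TensorProduct.assoc_tmul]
        induction comul (R := ℂ) a with
        | zero => simp
        | add x y hx hy => simp only [TensorProduct.add_tmul, map_add, hx, hy]
        | tmul b b' => simp [R]
    have e2 : ∀ s : C ⊗[ℂ] C, A.betaAmb.lTensor C (TensorProduct.assoc ℂ C C H (s ⊗ₜ[ℂ] h)) =
        R (comul.lTensor C s) := by
      intro s
      induction s with
      | zero => simp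
      | add x y hx hy => simp only [TensorProduct.add_tmul, map_add, hx, hy]
      | tmul a b => simp [R, betaAmb]
    rw [LinearMap.rTensor_tmul, e2, ← assoc_rTensor_comul, ← e1]
    simp [betaAmb]

theorem assoc_coL {V : Type*} [AddCommGroup V] [Module ℂ V] (x : C ⊗[ℂ] V) :
    TensorProduct.assoc ℂ A.D C V (A.coL.rTensor V x) =
      A.proj.rTensor (C ⊗[ℂ] V) (TensorProduct.assoc ℂ C C V (comul.rTensor V x)) := by
  induction x with
  | zero => simp
  | add x y hx hy => simp only [map_add, hx, hy]
  | tmul a b =>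
    simp only [LinearMap.rTensor_tmul, coL, LinearMap.comp_apply]
    induction comul (R := ℂ) a with
    | zero => simp
    | add x y hx hy => simp only [TensorProduct.add_tmul, map_add, hx, hy]
    | tmul b b' => simp

theorem betaAmb_coL (z : C ⊗[ℂ] H) :
    A.betaAmb.lTensor A.D (TensorProduct.assoc ℂ A.D C H (A.coL.rTensor H z)) =
      TensorProduct.assoc ℂ A.D C C (A.coL.rTensor C (A.betaAmb z)) := by
  rw [assoc_coL, assoc_coL, betaAmb_colinear, rTensor_proj_comm]

theorem betaAmb_coR' (z : C ⊗[ℂ] H) :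
    A.betaAmb.lTensor A.D (TensorProduct.assoc ℂ A.D C H (A.coR'.rTensor H z)) =
      TensorProduct.leftComm ℂ C A.D C (A.coR'.lTensor C (A.betaAmb z)) := by
  induction z with
  | zero => simp
  | add x y hx hy => simp only [map_add, hx, hy]
  | tmul c h =>
    let R : C ⊗[ℂ] (C ⊗[ℂ] C) →ₗ[ℂ] A.D ⊗[ℂ] (C ⊗[ℂ] C) :=
      TensorProduct.map A.proj ((A.act ∘ₗ (TensorProduct.mk ℂ C H).flip h).lTensor C) ∘ₗ
      (TensorProduct.comm ℂ (C ⊗[ℂ] C) C).toLinearMap ∘ₗ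
        (TensorProduct.assoc ℂ C C C).symm.toLinearMap
    have e1 : ∀ s : C ⊗[ℂ] C, A.betaAmb.lTensor A.D (TensorProduct.assoc ℂ A.D C H
        (TensorProduct.comm ℂ C A.D (A.proj.lTensor C s) ⊗ₜ[ℂ] h)) =
        R (TensorProduct.assoc ℂ C C C (comul.rTensor C s)) := by
      intro s
      induction s with
      | zero => simp
      | add x y hx hy => simp only [TensorProduct.add_tmul, map_add, hx, hy]
      | tmul a b =>
        simp only [betaAmb, LinearMap.rTensor_tmul, LinearMap.lTensor_tmul,
          TensorProduct.assoc_tmul, TensorProduct.comm_tmul, LinearMap.comp_apply]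
        induction comul (R := ℂ) a with
        | zero => simp
        | add x y hx hy =>
          simp only [TensorProduct.add_tmul, TensorProduct.tmul_add, map_add, hx, hy]
        | tmul b b' => simp [R]
    have e2 : ∀ s : C ⊗[ℂ] C, TensorProduct.leftComm ℂ C A.D C (A.coR'.lTensor C
        (A.act.lTensor C (TensorProduct.assoc ℂ C C H (s ⊗ₜ[ℂ] h)))) =
        R (comul.lTensor C s) := by
      intro s
      induction s with
      | zero => simp
      | add x y hx hy => simp only [TensorProduct.add_tmul, map_add, hx, hy]
      | tmul a b =>
        simp only [LinearMap.lTensor_tmul, TensorProduct.assoc_tmul, A.coR'_act]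
        simp only [coR', coR, LinearMap.comp_apply]
        induction comul (R := ℂ) b with
        | zero => simp
        | add x y hx hy =>
          simp only [TensorProduct.add_tmul, TensorProduct.tmul_add, map_add, hx, hy]
        | tmul b b' => simp [R]
    have h3 := e2 (comul c)
    rw [← assoc_rTensor_comul, ← e1] at h3
    simpa [betaAmb, coR', coR] using h3.symm

theorem coL_comm_comul (c : C) :
    TensorProduct.assoc ℂ A.D C C (A.coL.rTensor C (TensorProduct.comm ℂ C C (comul (R := ℂ) c)))
      = TensorProduct.leftComm ℂ C A.D C (A.coR'.lTensor C
        (TensorProduct.comm ℂ C C (comul (R := ℂ) c))) := by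
  let R : C ⊗[ℂ] (C ⊗[ℂ] C) →ₗ[ℂ] A.D ⊗[ℂ] (C ⊗[ℂ] C) := A.proj.rTensor (C ⊗[ℂ] C) ∘ₗ
    (TensorProduct.assoc ℂ C C C).toLinearMap ∘ₗ (TensorProduct.comm ℂ C (C ⊗[ℂ] C)).toLinearMap
  have e1 : ∀ s : C ⊗[ℂ] C, TensorProduct.assoc ℂ A.D C C (A.coL.rTensor C
      (TensorProduct.comm ℂ C C s)) = R (comul.lTensor C s) := by
    intro s
    induction s with
    | zero => simp
    | add x y hx hy => simp only [map_add, hx, hy]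
    | tmul a b =>
      simp only [TensorProduct.comm_tmul, LinearMap.rTensor_tmul, LinearMap.lTensor_tmul, coL,
        LinearMap.comp_apply]
      induction comul (R := ℂ) b with
      | zero => simp
      | add x y hx hy => simp only [TensorProduct.tmul_add, TensorProduct.add_tmul, map_add, hx, hy]
      | tmul b b' => simp [R]
  have e2 : ∀ s : C ⊗[ℂ] C, TensorProduct.leftComm ℂ C A.D C (A.coR'.lTensor C
      (TensorProduct.comm ℂ C C s)) = R (TensorProduct.assoc ℂ C C C (comul.rTensor C s)) := by
    intro s
    induction s with
    | zero => simp
    | add x y hx hy => simp only [map_add, hx, hy]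
    | tmul a b =>
      simp only [TensorProduct.comm_tmul, LinearMap.rTensor_tmul, LinearMap.lTensor_tmul, coR', coR,
        LinearMap.comp_apply]
      induction comul (R := ℂ) a with
      | zero => simp
      | add x y hx hy => simp only [TensorProduct.tmul_add, TensorProduct.add_tmul, map_add, hx, hy]
      | tmul b b' => simp [R]
  rw [e1, e2, assoc_rTensor_comul]

variable {A} in
/-- For `c ∈ C^D`, `c₂ ⊗ c₃ ⊗ c₁ ∈ C ⊗ (C □_D C)`. -/
theorem comulRot_mem (hA : A.IsHopfGalois) (c : A.invariants) :
    ((TensorProduct.assoc ℂ C A.D C).toLinearMap ∘ₗ A.coR.rTensor C).lTensor C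
        ((comulRot ∘ₗ A.invariants.subtype) c) =
      (A.coL.lTensor C).lTensor C ((comulRot ∘ₗ A.invariants.subtype) c) := by
  obtain ⟨z, hz⟩ := hA.2 ⟨_, A.comm_comul_mem c c.2⟩
  have hz' : A.betaAmb z = TensorProduct.comm ℂ C C (comul (R := ℂ) (c : C)) :=
    congrArg Subtype.val hz
  rw [LinearMap.comp_apply, Submodule.subtype_apply, comulRot_eq, ← hz', A.betaAmb_colinear]
  rw [← LinearMap.comp_apply, ← LinearMap.comp_apply, ← LinearMap.lTensor_comp,
    ← LinearMap.lTensor_comp]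
  congr 2
  exact LinearMap.ext fun x => A.betaAmb_mem x

variable {A} in
/-- `C^D → C ⊗ (C □_D C)`, `c ↦ c₂ ⊗ (c₃ ⊗ c₁)`. -/
def rotLift (hA : A.IsHopfGalois) : A.invariants →ₗ[ℂ] C ⊗[ℂ] A.cotensorSq :=
  liftEq _ _ (comulRot ∘ₗ A.invariants.subtype) (comulRot_mem hA)

variable {A} in
theorem lTensor_subtype_rotLift (hA : A.IsHopfGalois) (c : A.invariants) :
    A.cotensorSq.subtype.lTensor C (rotLift hA c) = comulRot (c : C) :=
  lTensor_subtype_liftEq _ _ _ (comulRot_mem hA) c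

variable {A} in
/-- `C^D → C ⊗ H`, `c ↦ c₂ ⊗ κ(c₃ ⊗ c₁)`. -/
def coactAux (hA : A.IsHopfGalois) : A.invariants →ₗ[ℂ] C ⊗[ℂ] H :=
  (kappa hA).lTensor C ∘ₗ rotLift hA

variable {A} in
theorem betaAmb_coactAux (hA : A.IsHopfGalois) (c : A.invariants) :
    A.betaAmb (coactAux hA c) = TensorProduct.comm ℂ C C (comul (R := ℂ) (c : C)) := by
  obtain ⟨z, hz⟩ := hA.2 ⟨_, A.comm_comul_mem c c.2⟩
  have hz' : A.betaAmb z = TensorProduct.comm ℂ C C (comul (R := ℂ) (c : C)) :=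
    congrArg Subtype.val hz
  rw [← hz']
  congr 1
  have h1 : rotLift hA c =
      A.beta.lTensor C (TensorProduct.assoc ℂ C C H (comul.rTensor H z)) := by
    apply Module.Flat.lTensor_preserves_injective_linearMap (M := C)
      _ (Submodule.injective_subtype _)
    rw [lTensor_subtype_rotLift, comulRot_eq, ← hz', A.betaAmb_colinear,
      ← LinearMap.comp_apply, ← LinearMap.lTensor_comp]
    rfl
  have h2 : kappa hA ∘ₗ A.beta = (TensorProduct.lid ℂ H).toLinearMap ∘ₗ
      (counit (R := ℂ)).rTensor H := by
    refine LinearMap.ext fun x => ?_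
    have : (LinearEquiv.ofBijective A.beta hA).symm (A.beta x) = x :=
      (LinearEquiv.ofBijective A.beta hA).symm_apply_apply x
    simp only [kappa, LinearMap.comp_apply, LinearEquiv.coe_coe, this]
  rw [coactAux, LinearMap.comp_apply, h1, ← LinearMap.comp_apply, ← LinearMap.lTensor_comp, h2]
  clear * -
  induction z with
  | zero => simp
  | add x y hx hy => simp only [map_add, hx, hy]
  | tmul c h =>
    have : ∀ s : C ⊗[ℂ] C, ((TensorProduct.lid ℂ H).toLinearMap ∘ₗ
        (counit (R := ℂ)).rTensor H).lTensor C (TensorProduct.assoc ℂ C C H (s ⊗ₜ[ℂ] h)) =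
        TensorProduct.rid ℂ C ((counit (R := ℂ)).lTensor C s) ⊗ₜ[ℂ] h := by
      intro s
      induction s with
      | zero => simp
      | add x y hx hy => simp only [TensorProduct.add_tmul, map_add, hx, hy]
      | tmul a b => simp [TensorProduct.smul_tmul]
    rw [LinearMap.rTensor_tmul, this, lTensor_counit_comul]
    simp

variable {A} in
theorem coactAux_mem (hA : A.IsHopfGalois) (c : A.invariants) :
    A.coL.lTensor H (TensorProduct.comm ℂ C H (coactAux hA c)) =
      A.coR'.lTensor H (TensorProduct.comm ℂ C H (coactAux hA c)) := by
  have inj : Function.Injective A.betaAmb := fun x y h => hA.1 (Subtype.ext h)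
  have h1 : A.coL.rTensor H (coactAux hA c) = A.coR'.rTensor H (coactAux hA c) := by
    apply (TensorProduct.assoc ℂ A.D C H).injective
    apply Module.Flat.lTensor_preserves_injective_linearMap (M := A.D) _ inj
    rw [A.betaAmb_coL, A.betaAmb_coR', betaAmb_coactAux, A.coL_comm_comul]
  have h2 : ∀ (f : C →ₗ[ℂ] A.D ⊗[ℂ] C) (s : C ⊗[ℂ] H), f.lTensor H (TensorProduct.comm ℂ C H s) =
      TensorProduct.comm ℂ (A.D ⊗[ℂ] C) H (f.rTensor H s) := by
    intro f s
    induction s with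
    | zero => simp
    | add x y hx hy => simp only [map_add, hx, hy]
    | tmul a b => simp
  rw [h2, h2, h1]

variable {A} in
/-- The left coaction `c ↦ κ(c₃ ⊗ c₁) ⊗ c₂` of `H` on `C^D`. -/
def coactInv (hA : A.IsHopfGalois) : A.invariants →ₗ[ℂ] H ⊗[ℂ] A.invariants :=
  liftEq A.coL A.coR' ((TensorProduct.comm ℂ C H).toLinearMap ∘ₗ coactAux hA) (coactAux_mem hA)

variable {A} in
/-- The left coaction of `H` on `M̃`, transported from `C^D` along `ξ`:
`d ⊗ c ↦ κ(c₄ ⊗ c₁) ⊗ ε(d) π(c₂) ⊗ c₃`. -/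
def tildeCoact (hA : A.IsHopfGalois) : A.tildeM →ₗ[ℂ] H ⊗[ℂ] A.tildeM :=
  A.xi.symm.toLinearMap.lTensor H ∘ₗ coactInv hA ∘ₗ A.xi.toLinearMap

/-- The iterated cotensor product `C □_D ⋯ □_D C` (`n + 1` factors), as the subspace of
`C^{⊗(n+1)}` on which the right coaction on each factor but the last agrees with the left coaction
on the next one. -/
def cotensorPow (n : ℕ) : Submodule ℂ (⨂[ℂ]^(n + 1) C) :=
  ⨅ i : Fin n, LinearMap.eqLocus (coactAt A.coR' (n + 1) i.castSucc) (coactAt A.coL (n + 1) i.succ)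

/-- The left `D^e`-coaction
`c₀ ⊗ ⋯ ⊗ cₙ ↦ (π(c₀₁) ⊗ π(cₙ₂)) ⊗ c₀₂ ⊗ c₁ ⊗ ⋯ ⊗ cₙ₋₁ ⊗ cₙ₁`
(`(π(c₁) ⊗ π(c₃)) ⊗ c₂` for `n = 0`). -/
def powCoact (n : ℕ) : (⨂[ℂ]^(n + 1) C) →ₗ[ℂ] (A.D ⊗[ℂ] A.D) ⊗[ℂ] (⨂[ℂ]^(n + 1) C) :=
  (TensorProduct.assoc ℂ A.D A.D (⨂[ℂ]^(n + 1) C)).symm.toLinearMap ∘ₗ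
    (coactAt A.coR' (n + 1) (Fin.last n)).lTensor A.D ∘ₗ coactAt A.coL (n + 1) 0

/-- `Cⁿ(C, C^D) = D □_{D^e} C^{□_D (n+1)}`, as a subspace of `D ⊗ C^{⊗(n+1)}`. -/
def coextObj (n : ℕ) : Submodule ℂ (A.D ⊗[ℂ] (⨂[ℂ]^(n + 1) C)) :=
  LinearMap.range ((A.cotensorPow n).subtype.lTensor A.D) ⊓ cotensor A.coDe (A.powCoact n)

/-- `δᵢ(d ⊗ c₀ ⊗ ⋯ ⊗ cₙ) = d ⊗ c₀ ⊗ ⋯ ⊗ Δ(cᵢ) ⊗ ⋯ ⊗ cₙ` for `i ≤ n`, and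
`δₙ₊₁(d ⊗ c₀ ⊗ ⋯ ⊗ cₙ) = ε(d) π(c₀₂) ⊗ c₀₃ ⊗ c₁ ⊗ ⋯ ⊗ cₙ ⊗ c₀₁`. -/
def coface (n : ℕ) : Fin (n + 2) →
    A.D ⊗[ℂ] (⨂[ℂ]^(n + 1) C) →ₗ[ℂ] A.D ⊗[ℂ] (⨂[ℂ]^(n + 1 + 1) C) :=
  Fin.lastCases
    (coactAt A.coL (n + 2) 0 ∘ₗ rotate (n + 1) ∘ₗ comulAt (n + 1) 0 ∘ₗ A.epsD (⨂[ℂ]^(n + 1) C))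
    (fun i => (comulAt (n + 1) i).lTensor A.D)

/-- `σᵢ(d ⊗ c₀ ⊗ ⋯ ⊗ cₙ₊₁) = d ⊗ c₀ ⊗ ⋯ ⊗ ε(cᵢ₊₁) ⊗ ⋯ ⊗ cₙ₊₁`. -/
def codegeneracy (n : ℕ) (i : Fin (n + 1)) :
    A.D ⊗[ℂ] (⨂[ℂ]^(n + 1 + 1) C) →ₗ[ℂ] A.D ⊗[ℂ] (⨂[ℂ]^(n + 1) C) :=
  (counitAt (n + 1) i.succ).lTensor A.D

/-- `τₙ(d ⊗ c₀ ⊗ ⋯ ⊗ cₙ) = ε(d) π(c₁₁) ⊗ c₁₂ ⊗ c₂ ⊗ ⋯ ⊗ cₙ ⊗ c₀`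
(`ε(d) π(c₀₁) ⊗ c₀₂` for `n = 0`). -/
def cyclicOp (n : ℕ) : A.D ⊗[ℂ] (⨂[ℂ]^(n + 1) C) →ₗ[ℂ] A.D ⊗[ℂ] (⨂[ℂ]^(n + 1) C) :=
  coactAt A.coL (n + 1) 0 ∘ₗ rotate n ∘ₗ A.epsD (⨂[ℂ]^(n + 1) C)

/-- The operators `δᵢ`, `σᵢ`, `τₙ` are well defined on the spaces `D □_{D^e} C^{□_D (n+1)}`. -/
structure OperatorsWellDefined : Prop where
  coface_mem : ∀ (n : ℕ) (i : Fin (n + 2)), ∀ x ∈ A.coextObj n, A.coface n i x ∈ A.coextObj (n + 1)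
  codegeneracy_mem : ∀ (n : ℕ) (i : Fin (n + 1)), ∀ x ∈ A.coextObj (n + 1),
    A.codegeneracy n i x ∈ A.coextObj n
  cyclicOp_mem : ∀ n : ℕ, ∀ x ∈ A.coextObj n, A.cyclicOp n x ∈ A.coextObj n

variable {A} in
/-- The cocyclic module `Cⁿ(C, C^D) = D □_{D^e} C^{□_D (n+1)}` of the coextension. -/
abbrev coextCyclic (hX : A.OperatorsWellDefined) : CocyclicData where
  obj n := A.coextObj n
  δ n i := (A.coface n i).restrict (hX.coface_mem n i)
  σ n i := (A.codegeneracy n i).restrict (hX.codegeneracy_mem n i)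
  τ n := (A.cyclicOp n).restrict (hX.cyclicOp_mem n)

/-- The map `ωₙ` on `H^{⊗n} ⊗ M̃`, with values in `D ⊗ C^{⊗(n+1)}`:
`h₀ ⊗ ⋯ ⊗ hₙ₋₁ ⊗ d ⊗ c ↦
  d ⊗ c₁ ⊗ c₂ ◁ h₀₁ ⊗ c₃ ◁ h₀₂ h₁₁ ⊗ ⋯ ⊗ cₙ₊₁ ◁ h₀ₙ h₁₍ₙ₋₁₎ ⋯ hₙ₋₁`. -/
def omega (n : ℕ) : (⨂[ℂ]^n H) ⊗[ℂ] A.tildeM →ₗ[ℂ] A.D ⊗[ℂ] (⨂[ℂ]^(n + 1) C) :=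
  (TensorProduct.lift (PiTensorProduct.map₂ fun _ : Fin (n + 1) => TensorProduct.curry A.act) ∘ₗ
      TensorProduct.map (itComul (n + 1)) (oneHead n ∘ₗ cumulProd n) ∘ₗ
      (TensorProduct.comm ℂ (⨂[ℂ]^n H) C).toLinearMap).lTensor A.D ∘ₗ
    (TensorProduct.leftComm ℂ (⨂[ℂ]^n H) A.D C).toLinearMap ∘ₗ
    A.tildeM.subtype.lTensor (⨂[ℂ]^n H)

variable {A} in
/-- `ωₙ : Cⁿ(H, M̃) → Cⁿ(C, C^D)`. -/
def omegaHom (hA : A.IsHopfGalois) (hX : A.OperatorsWellDefined)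
    (hω : ∀ n x, A.omega n x ∈ A.coextObj n) (n : ℕ) :
    (hopfCyclic (H := H) (M := A.tildeM) A.tildeAct (tildeCoact hA)).obj n →ₗ[ℂ] (coextCyclic hX).obj n :=
  (A.omega n).codRestrict (A.coextObj n) (hω n)

end RightModuleCoalgebra
end CocycHopf

end

/-!
The proof compares three cocyclic modules: `Cⁿ(H, M̃) = H^{⊗n} ⊗ M̃`, the spaces
`D □_{D^e} C^{□_D(n+1)}`, and the elementary cocyclic module `n ↦ C^{⊗(n+1)}` of the coalgebra `C`
(`coalgebraCyclic`), whose cyclic operators are the rotations of the tensor factors. The link between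
them is the iterated Galois map
`c ⊗ h₀ ⊗ ⋯ ⊗ hₙ₋₁ ↦ c₁ ⊗ c₂ ◁ h₀₁ ⊗ c₃ ◁ h₀₂ h₁₁ ⊗ ⋯` (`galoisPow`), which arises by applying the
Galois map `β(c ⊗ h) = c₁ ⊗ c₂ ◁ h` to one factor after the other (`galoisPow_cons`).

*The coefficients.* The coaction of `H` on `M̃ ≅ C^D` is characterized by
`m₀₁ ⊗ m₀₂ ◁ m₋₁ = m₂ ⊗ m₁` (`betaVia_tildeCoact`), that is, `β` sends it to the flipped
comultiplication. As `β` is injective, every axiom of a stable anti-Yetter-Drinfeld module may be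
checked after applying `β`, where it becomes an identity between iterated comultiplications
(`isSAYD_of_betaVia`).

*Bijectivity of `ω`.* Over a field tensor products preserve injections and equalizers. By induction
along `galoisPow_cons`, bijectivity of `β : C ⊗ H → C □_D C` therefore shows that the iterated Galois
map is injective with image the iterated cotensor product (`range_galoisSwap`). It intertwines the
`D^e`-coactions of `C` and of `C^{□_D(n+1)}`, so taking the cotensor product with `D` over `D^e` gives
that `ωₙ` is injective with image `D □_{D^e} C^{□_D(n+1)}` (`range_omega`).

*Compatibility with the operators.* The iterated Galois map turns insertion of `1` into `Δ`,
multiplication of neighbouring factors and the counit into `ε`, and, by the characterization of the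
coaction of `H` on `M̃`, the cyclic operator of `Cⁿ(H, M̃)` into the rotation (`galoisSwap_cyclic`).
The last coface is the cyclic operator after the first coface on both sides. Hence `ω` commutes with
all operators; in particular these preserve the image of `ω`, which is their well-definedness on
`D □_{D^e} C^{□_D(n+1)}`. Applying `ε` to the factor in `D` embeds `Cⁿ(H, M̃)` into `C^{⊗(n+1)}`
compatibly with all operators, so the cocyclic identities for `Cⁿ(H, M̃)` follow from those for the
coalgebra `C` (`hopfCyclic_isCocyclic`), and are then transported along `ω`.

*The model `H^{⊗(n+1)} □_H M̃`.* The map `w ⊗ g ↦ w₀ ⊗ w₁ g` identifies `H^{⊗(n+1)}` with a cofree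
comodule `H^{⊗n} ⊗ H` (`twistEquiv_tensorCoact`), and the cotensor product of a cofree comodule
`V ⊗ H` with `M̃` is `V ⊗ M̃` (`bijective_cotensor_cofree`).

Identities that rest on coassociativity are proved by writing both sides as one linear map applied to
the two bracketings of `c₁ ⊗ c₂ ⊗ c₃`.
-/

noncomputable section

namespace CocycHopf

/-! ### Tensor powers and their structure maps on pure tensors -/

section TensorPowers

variable {V : Type*} [AddCommGroup V] [Module ℂ V]

theorem cons_induction {n : ℕ} {p : (⨂[ℂ]^(n + 1) V) → Prop}
    (tmul : ∀ v w, p (cons n (v ⊗ₜ[ℂ] w))) (add : ∀ x y, p x → p y → p (x + y)) (x) : p x := by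
  obtain ⟨y, rfl⟩ := (cons n).surjective x
  induction y with
  | zero => simpa using tmul 0 0
  | add x y hx hy => rw [map_add]; exact add _ _ hx hy
  | tmul v w => exact tmul v w

theorem cons_hom_ext {n : ℕ} {W : Type*} [AddCommGroup W] [Module ℂ W]
    {f g : (⨂[ℂ]^(n + 1) V) →ₗ[ℂ] W}
    (h : ∀ v w, f (cons n (v ⊗ₜ[ℂ] w)) = g (cons n (v ⊗ₜ[ℂ] w))) : f = g :=
  LinearMap.ext (cons_induction h fun x y hx hy => by rw [map_add, map_add, hx, hy])

theorem zero_hom_ext {W : Type*} [AddCommGroup W] [Module ℂ W] {f g : (⨂[ℂ]^0 V) →ₗ[ℂ] W}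
    (h : f (PiTensorProduct.tprod ℂ Fin.elim0) = g (PiTensorProduct.tprod ℂ Fin.elim0)) :
    f = g := by
  refine PiTensorProduct.ext (MultilinearMap.ext fun v => ?_)
  rw [Subsingleton.elim v Fin.elim0]
  exact h

theorem snoc_cons (n : ℕ) (v u : V) (w : ⨂[ℂ]^n V) :
    snoc (n + 1) (cons n (v ⊗ₜ[ℂ] w) ⊗ₜ[ℂ] u) = cons (n + 1) (v ⊗ₜ[ℂ] snoc n (w ⊗ₜ[ℂ] u)) := by
  induction w using PiTensorProduct.induction_on with
  | smul_tprod r f =>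
    simp only [TensorProduct.tmul_smul, ← TensorProduct.smul_tmul', map_smul, cons_tmul_tprod,
      snoc_tprod_tmul, Fin.cons_snoc_eq_snoc_cons]
  | add x y hx hy => simp only [TensorProduct.tmul_add, TensorProduct.add_tmul, map_add, hx, hy]

theorem snoc_zero (v : V) : snoc 0 (PiTensorProduct.tprod ℂ Fin.elim0 ⊗ₜ[ℂ] v) =
    cons 0 (v ⊗ₜ[ℂ] PiTensorProduct.tprod ℂ Fin.elim0) := by
  rw [snoc_tprod_tmul, cons_tmul_tprod]
  congr 1
  funext i
  obtain rfl : i = Fin.last 0 := Subsingleton.elim (α := Fin 1) _ _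
  rw [Fin.snoc_last]
  rfl

theorem snoc_zero_tmul (w : ⨂[ℂ]^0 V) (v : V) : snoc 0 (w ⊗ₜ[ℂ] v) = cons 0 (v ⊗ₜ[ℂ] w) :=
  LinearMap.congr_fun (zero_hom_ext
    (f := (snoc 0).toLinearMap ∘ₗ (TensorProduct.mk ℂ _ V).flip v)
    (g := (cons 0).toLinearMap ∘ₗ TensorProduct.mk ℂ V _ v) (snoc_zero v)) w

@[simp] theorem rotate_cons (n : ℕ) (v : V) (w : ⨂[ℂ]^n V) :
    rotate n (cons n (v ⊗ₜ[ℂ] w)) = snoc n (w ⊗ₜ[ℂ] v) := by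
  simp [rotate]

@[simp] theorem rotate_tprod (n : ℕ) (v : Fin (n + 1) → V) :
    rotate n (PiTensorProduct.tprod ℂ v) = PiTensorProduct.tprod ℂ (fun i => v (i + 1)) := by
  rw [← Fin.cons_self_tail v, ← cons_tmul_tprod, rotate_cons, snoc_tprod_tmul]
  congr 1
  funext i
  refine Fin.lastCases ?_ (fun j => ?_) i
  · simp
  · simp [Fin.coeSucc_eq_succ]

theorem rotate_pow (n : ℕ) : rotate (V := V) n ^ (n + 1) = LinearMap.id := by
  have h : ∀ (k : ℕ) (v : Fin (n + 1) → V), (rotate n ^ k) (PiTensorProduct.tprod ℂ v) =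
      PiTensorProduct.tprod ℂ (fun i => v (i + k • (1 : Fin (n + 1)))) := by
    intro k
    induction k with
    | zero => simp
    | succ k ih =>
      intro v
      rw [pow_succ, Module.End.mul_apply, rotate_tprod, ih]
      simp only [succ_nsmul, add_assoc]
  refine PiTensorProduct.ext (MultilinearMap.ext fun v => ?_)
  -- `Fin (n + 1)` is cyclic of order `n + 1`
  have h1 : (n + 1) • (1 : Fin (n + 1)) = 0 := by
    simpa using card_nsmul_eq_zero (x := (1 : Fin (n + 1)))
  simp [h, h1]

section coactAt

variable {E : Type*} [AddCommGroup E] [Module ℂ E] (f : V →ₗ[ℂ] E ⊗[ℂ] V)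

theorem coactAt_zero_cons (n : ℕ) (v : V) (w : ⨂[ℂ]^n V) :
    coactAt f (n + 1) 0 (cons n (v ⊗ₜ[ℂ] w)) =
      (cons n).toLinearMap.lTensor E (TensorProduct.assoc ℂ E V (⨂[ℂ]^n V) (f v ⊗ₜ[ℂ] w)) := by
  simp [coactAt]

theorem coactAt_succ_cons (n : ℕ) (j : Fin n) (v : V) (w : ⨂[ℂ]^n V) :
    coactAt f (n + 1) j.succ (cons n (v ⊗ₜ[ℂ] w)) = (cons n).toLinearMap.lTensor E
      (TensorProduct.leftComm ℂ V E (⨂[ℂ]^n V) (v ⊗ₜ[ℂ] coactAt f n j w)) := by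
  simp [coactAt]

end coactAt

section Coalgebra

variable [Coalgebra ℂ V]

@[simp] theorem comulAt_zero_cons (n : ℕ) (v : V) (w : ⨂[ℂ]^n V) :
    comulAt (n + 1) 0 (cons n (v ⊗ₜ[ℂ] w)) = cons (n + 1) ((cons n).toLinearMap.lTensor V
      (TensorProduct.assoc ℂ V V (⨂[ℂ]^n V) (comul (R := ℂ) v ⊗ₜ[ℂ] w))) := by
  simp [comulAt]

@[simp] theorem comulAt_succ_cons (n : ℕ) (j : Fin n) (v : V) (w : ⨂[ℂ]^n V) :
    comulAt (n + 1) j.succ (cons n (v ⊗ₜ[ℂ] w)) = cons (n + 1) (v ⊗ₜ[ℂ] comulAt n j w) := by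
  simp [comulAt]

theorem counitHead_cons (n : ℕ) (v : V) (w : ⨂[ℂ]^n V) :
    counitHead n (cons n (v ⊗ₜ[ℂ] w)) = counit (R := ℂ) v • w := by
  simp [counitHead]

@[simp] theorem counitAt_zero_cons (n : ℕ) (v : V) (w : ⨂[ℂ]^n V) :
    counitAt n 0 (cons n (v ⊗ₜ[ℂ] w)) = counit (R := ℂ) v • w := by
  cases n <;> exact counitHead_cons _ v w

@[simp] theorem counitAt_succ_cons (n : ℕ) (j : Fin (n + 1)) (v : V) (w : ⨂[ℂ]^(n + 1) V) :
    counitAt (n + 1) j.succ (cons (n + 1) (v ⊗ₜ[ℂ] w)) = cons n (v ⊗ₜ[ℂ] counitAt n j w) := by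
  simp [counitAt]

@[simp] theorem counitLast_snoc (n : ℕ) (v : V) (w : ⨂[ℂ]^n V) :
    counitLast n (snoc n (w ⊗ₜ[ℂ] v)) = counit (R := ℂ) v • w := by
  simp [counitLast]

theorem comulAt_castSucc_snoc (n : ℕ) (i : Fin n) (w : ⨂[ℂ]^n V) (v : V) :
    comulAt (n + 1) i.castSucc (snoc n (w ⊗ₜ[ℂ] v)) = snoc (n + 1) (comulAt n i w ⊗ₜ[ℂ] v) := by
  induction n with
  | zero => exact i.elim0
  | succ n ih =>
    induction w using cons_induction with
    | add x y hx hy => simp only [TensorProduct.add_tmul, map_add, hx, hy]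
    | tmul u w =>
      rw [snoc_cons]
      refine Fin.cases ?_ (fun j => ?_) i
      · rw [Fin.castSucc_zero, comulAt_zero_cons, comulAt_zero_cons]
        induction comul (R := ℂ) u with
        | zero => simp
        | add x y hx hy => simp only [TensorProduct.add_tmul, map_add, hx, hy]
        | tmul a b => simp [snoc_cons]
      · rw [Fin.castSucc_succ, comulAt_succ_cons, comulAt_succ_cons, ih, snoc_cons]

theorem comulAt_last_snoc (n : ℕ) (w : ⨂[ℂ]^n V) (v : V) :
    comulAt (n + 1) (Fin.last n) (snoc n (w ⊗ₜ[ℂ] v)) =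
      snoc (n + 1) ((snoc n).toLinearMap.rTensor V
        ((TensorProduct.assoc ℂ (⨂[ℂ]^n V) V V).symm (w ⊗ₜ[ℂ] comul (R := ℂ) v))) := by
  induction n with
  | zero =>
    have := LinearMap.congr_fun (zero_hom_ext (V := V)
      (f := comulAt 1 (Fin.last 0) ∘ₗ (snoc 0).toLinearMap ∘ₗ
        (TensorProduct.mk ℂ _ _).flip v)
      (g := (snoc 1).toLinearMap ∘ₗ (snoc 0).toLinearMap.rTensor V ∘ₗ
        (TensorProduct.assoc ℂ (⨂[ℂ]^0 V) V V).symm.toLinearMap ∘ₗ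
        (TensorProduct.mk ℂ _ _).flip (comul (R := ℂ) v)) ?_) w
    · exact this
    · simp only [LinearMap.comp_apply, LinearMap.flip_apply, TensorProduct.mk_apply,
        LinearEquiv.coe_coe, snoc_zero]
      change comulAt 1 0 _ = _
      rw [comulAt_zero_cons]
      induction comul (R := ℂ) v with
      | zero => simp
      | add x y hx hy => simp only [TensorProduct.add_tmul, TensorProduct.tmul_add, map_add, hx, hy]
      | tmul a b => simp [snoc_cons, snoc_zero]
  | succ n ih =>
    induction w using cons_induction with
    | add x y hx hy => simp only [TensorProduct.add_tmul, map_add, hx, hy]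
    | tmul u w =>
      rw [snoc_cons, ← Fin.succ_last, comulAt_succ_cons, ih]
      induction comul (R := ℂ) v with
      | zero => simp
      | add x y hx hy => simp only [TensorProduct.tmul_add, map_add, hx, hy]
      | tmul a b => simp [snoc_cons]

theorem counitAt_castSucc_snoc (n : ℕ) (i : Fin (n + 1)) (w : ⨂[ℂ]^(n + 1) V) (v : V) :
    counitAt (n + 1) i.castSucc (snoc (n + 1) (w ⊗ₜ[ℂ] v)) = snoc n (counitAt n i w ⊗ₜ[ℂ] v) := by
  induction n with
  | zero =>
    induction w using cons_induction with
    | add x y hx hy => simp only [TensorProduct.add_tmul, map_add, hx, hy]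
    | tmul u w =>
      obtain rfl : i = 0 := Subsingleton.elim (α := Fin 1) _ _
      rw [snoc_cons, Fin.castSucc_zero]
      simp [← TensorProduct.smul_tmul']
  | succ n ih =>
    induction w using cons_induction with
    | add x y hx hy => simp only [TensorProduct.add_tmul, map_add, hx, hy]
    | tmul u w =>
      rw [snoc_cons]
      refine Fin.cases ?_ (fun j => ?_) i
      · simp [← TensorProduct.smul_tmul']
      · rw [Fin.castSucc_succ, counitAt_succ_cons, counitAt_succ_cons, ih, snoc_cons]

/-- The recursions of `counitAt` and `counitLast` start from opposite ends; they agree on the last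
factor. -/
theorem counitAt_last (n : ℕ) : counitAt (V := V) n (Fin.last n) = counitLast n := by
  induction n with
  | zero =>
    refine cons_hom_ext fun v w => ?_
    exact (counitAt_zero_cons 0 v w).trans (by rw [← snoc_zero_tmul, counitLast_snoc])
  | succ n ih =>
    refine cons_hom_ext fun v w => ?_
    rw [← Fin.succ_last, counitAt_succ_cons, ih]
    obtain ⟨y, rfl⟩ := (snoc n).surjective w
    induction y with
    | zero => simp
    | add x y hx hy => simp only [TensorProduct.tmul_add, map_add, hx, hy]
    | tmul a b => rw [← snoc_cons, counitLast_snoc, counitLast_snoc]; simp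

end Coalgebra

section Algebra

variable {H : Type*} [Ring H] [Algebra ℂ H]

theorem oneHead_apply (n : ℕ) (w : ⨂[ℂ]^n H) : oneHead n w = cons n ((1 : H) ⊗ₜ[ℂ] w) := rfl

@[simp] theorem insertOneAt_zero (n : ℕ) (w : ⨂[ℂ]^n H) :
    insertOneAt n 0 w = cons n ((1 : H) ⊗ₜ[ℂ] w) := by
  cases n <;> rfl

@[simp] theorem insertOneAt_succ_cons (n : ℕ) (j : Fin (n + 1)) (v : H) (w : ⨂[ℂ]^n H) :
    insertOneAt (n + 1) j.succ (cons n (v ⊗ₜ[ℂ] w)) = cons (n + 1) (v ⊗ₜ[ℂ] insertOneAt n j w) := by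
  simp [insertOneAt]

@[simp] theorem mulAt_zero_cons (n : ℕ) (v u : H) (w : ⨂[ℂ]^n H) :
    mulAt (n + 1) 0 (cons (n + 1) (v ⊗ₜ[ℂ] cons n (u ⊗ₜ[ℂ] w))) = cons n ((v * u) ⊗ₜ[ℂ] w) := by
  simp [mulAt]

@[simp] theorem mulAt_succ_cons (n : ℕ) (j : Fin n) (v : H) (w : ⨂[ℂ]^(n + 1) H) :
    mulAt (n + 1) j.succ (cons (n + 1) (v ⊗ₜ[ℂ] w)) = cons n (v ⊗ₜ[ℂ] mulAt n j w) := by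
  simp [mulAt]

end Algebra

end TensorPowers

end CocycHopf

namespace CocycHopf

/-! ### The cocyclic module of a coalgebra -/

namespace CocyclicData

/-- A criterion for cocyclicity: `δδ = δδ` and the identities for `σⱼδᵢ` with `i ≤ j` or `i > j + 1` need
be checked only for cofaces other than the last, because the last coface is `τ ∘ δ₀`. -/
theorem IsCocyclic.mk_of_last (X : CocyclicData)
    (δ_comp_δ : ∀ (n : ℕ) (i j : Fin (n + 1)), i ≤ j →
      X.δ (n + 1) j.succ.castSucc ∘ₗ X.δ n i.castSucc =
        X.δ (n + 1) i.castSucc.castSucc ∘ₗ X.δ n j.castSucc)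
    (σ_comp_δ_of_le : ∀ (n : ℕ) (i j : Fin (n + 1)), i ≤ j →
      X.σ (n + 1) j.succ ∘ₗ X.δ (n + 1) i.castSucc.castSucc = X.δ n i.castSucc ∘ₗ X.σ n j)
    (σ_comp_δ_self : ∀ (n : ℕ) (i : Fin (n + 1)), X.σ n i ∘ₗ X.δ n i.castSucc = LinearMap.id)
    (σ_comp_δ_succ : ∀ (n : ℕ) (i : Fin (n + 1)), X.σ n i ∘ₗ X.δ n i.succ = LinearMap.id)
    (σ_comp_δ_of_gt : ∀ (n : ℕ) (i j : Fin (n + 1)), j < i →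
      X.σ (n + 1) j.castSucc ∘ₗ X.δ (n + 1) i.succ.castSucc = X.δ n i.castSucc ∘ₗ X.σ n j)
    (σ_comp_σ : ∀ (n : ℕ) (i j : Fin (n + 1)), i ≤ j →
      X.σ n j ∘ₗ X.σ (n + 1) i.castSucc = X.σ n i ∘ₗ X.σ (n + 1) j.succ)
    (τ_comp_δ_succ : ∀ (n : ℕ) (i : Fin (n + 1)),
      X.τ (n + 1) ∘ₗ X.δ n i.succ = X.δ n i.castSucc ∘ₗ X.τ n)
    (τ_comp_δ_zero : ∀ n : ℕ, X.τ (n + 1) ∘ₗ X.δ n 0 = X.δ n (Fin.last (n + 1)))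
    (τ_comp_σ_succ : ∀ (n : ℕ) (j : Fin (n + 1)),
      X.τ (n + 1) ∘ₗ X.σ (n + 1) j.succ = X.σ (n + 1) j.castSucc ∘ₗ X.τ (n + 2))
    (τ_comp_σ_zero : ∀ n : ℕ,
      X.τ n ∘ₗ X.σ n 0 = X.σ n (Fin.last n) ∘ₗ X.τ (n + 1) ∘ₗ X.τ (n + 1))
    (τ_pow : ∀ n : ℕ, X.τ n ^ (n + 1) = LinearMap.id) : X.IsCocyclic where
  δ_comp_δ n i j hij := by
    induction j using Fin.lastCases with
    | cast j =>
      obtain ⟨i, rfl⟩ := Fin.exists_castSucc_eq.2 (ne_of_lt (hij.trans_lt (Fin.castSucc_lt_last j)))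
      rw [Fin.succ_castSucc]
      exact δ_comp_δ n i j hij
    | last =>
      rw [Fin.succ_last, ← τ_comp_δ_zero, ← τ_comp_δ_zero]
      ext x
      -- `τ δ₀ δᵢ = τ δᵢ₊₁ δ₀ = δᵢ τ δ₀`
      have e1 := LinearMap.congr_fun (τ_comp_δ_succ (n + 1) i) (X.δ n 0 x)
      have e2 : X.δ (n + 1) i.succ (X.δ n 0 x) = X.δ (n + 1) 0 (X.δ n i x) := by
        induction i using Fin.lastCases with
        | cast i => exact LinearMap.congr_fun (δ_comp_δ n 0 i (Fin.zero_le _)) x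
        | last =>
          rw [Fin.succ_last, ← τ_comp_δ_zero, ← τ_comp_δ_zero]
          -- `τ δ₁ δ₀ = δ₀ τ δ₀`, and `δ₁ δ₀ = δ₀ δ₀`
          have e3 := LinearMap.congr_fun (τ_comp_δ_succ (n + 1) 0) (X.δ n 0 x)
          have e4 := LinearMap.congr_fun (δ_comp_δ n 0 0 le_rfl) x
          simp only [LinearMap.comp_apply, Fin.castSucc_zero, Fin.succ_zero_eq_one] at e3 e4 ⊢
          rw [← e3]
          exact congrArg _ e4.symm
      simp only [LinearMap.comp_apply] at e1 ⊢
      rw [← e1, e2]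
  σ_comp_δ_of_le n i j hij := by
    obtain ⟨i, rfl⟩ := Fin.exists_castSucc_eq.2 (ne_of_lt (hij.trans_lt (Fin.castSucc_lt_last j)))
    exact σ_comp_δ_of_le n i j hij
  σ_comp_δ_self := σ_comp_δ_self
  σ_comp_δ_succ := σ_comp_δ_succ
  σ_comp_δ_of_gt n i j hij := by
    induction i using Fin.lastCases with
    | cast i =>
      rw [Fin.succ_castSucc]
      exact σ_comp_δ_of_gt n i j hij
    | last =>
      rw [Fin.succ_last, ← τ_comp_δ_zero, ← τ_comp_δ_zero]
      ext x
      have e1 := LinearMap.congr_fun (τ_comp_σ_succ n j) (X.δ (n + 1) 0 x)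
      have e2 := LinearMap.congr_fun (σ_comp_δ_of_le n 0 j (Fin.zero_le _)) x
      simp only [LinearMap.comp_apply, Fin.castSucc_zero] at e1 e2 ⊢
      rw [← e1, e2]
  σ_comp_σ := σ_comp_σ
  τ_comp_δ_succ := τ_comp_δ_succ
  τ_comp_δ_zero := τ_comp_δ_zero
  τ_comp_σ_succ := τ_comp_σ_succ
  τ_comp_σ_zero := τ_comp_σ_zero
  τ_pow := τ_pow

end CocyclicData

section Coalgebra

variable {V : Type*} [AddCommGroup V] [Module ℂ V] [Coalgebra ℂ V]

theorem comulAt_comp_comulAt (n : ℕ) (i j : Fin n) (hij : i ≤ j) :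
    comulAt (V := V) (n + 1) j.succ ∘ₗ comulAt n i = comulAt (n + 1) i.castSucc ∘ₗ comulAt n j := by
  induction n with
  | zero => exact i.elim0
  | succ n ih =>
    refine cons_hom_ext fun v w => ?_
    induction i using Fin.cases with
    | zero =>
      induction j using Fin.cases with
      | zero =>
        -- coassociativity in the first factor
        let F : V ⊗[ℂ] (V ⊗[ℂ] V) →ₗ[ℂ] ⨂[ℂ]^(n + 3) V :=
          (cons (n + 2)).toLinearMap ∘ₗ ((cons (n + 1)).toLinearMap ∘ₗ
            (cons n).toLinearMap.lTensor V ∘ₗ (TensorProduct.assoc ℂ V V (⨂[ℂ]^n V)).toLinearMap ∘ₗ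
            (TensorProduct.mk ℂ (V ⊗[ℂ] V) (⨂[ℂ]^n V)).flip w).lTensor V
        have e1 : ∀ s : V ⊗[ℂ] V, comulAt (n + 2) 1 (cons (n + 1) ((cons n).toLinearMap.lTensor V
            (TensorProduct.assoc ℂ V V (⨂[ℂ]^n V) (s ⊗ₜ[ℂ] w)))) = F (comul.lTensor V s) := by
          intro s
          induction s with
          | zero => simp
          | add x y hx hy => simp only [TensorProduct.add_tmul, map_add, hx, hy]
          | tmul a b =>
            change comulAt (n + 2) (Fin.succ 0) (cons (n + 1) (a ⊗ₜ[ℂ] cons n (b ⊗ₜ[ℂ] w))) = _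
            rw [comulAt_succ_cons]
            simp [F]
        have e2 : ∀ s : V ⊗[ℂ] V, comulAt (n + 2) 0 (cons (n + 1) ((cons n).toLinearMap.lTensor V
            (TensorProduct.assoc ℂ V V (⨂[ℂ]^n V) (s ⊗ₜ[ℂ] w)))) =
            F (TensorProduct.assoc ℂ V V V (comul.rTensor V s)) := by
          intro s
          induction s with
          | zero => simp
          | add x y hx hy => simp only [TensorProduct.add_tmul, map_add, hx, hy]
          | tmul a b =>
            simp only [TensorProduct.assoc_tmul, LinearMap.lTensor_tmul, LinearEquiv.coe_coe,
              comulAt_zero_cons, LinearMap.rTensor_tmul]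
            induction comul (R := ℂ) a with
            | zero => simp
            | add x y hx hy => simp only [TensorProduct.add_tmul, map_add, hx, hy]
            | tmul x y => simp [F]
        simp only [LinearMap.comp_apply, comulAt_zero_cons, Fin.castSucc_zero,
          Fin.succ_zero_eq_one]
        rw [e1, e2, coassoc_apply]
      | succ j =>
        simp only [LinearMap.comp_apply, comulAt_zero_cons, Fin.castSucc_zero, comulAt_succ_cons]
        induction comul (R := ℂ) v with
        | zero => simp
        | add x y hx hy => simp only [TensorProduct.add_tmul, map_add, hx, hy]
        | tmul x y => simp
    | succ i =>
      induction j using Fin.cases with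
      | zero => exact absurd hij (by simp)
      | succ j =>
        have := LinearMap.congr_fun (ih i j (Fin.succ_le_succ_iff.1 hij)) w
        simp only [LinearMap.comp_apply] at this
        simp [this, Fin.castSucc_succ]

theorem counitAt_comp_comulAt_of_lt (n : ℕ) (i : Fin n) (k : Fin (n + 1)) (h : i.castSucc < k) :
    counitAt (V := V) (n + 1) k.succ ∘ₗ comulAt (n + 1) i.castSucc =
      comulAt n i ∘ₗ counitAt n k := by
  induction n with
  | zero => exact i.elim0
  | succ n ih =>
    refine cons_hom_ext fun v w => ?_
    induction k using Fin.cases with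
    | zero => exact absurd h (by simp)
    | succ k =>
      induction i using Fin.cases with
      | zero =>
        simp only [LinearMap.comp_apply, comulAt_zero_cons, Fin.castSucc_zero, counitAt_succ_cons]
        induction comul (R := ℂ) v with
        | zero => simp
        | add x y hx hy => simp only [TensorProduct.add_tmul, map_add, hx, hy]
        | tmul x y => simp
      | succ i =>
        have := LinearMap.congr_fun (ih i k (by simpa [Fin.castSucc_succ] using h)) w
        simp only [LinearMap.comp_apply] at this
        simp [this, Fin.castSucc_succ]

theorem counitAt_castSucc_comp_comulAt (n : ℕ) (i : Fin n) :
    counitAt (V := V) n i.castSucc ∘ₗ comulAt n i = LinearMap.id := by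
  induction n with
  | zero => exact i.elim0
  | succ n ih =>
    refine cons_hom_ext fun v w => ?_
    induction i using Fin.cases with
    | zero =>
      have : ∀ s : V ⊗[ℂ] V, counitAt (n + 1) 0 (cons (n + 1) ((cons n).toLinearMap.lTensor V
          (TensorProduct.assoc ℂ V V (⨂[ℂ]^n V) (s ⊗ₜ[ℂ] w)))) =
          cons n (TensorProduct.lid ℂ V ((counit (R := ℂ)).rTensor V s) ⊗ₜ[ℂ] w) := by
        intro s
        induction s with
        | zero => simp
        | add x y hx hy => simp only [TensorProduct.add_tmul, map_add, hx, hy]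
        | tmul x y => simp [← TensorProduct.smul_tmul']
      simp only [LinearMap.comp_apply, comulAt_zero_cons, Fin.castSucc_zero]
      rw [this, rTensor_counit_comul]
      simp
    | succ i =>
      have := LinearMap.congr_fun (ih i) w
      simp only [LinearMap.comp_apply] at this
      simp [this, Fin.castSucc_succ]

theorem counitAt_succ_comp_comulAt (n : ℕ) (i : Fin n) :
    counitAt (V := V) n i.succ ∘ₗ comulAt n i = LinearMap.id := by
  induction n with
  | zero => exact i.elim0
  | succ n ih =>
    refine cons_hom_ext fun v w => ?_
    induction i using Fin.cases with
    | zero =>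
      have : ∀ s : V ⊗[ℂ] V, counitAt (n + 1) (Fin.succ 0) (cons (n + 1)
          ((cons n).toLinearMap.lTensor V
          (TensorProduct.assoc ℂ V V (⨂[ℂ]^n V) (s ⊗ₜ[ℂ] w)))) =
          cons n (TensorProduct.rid ℂ V ((counit (R := ℂ)).lTensor V s) ⊗ₜ[ℂ] w) := by
        intro s
        induction s with
        | zero => simp
        | add x y hx hy => simp only [TensorProduct.add_tmul, map_add, hx, hy]
        | tmul x y =>
          simp only [TensorProduct.assoc_tmul, LinearMap.lTensor_tmul, LinearEquiv.coe_coe,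
            counitAt_succ_cons, counitAt_zero_cons]
          simp [← TensorProduct.smul_tmul']
      simp only [LinearMap.comp_apply, comulAt_zero_cons]
      rw [this, lTensor_counit_comul]
      simp
    | succ i =>
      have := LinearMap.congr_fun (ih i) w
      simp only [LinearMap.comp_apply] at this
      simp [this]

theorem counitAt_comp_comulAt_of_le (n : ℕ) (i : Fin n) (k : Fin (n + 1)) (h : k ≤ i.castSucc) :
    counitAt (V := V) (n + 1) k.castSucc ∘ₗ comulAt (n + 1) i.succ =
      comulAt n i ∘ₗ counitAt n k := by
  induction n with
  | zero => exact i.elim0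
  | succ n ih =>
    refine cons_hom_ext fun v w => ?_
    induction k using Fin.cases with
    | zero => simp
    | succ k =>
      induction i using Fin.cases with
      | zero => exact absurd h (by simp)
      | succ i =>
        have := LinearMap.congr_fun (ih i k (by simpa [Fin.castSucc_succ] using h)) w
        simp only [LinearMap.comp_apply] at this
        simp [this, Fin.castSucc_succ]

theorem counitAt_comp_counitAt (n : ℕ) (i j : Fin (n + 1)) (hij : i ≤ j) :
    counitAt (V := V) n j ∘ₗ counitAt (n + 1) i.castSucc =
      counitAt n i ∘ₗ counitAt (n + 1) j.succ := by
  induction n with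
  | zero =>
    obtain rfl : i = 0 := Subsingleton.elim (α := Fin 1) _ _
    obtain rfl : j = 0 := Subsingleton.elim (α := Fin 1) _ _
    refine cons_hom_ext fun v w => ?_
    rw [LinearMap.comp_apply, LinearMap.comp_apply, counitAt_succ_cons, Fin.castSucc_zero]
    simp
  | succ n ih =>
    refine cons_hom_ext fun v w => ?_
    induction i using Fin.cases with
    | zero => simp
    | succ i =>
      induction j using Fin.cases with
      | zero => exact absurd hij (by simp)
      | succ j =>
        have := LinearMap.congr_fun (ih i j (Fin.succ_le_succ_iff.1 hij)) w
        simp only [LinearMap.comp_apply] at this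
        simp [this, Fin.castSucc_succ]

theorem rotate_comp_comulAt_succ (n : ℕ) (i : Fin n) :
    rotate (V := V) (n + 1) ∘ₗ comulAt (n + 1) i.succ =
      comulAt (n + 1) i.castSucc ∘ₗ rotate n :=
  cons_hom_ext fun v w => by simp [comulAt_castSucc_snoc]

/-- The identity `τ δₙ₊₁ = δₙ τ`, in which both cofaces involve the ends of the tensor product. -/
theorem rotate_rotate_comulAt_zero (n : ℕ) :
    rotate (V := V) (n + 1) ∘ₗ rotate (n + 1) ∘ₗ comulAt (n + 1) 0 =
      comulAt (n + 1) (Fin.last n) ∘ₗ rotate n := by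
  refine cons_hom_ext fun v w => ?_
  simp only [LinearMap.comp_apply, comulAt_zero_cons, rotate_cons, comulAt_last_snoc]
  induction comul (R := ℂ) v with
  | zero => simp
  | add x y hx hy => simp only [TensorProduct.add_tmul, TensorProduct.tmul_add, map_add, hx, hy]
  | tmul x y => simp [snoc_cons]

theorem rotate_comp_counitAt_succ (n : ℕ) (k : Fin (n + 1)) :
    rotate (V := V) n ∘ₗ counitAt (n + 1) k.succ =
      counitAt (n + 1) k.castSucc ∘ₗ rotate (n + 1) :=
  cons_hom_ext fun v w => by simp [counitAt_castSucc_snoc]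

theorem rotate_comp_counitAt_one (n : ℕ) :
    rotate (V := V) n ∘ₗ counitAt (n + 1) 1 =
      counitAt (n + 1) (Fin.last (n + 1)) ∘ₗ rotate (n + 1) ∘ₗ rotate (n + 1) := by
  refine cons_hom_ext fun v w => ?_
  induction w using cons_induction with
  | add x y hx hy => simp only [TensorProduct.tmul_add, map_add, hx, hy]
  | tmul u w =>
    rw [LinearMap.comp_apply, ← Fin.succ_zero_eq_one, counitAt_succ_cons, counitAt_last]
    simp [snoc_cons]

/-- The identity `σₙ δₙ₊₁ = id`. -/
theorem counitLast_rotate_comulAt_zero (n : ℕ) :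
    counitLast (V := V) (n + 1) ∘ₗ rotate (n + 1) ∘ₗ comulAt (n + 1) 0 = LinearMap.id := by
  refine cons_hom_ext fun v w => ?_
  rw [← LinearMap.congr_fun (counitAt_castSucc_comp_comulAt (n + 1) 0) (cons n (v ⊗ₜ[ℂ] w))]
  simp only [LinearMap.comp_apply, comulAt_zero_cons, Fin.castSucc_zero]
  induction comul (R := ℂ) v with
  | zero => simp
  | add x y hx hy => simp only [TensorProduct.add_tmul, map_add, hx, hy]
  | tmul x y => simp

variable (V) in
/-- The cocyclic module `n ↦ V^{⊗(n+1)}` of a coalgebra `V`: the cofaces apply `Δ` to one factor,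
the codegeneracies apply `ε` to a factor other than the first, and the cyclic operators are the
rotations. -/
abbrev coalgebraCyclic : CocyclicData where
  obj n := ⨂[ℂ]^(n + 1) V
  δ n := Fin.lastCases (rotate (n + 1) ∘ₗ comulAt (n + 1) 0) (comulAt (n + 1))
  σ n i := counitAt (n + 1) i.succ
  τ n := rotate n

variable (V) in
theorem coalgebraCyclic_isCocyclic : (coalgebraCyclic V).IsCocyclic := by
  refine .mk_of_last _ ?_ ?_ ?_ ?_ ?_ ?_ ?_ ?_ ?_ ?_ ?_
  · intro n i j hij
    simpa only [Fin.lastCases_castSucc] using comulAt_comp_comulAt (V := V) (n + 1) i j hij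
  · intro n i j hij
    simpa only [Fin.lastCases_castSucc] using counitAt_comp_comulAt_of_lt (V := V) (n + 1) i j.succ
      (Fin.castSucc_lt_succ_iff.2 hij)
  · intro n i
    simpa only [Fin.lastCases_castSucc] using counitAt_succ_comp_comulAt (V := V) (n + 1) i
  · intro n i
    induction i using Fin.lastCases with
    | last =>
      simpa only [Fin.succ_last, Fin.lastCases_last, counitAt_last] using
        counitLast_rotate_comulAt_zero (V := V) n
    | cast i =>
      simpa only [Fin.succ_castSucc, Fin.lastCases_castSucc] using
        counitAt_castSucc_comp_comulAt (V := V) (n + 1) i.succ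
  · intro n i j hij
    simpa only [Fin.lastCases_castSucc, Fin.succ_castSucc] using
      counitAt_comp_comulAt_of_le (V := V) (n + 1) i j.succ
        (Fin.succ_le_castSucc_iff.2 hij)
  · intro n i j hij
    simpa only [Fin.succ_castSucc] using counitAt_comp_counitAt (V := V) (n + 1) i.succ j.succ
      (Fin.succ_le_succ_iff.2 hij)
  · intro n i
    induction i using Fin.lastCases with
    | last =>
      simpa only [Fin.succ_last, Fin.lastCases_last, Fin.lastCases_castSucc] using
        rotate_rotate_comulAt_zero (V := V) n
    | cast i =>
      simpa only [Fin.succ_castSucc, Fin.lastCases_castSucc] using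
        rotate_comp_comulAt_succ (V := V) n i
  · intro n
    simp only [Fin.lastCases_last, ← Fin.castSucc_zero, Fin.lastCases_castSucc]
  · intro n j
    simpa only [Fin.succ_castSucc] using rotate_comp_counitAt_succ (V := V) (n + 1) j.succ
  · intro n
    simpa only [Fin.succ_last, Fin.succ_zero_eq_one] using rotate_comp_counitAt_one (V := V) n
  · exact rotate_pow

end Coalgebra
end CocycHopf

namespace CocycHopf

/-! ### Right comodules over a Hopf algebra and the diagonal coaction -/

section RightCoaction

variable {H : Type*} [Ring H] [HopfAlgebra ℂ H]
  {U V W : Type*} [AddCommGroup U] [Module ℂ U] [AddCommGroup V] [Module ℂ V]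
  [AddCommGroup W] [Module ℂ W]

theorem lTensor_rTensor_comm {U V W X : Type*} [AddCommGroup U] [Module ℂ U] [AddCommGroup V]
    [Module ℂ V] [AddCommGroup W] [Module ℂ W] [AddCommGroup X] [Module ℂ X]
    (f : U →ₗ[ℂ] V) (g : W →ₗ[ℂ] X) (x : U ⊗[ℂ] W) :
    g.lTensor V (f.rTensor W x) = f.rTensor X (g.lTensor U x) := by
  rw [← LinearMap.comp_apply, ← LinearMap.comp_apply, LinearMap.lTensor_comp_rTensor,
    LinearMap.rTensor_comp_lTensor]

/-- A coassociative and counital right coaction `δ : V → V ⊗ H`. -/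
structure IsRightCoaction (δ : V →ₗ[ℂ] V ⊗[ℂ] H) : Prop where
  coassoc : ∀ v, TensorProduct.assoc ℂ V H H (δ.rTensor H (δ v)) =
    (comul (R := ℂ)).lTensor V (δ v)
  counit : ∀ v, TensorProduct.rid ℂ V ((counit (R := ℂ)).lTensor V (δ v)) = v

/-- The tensor product `v ⊗ w ↦ v₀ ⊗ w₀ ⊗ v₁ w₁` of two right coactions. -/
def tensorCoact (δ : V →ₗ[ℂ] V ⊗[ℂ] H) (δ' : W →ₗ[ℂ] W ⊗[ℂ] H) :
    V ⊗[ℂ] W →ₗ[ℂ] (V ⊗[ℂ] W) ⊗[ℂ] H :=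
  (LinearMap.mul' ℂ H).lTensor (V ⊗[ℂ] W) ∘ₗ
    (TensorProduct.tensorTensorTensorComm ℂ V H W H).toLinearMap ∘ₗ TensorProduct.map δ δ'

theorem tensorCoact_tmul (δ : V →ₗ[ℂ] V ⊗[ℂ] H) (δ' : W →ₗ[ℂ] W ⊗[ℂ] H) (v : V) (w : W) :
    tensorCoact δ δ' (v ⊗ₜ[ℂ] w) = (LinearMap.mul' ℂ H).lTensor (V ⊗[ℂ] W)
      (TensorProduct.tensorTensorTensorComm ℂ V H W H (δ v ⊗ₜ[ℂ] δ' w)) := rfl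

theorem IsRightCoaction.tensor {δ : V →ₗ[ℂ] V ⊗[ℂ] H} {δ' : W →ₗ[ℂ] W ⊗[ℂ] H}
    (hδ : IsRightCoaction δ) (hδ' : IsRightCoaction δ') : IsRightCoaction (tensorCoact δ δ') where
  coassoc x := by
    induction x with
    | zero => simp
    | add x y hx hy => simp only [map_add, hx, hy]
    | tmul v w =>
      let G : (V ⊗[ℂ] (H ⊗[ℂ] H)) ⊗[ℂ] (W ⊗[ℂ] (H ⊗[ℂ] H)) →ₗ[ℂ] (V ⊗[ℂ] W) ⊗[ℂ] (H ⊗[ℂ] H) :=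
        (LinearMap.mul' ℂ (H ⊗[ℂ] H)).lTensor (V ⊗[ℂ] W) ∘ₗ
          (TensorProduct.tensorTensorTensorComm ℂ V (H ⊗[ℂ] H) W (H ⊗[ℂ] H)).toLinearMap
      have e1 : ∀ (s : V ⊗[ℂ] H) (t : W ⊗[ℂ] H),
          TensorProduct.assoc ℂ _ H H ((tensorCoact δ δ').rTensor H
            ((LinearMap.mul' ℂ H).lTensor (V ⊗[ℂ] W)
              (TensorProduct.tensorTensorTensorComm ℂ V H W H (s ⊗ₜ[ℂ] t)))) =
          G (TensorProduct.assoc ℂ V H H (δ.rTensor H s) ⊗ₜ[ℂ]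
            TensorProduct.assoc ℂ W H H (δ'.rTensor H t)) := by
        intro s t
        induction s with
        | zero => simp
        | add x y hx hy => simp only [TensorProduct.add_tmul, map_add, hx, hy]
        | tmul a b =>
          induction t with
          | zero => simp
          | add x y hx hy => simp only [TensorProduct.tmul_add, map_add, hx, hy]
          | tmul v q =>
            simp only [TensorProduct.tensorTensorTensorComm_tmul, LinearMap.lTensor_tmul,
              LinearMap.rTensor_tmul, tensorCoact_tmul]
            generalize δ a = s'
            generalize δ' v = t'
            induction s' with
            | zero => simp
            | add x y hx hy => simp only [TensorProduct.add_tmul, map_add, hx, hy]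
            | tmul a a' =>
              induction t' with
              | zero => simp
              | add x y hx hy =>
                simp only [TensorProduct.tmul_add, TensorProduct.add_tmul, map_add, hx, hy]
              | tmul v v' => simp [G]
      have e2 : ∀ (s : V ⊗[ℂ] H) (t : W ⊗[ℂ] H),
          (comul (R := ℂ)).lTensor _ ((LinearMap.mul' ℂ H).lTensor (V ⊗[ℂ] W)
              (TensorProduct.tensorTensorTensorComm ℂ V H W H (s ⊗ₜ[ℂ] t))) =
          G ((comul (R := ℂ)).lTensor V s ⊗ₜ[ℂ] (comul (R := ℂ)).lTensor W t) := by
        intro s t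
        induction s with
        | zero => simp
        | add x y hx hy => simp only [TensorProduct.add_tmul, map_add, hx, hy]
        | tmul a b =>
          induction t with
          | zero => simp
          | add x y hx hy => simp only [TensorProduct.tmul_add, map_add, hx, hy]
          | tmul v q => simp [G]
      rw [tensorCoact_tmul, e1, e2, hδ.coassoc, hδ'.coassoc]
  counit x := by
    induction x with
    | zero => simp
    | add x y hx hy => simp only [map_add, hx, hy]
    | tmul v w =>
      have e : ∀ (s : V ⊗[ℂ] H) (t : W ⊗[ℂ] H),
          TensorProduct.rid ℂ _ ((Coalgebra.counit (R := ℂ)).lTensor _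
            ((LinearMap.mul' ℂ H).lTensor (V ⊗[ℂ] W)
              (TensorProduct.tensorTensorTensorComm ℂ V H W H (s ⊗ₜ[ℂ] t)))) =
          TensorProduct.rid ℂ _ ((Coalgebra.counit (R := ℂ)).lTensor V s) ⊗ₜ[ℂ]
            TensorProduct.rid ℂ _ ((Coalgebra.counit (R := ℂ)).lTensor W t) := by
        intro s t
        induction s with
        | zero => simp
        | add x y hx hy => simp only [TensorProduct.add_tmul, map_add, hx, hy]
        | tmul a b =>
          induction t with
          | zero => simp
          | add x y hx hy => simp only [TensorProduct.tmul_add, map_add, hx, hy]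
          | tmul v q => simp [smul_smul, TensorProduct.smul_tmul', mul_comm]
      rw [tensorCoact_tmul, e, hδ.counit, hδ'.counit]

theorem tensorCoact_map {V' W' : Type*} [AddCommGroup V'] [Module ℂ V'] [AddCommGroup W']
    [Module ℂ W'] {δ : V →ₗ[ℂ] V ⊗[ℂ] H} {δ' : W →ₗ[ℂ] W ⊗[ℂ] H} {ε : V' →ₗ[ℂ] V' ⊗[ℂ] H}
    {ε' : W' →ₗ[ℂ] W' ⊗[ℂ] H} {e : V →ₗ[ℂ] V'} {f : W →ₗ[ℂ] W'}
    (he : ∀ v, ε (e v) = e.rTensor H (δ v)) (hf : ∀ w, ε' (f w) = f.rTensor H (δ' w))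
    (x : V ⊗[ℂ] W) :
    tensorCoact ε ε' (TensorProduct.map e f x) =
      (TensorProduct.map e f).rTensor H (tensorCoact δ δ' x) := by
  induction x with
  | zero => simp
  | add x y hx hy => simp only [map_add, hx, hy]
  | tmul v w =>
    rw [TensorProduct.map_tmul, tensorCoact_tmul, tensorCoact_tmul, he, hf]
    generalize δ v = s
    generalize δ' w = t
    induction s with
    | zero => simp
    | add x y hx hy => simp only [TensorProduct.add_tmul, map_add, hx, hy]
    | tmul a b =>
      induction t with
      | zero => simp
      | add x y hx hy => simp only [TensorProduct.tmul_add, map_add, hx, hy]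
      | tmul v q => simp

theorem tensorCoact_lTensor {W' : Type*} [AddCommGroup W'] [Module ℂ W']
    (δ : V →ₗ[ℂ] V ⊗[ℂ] H) {δ' : W →ₗ[ℂ] W ⊗[ℂ] H} {ε' : W' →ₗ[ℂ] W' ⊗[ℂ] H} {f : W →ₗ[ℂ] W'}
    (hf : ∀ w, ε' (f w) = f.rTensor H (δ' w)) (x : V ⊗[ℂ] W) :
    tensorCoact δ ε' (f.lTensor V x) = (f.lTensor V).rTensor H (tensorCoact δ δ' x) :=
  tensorCoact_map (e := LinearMap.id) (by simp) hf x

theorem tensorCoact_rTensor {V' : Type*} [AddCommGroup V'] [Module ℂ V']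
    {δ : V →ₗ[ℂ] V ⊗[ℂ] H} (δ' : W →ₗ[ℂ] W ⊗[ℂ] H) {ε : V' →ₗ[ℂ] V' ⊗[ℂ] H} {e : V →ₗ[ℂ] V'}
    (he : ∀ v, ε (e v) = e.rTensor H (δ v)) (x : V ⊗[ℂ] W) :
    tensorCoact ε δ' (e.rTensor W x) = (e.rTensor W).rTensor H (tensorCoact δ δ' x) :=
  tensorCoact_map (f := LinearMap.id) he (by simp) x

theorem tensorCoact_trivial_comm (x : V ⊗[ℂ] H) :
    tensorCoact comul ((TensorProduct.mk ℂ V H).flip 1) (TensorProduct.comm ℂ V H x) =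
      (TensorProduct.comm ℂ V H).toLinearMap.rTensor H
        (tensorCoact ((TensorProduct.mk ℂ V H).flip 1) comul x) := by
  induction x with
  | zero => simp
  | add x y hx hy => simp only [map_add, hx, hy]
  | tmul v g =>
    rw [TensorProduct.comm_tmul, tensorCoact_tmul, tensorCoact_tmul, LinearMap.flip_apply,
      TensorProduct.mk_apply]
    induction comul (R := ℂ) g with
    | zero => simp
    | add x y hx hy => simp only [TensorProduct.add_tmul, TensorProduct.tmul_add, map_add, hx, hy]
    | tmul a b => simp

theorem tensorCoact_assoc (δ : U →ₗ[ℂ] U ⊗[ℂ] H) (δ' : V →ₗ[ℂ] V ⊗[ℂ] H)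
    (δ'' : W →ₗ[ℂ] W ⊗[ℂ] H) (x : (U ⊗[ℂ] V) ⊗[ℂ] W) :
    tensorCoact δ (tensorCoact δ' δ'') (TensorProduct.assoc ℂ U V W x) =
      (TensorProduct.assoc ℂ U V W).toLinearMap.rTensor H
        (tensorCoact (tensorCoact δ δ') δ'' x) := by
  induction x with
  | zero => simp
  | add x y hx hy => simp only [map_add, hx, hy]
  | tmul y w =>
    induction y with
    | zero => simp
    | add x y hx hy => simp only [TensorProduct.add_tmul, map_add, hx, hy]
    | tmul u v =>
      simp only [TensorProduct.assoc_tmul, tensorCoact_tmul]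
      generalize δ u = r
      generalize δ' v = s
      generalize δ'' w = t
      induction r with
      | zero => simp
      | add x y hx hy => simp only [TensorProduct.add_tmul, map_add, hx, hy]
      | tmul a b =>
        induction s with
        | zero => simp
        | add x y hx hy =>
          simp only [TensorProduct.tmul_add, TensorProduct.add_tmul, map_add, hx, hy]
        | tmul c d =>
          induction t with
          | zero => simp
          | add x y hx hy => simp only [TensorProduct.tmul_add, map_add, hx, hy]
          | tmul v q => simp [mul_assoc]

/-- The inductive step in the computation of the diagonal coaction of `H^{⊗(n+1)}` as that of
`H^{⊗n} ⊗ H`, with `V = H^{⊗n}`, `W = H^{⊗(n+1)}`, `X = H^{⊗(n+2)}`. -/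
theorem tensorCoact_snoc_step {X : Type*} [AddCommGroup X] [Module ℂ X]
    {δ : V →ₗ[ℂ] V ⊗[ℂ] H} {δ' : W →ₗ[ℂ] W ⊗[ℂ] H} {ε : X →ₗ[ℂ] X ⊗[ℂ] H}
    {c : H ⊗[ℂ] V ≃ₗ[ℂ] W} {s : V ⊗[ℂ] H ≃ₗ[ℂ] W} {c' : H ⊗[ℂ] W ≃ₗ[ℂ] X}
    {s' : W ⊗[ℂ] H ≃ₗ[ℂ] X}
    (hc : ∀ x, δ' (c x) = c.toLinearMap.rTensor H (tensorCoact comul δ x))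
    (hs : ∀ x, δ' (s x) = s.toLinearMap.rTensor H (tensorCoact δ comul x))
    (hc' : ∀ x, ε (c' x) = c'.toLinearMap.rTensor H (tensorCoact comul δ' x))
    (h : ∀ y, s' (c.toLinearMap.rTensor H y) =
      c' (s.toLinearMap.lTensor H (TensorProduct.assoc ℂ H V H y)))
    (x : W ⊗[ℂ] H) : ε (s' x) = s'.toLinearMap.rTensor H (tensorCoact δ' comul x) := by
  obtain ⟨y, rfl⟩ := (LinearEquiv.rTensor H c).surjective x
  change ε (s' (c.toLinearMap.rTensor H y)) =
    s'.toLinearMap.rTensor H (tensorCoact δ' comul (c.toLinearMap.rTensor H y))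
  have h' : s'.toLinearMap ∘ₗ c.toLinearMap.rTensor H = c'.toLinearMap ∘ₗ
      s.toLinearMap.lTensor H ∘ₗ (TensorProduct.assoc ℂ H V H).toLinearMap := LinearMap.ext h
  rw [h, hc', tensorCoact_lTensor comul hs, tensorCoact_rTensor comul hc, tensorCoact_assoc]
  have h'' := congrArg (LinearMap.rTensor H) h'
  simp only [LinearMap.rTensor_comp] at h''
  exact (LinearMap.congr_fun h'' _).symm

/-- For a right coaction `δ(v) = v₀ ⊗ v₁` of `H` on `V` and a linear endomorphism `f` of `H`, the
map `v ⊗ g ↦ v₀ ⊗ f(v₁) g`. -/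
def twist (δ : V →ₗ[ℂ] V ⊗[ℂ] H) (f : H →ₗ[ℂ] H) : V ⊗[ℂ] H →ₗ[ℂ] V ⊗[ℂ] H :=
  (LinearMap.mul' ℂ H ∘ₗ f.rTensor H).lTensor V ∘ₗ (TensorProduct.assoc ℂ V H H).toLinearMap ∘ₗ
    δ.rTensor H

theorem twist_tmul (δ : V →ₗ[ℂ] V ⊗[ℂ] H) (f : H →ₗ[ℂ] H) (v : V) (g : H) :
    twist δ f (v ⊗ₜ[ℂ] g) = (LinearMap.mulRight ℂ g ∘ₗ f).lTensor V (δ v) := by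
  simp only [twist, LinearMap.comp_apply, LinearMap.rTensor_tmul, LinearEquiv.coe_coe]
  induction δ v with
  | zero => simp
  | add x y hx hy => simp only [TensorProduct.add_tmul, map_add, hx, hy]
  | tmul a b => simp

/-- The twist of a tensor product of comodules, one factor at a time: `h ⊗ v ⊗ g` goes to
`h₁ ⊗ v₀ ⊗ h₂ (v₁ g)`. -/
theorem twist_id_tensorCoact {δ : V →ₗ[ℂ] V ⊗[ℂ] H} {δ' : W →ₗ[ℂ] W ⊗[ℂ] H} {e : H ⊗[ℂ] V →ₗ[ℂ] W}
    (he : ∀ x, δ' (e x) = e.rTensor H (tensorCoact comul δ x)) (h g : H) (v : V) :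
    twist δ' LinearMap.id (e (h ⊗ₜ[ℂ] v) ⊗ₜ[ℂ] g) =
      TensorProduct.map e (LinearMap.mul' ℂ H) (TensorProduct.tensorTensorTensorComm ℂ H H V H
        (comul (R := ℂ) h ⊗ₜ[ℂ] twist δ LinearMap.id (v ⊗ₜ[ℂ] g))) := by
  rw [twist_tmul, twist_tmul, he, tensorCoact_tmul]
  generalize δ v = t
  generalize comul (R := ℂ) h = s
  induction s with
  | zero => simp
  | add x y hx hy => simp only [TensorProduct.add_tmul, map_add, hx, hy]
  | tmul a b =>
    induction t with
    | zero => simp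
    | add x y hx hy => simp only [TensorProduct.tmul_add, map_add, hx, hy]
    | tmul x y => simp [mul_assoc]

/-- `f ↦ twist δ f` turns convolution into composition; this is the case of two convolution inverse
endomorphisms. -/
theorem IsRightCoaction.twist_twist {δ : V →ₗ[ℂ] V ⊗[ℂ] H} (hδ : IsRightCoaction δ)
    {f g : H →ₗ[ℂ] H}
    (hfg : ∀ h, LinearMap.mul' ℂ H (TensorProduct.map f g (comul (R := ℂ) h)) =
      algebraMap ℂ H (Coalgebra.counit h))
    (x : V ⊗[ℂ] H) : twist δ f (twist δ g x) = x := by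
  induction x with
  | zero => simp
  | add x y hx hy => simp only [map_add, hx, hy]
  | tmul v a =>
    let K : V ⊗[ℂ] (H ⊗[ℂ] H) →ₗ[ℂ] V ⊗[ℂ] H :=
      (LinearMap.mulRight ℂ a ∘ₗ LinearMap.mul' ℂ H ∘ₗ TensorProduct.map f g).lTensor V
    have e1 : ∀ s : V ⊗[ℂ] H, twist δ f ((LinearMap.mulRight ℂ a ∘ₗ g).lTensor V s) =
        K (TensorProduct.assoc ℂ V H H (δ.rTensor H s)) := by
      intro s
      induction s with
      | zero => simp
      | add x y hx hy => simp only [map_add, hx, hy]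
      | tmul u h =>
        simp only [LinearMap.lTensor_tmul, twist_tmul, LinearMap.rTensor_tmul]
        induction δ u with
        | zero => simp
        | add x y hx hy => simp only [TensorProduct.add_tmul, map_add, hx, hy]
        | tmul u k => simp [K, mul_assoc]
    have e2 : ∀ s : V ⊗[ℂ] H, K ((comul (R := ℂ)).lTensor V s) =
        TensorProduct.rid ℂ V ((Coalgebra.counit (R := ℂ)).lTensor V s) ⊗ₜ[ℂ] a := by
      intro s
      induction s with
      | zero => simp
      | add x y hx hy => simp only [TensorProduct.add_tmul, map_add, hx, hy]
      | tmul u h => simp [K, hfg, TensorProduct.smul_tmul, Algebra.algebraMap_eq_smul_one]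
    rw [twist_tmul, e1, hδ.coassoc, e2, hδ.counit]

/-- The automorphism `v ⊗ g ↦ v₀ ⊗ v₁ g` of `V ⊗ H`, with inverse `v ⊗ g ↦ v₀ ⊗ S(v₁) g`. -/
def IsRightCoaction.twistEquiv {δ : V →ₗ[ℂ] V ⊗[ℂ] H} (hδ : IsRightCoaction δ) :
    V ⊗[ℂ] H ≃ₗ[ℂ] V ⊗[ℂ] H :=
  LinearEquiv.ofLinearMap (twist δ LinearMap.id) (twist δ (HopfAlgebra.antipode ℂ))
    (LinearMap.ext (hδ.twist_twist HopfAlgebra.mul_antipode_lTensor_comul_apply))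
    (LinearMap.ext (hδ.twist_twist HopfAlgebra.mul_antipode_rTensor_comul_apply))

theorem IsRightCoaction.twistEquiv_tmul {δ : V →ₗ[ℂ] V ⊗[ℂ] H} (hδ : IsRightCoaction δ)
    (v : V) (g : H) :
    hδ.twistEquiv (v ⊗ₜ[ℂ] g) = (LinearMap.mulRight ℂ g).lTensor V (δ v) :=
  twist_tmul _ _ _ _

theorem IsRightCoaction.twistEquiv_symm_apply {δ : V →ₗ[ℂ] V ⊗[ℂ] H} (hδ : IsRightCoaction δ)
    (x : V ⊗[ℂ] H) : hδ.twistEquiv.symm x = twist δ (HopfAlgebra.antipode ℂ) x := rfl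

/-- The twist trivializes the tensor product of `V` with the regular comodule `H`: it carries the
diagonal coaction on `V ⊗ H` to the cofree one. -/
theorem IsRightCoaction.twistEquiv_tensorCoact {δ : V →ₗ[ℂ] V ⊗[ℂ] H} (hδ : IsRightCoaction δ)
    (x : V ⊗[ℂ] H) :
    hδ.twistEquiv.toLinearMap.rTensor H (tensorCoact δ comul x) =
      (TensorProduct.assoc ℂ V H H).symm ((comul (R := ℂ)).lTensor V (hδ.twistEquiv x)) := by
  induction x with
  | zero => simp
  | add x y hx hy => simp only [map_add, hx, hy]
  | tmul w g =>
    let K (s : H ⊗[ℂ] H) : V ⊗[ℂ] (H ⊗[ℂ] H) →ₗ[ℂ] (V ⊗[ℂ] H) ⊗[ℂ] H :=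
      (TensorProduct.assoc ℂ V H H).symm.toLinearMap ∘ₗ (LinearMap.mulRight ℂ s).lTensor V
    have K_add : ∀ s s' z, K (s + s') z = K s z + K s' z := by
      intro s s' z
      have : LinearMap.mulRight ℂ (s + s') = LinearMap.mulRight ℂ s + LinearMap.mulRight ℂ s' := by
        ext; simp [mul_add]
      simp only [K, this, LinearMap.lTensor_add, LinearMap.comp_apply, LinearMap.add_apply, map_add]
    have K_zero : ∀ z, K 0 z = 0 := by simp [K]
    have e1 : ∀ (t : V ⊗[ℂ] H) (s : H ⊗[ℂ] H),
        hδ.twistEquiv.toLinearMap.rTensor H ((LinearMap.mul' ℂ H).lTensor _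
          (TensorProduct.tensorTensorTensorComm ℂ V H H H (t ⊗ₜ[ℂ] s))) =
        K s (TensorProduct.assoc ℂ _ H H (δ.rTensor H t)) := by
      intro t s
      induction s with
      | zero => simp [K_zero]
      | add x y hx hy => simp only [TensorProduct.tmul_add, map_add, hx, hy, K_add]
      | tmul a b =>
        induction t with
        | zero => simp
        | add x y hx hy => simp only [TensorProduct.add_tmul, map_add, hx, hy]
        | tmul v q =>
          simp only [TensorProduct.tensorTensorTensorComm_tmul, LinearMap.lTensor_tmul,
            LinearMap.rTensor_tmul, LinearEquiv.coe_coe, LinearMap.mul'_apply,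
            hδ.twistEquiv_tmul]
          induction δ v with
          | zero => simp
          | add x y hx hy => simp only [TensorProduct.add_tmul, map_add, hx, hy]
          | tmul v q => simp [K]
    have e2 : ∀ t : V ⊗[ℂ] H, (TensorProduct.assoc ℂ V H H).symm
        ((comul (R := ℂ)).lTensor V ((LinearMap.mulRight ℂ g).lTensor V t)) =
        K (comul (R := ℂ) g) ((comul (R := ℂ)).lTensor _ t) := by
      intro t
      induction t with
      | zero => simp
      | add x y hx hy => simp only [map_add, hx, hy]
      | tmul v q => simp [K]
    rw [tensorCoact_tmul, e1, hδ.twistEquiv_tmul, e2, hδ.coassoc]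

/-- `ε(v₁ g) v₀ = ε(g) v`. -/
theorem IsRightCoaction.counit_twistEquiv {δ : V →ₗ[ℂ] V ⊗[ℂ] H} (hδ : IsRightCoaction δ)
    (x : V ⊗[ℂ] H) :
    TensorProduct.rid ℂ _ ((Coalgebra.counit (R := ℂ)).lTensor _ (hδ.twistEquiv x)) =
      TensorProduct.rid ℂ _ ((Coalgebra.counit (R := ℂ)).lTensor _ x) := by
  induction x with
  | zero => simp
  | add x y hx hy => simp only [map_add, hx, hy]
  | tmul v a =>
    have : ∀ t : V ⊗[ℂ] H, TensorProduct.rid ℂ _ ((Coalgebra.counit (R := ℂ)).lTensor _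
        ((LinearMap.mulRight ℂ a).lTensor V t)) = Coalgebra.counit (R := ℂ) a •
        TensorProduct.rid ℂ _ ((Coalgebra.counit (R := ℂ)).lTensor _ t) := by
      intro t
      induction t with
      | zero => simp
      | add x y hx hy => simp only [map_add, hx, hy, smul_add]
      | tmul v q => simp [smul_smul, mul_comm]
    rw [hδ.twistEquiv_tmul, this, hδ.counit]
    simp

/-- For a cofree right comodule `X ≃ V ⊗ H`, the cotensor product `X □_H M` with a left comodule `M`
is `V ⊗ M`. -/
theorem bijective_cotensor_cofree {X M : Type*} [AddCommGroup X] [Module ℂ X] [AddCommGroup M]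
    [Module ℂ M] {δ : X →ₗ[ℂ] X ⊗[ℂ] H} {ρ : M →ₗ[ℂ] H ⊗[ℂ] M} (t : X ≃ₗ[ℂ] V ⊗[ℂ] H)
    (ht : ∀ x, t.toLinearMap.rTensor H (δ x) =
      (TensorProduct.assoc ℂ V H H).symm ((comul (R := ℂ)).lTensor V (t x)))
    (hc : ∀ m : M, TensorProduct.assoc ℂ H H M ((comul (R := ℂ)).rTensor M (ρ m)) =
      ρ.lTensor H (ρ m))
    (hu : ∀ m : M, TensorProduct.lid ℂ M ((Coalgebra.counit (R := ℂ)).rTensor M (ρ m)) = m)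
    {p : X →ₗ[ℂ] V}
    (hp : ∀ x, p x = TensorProduct.rid ℂ V ((Coalgebra.counit (R := ℂ)).lTensor V (t x))) :
    Function.Bijective (p.rTensor M ∘ₗ (cotensor δ ρ).subtype) := by
  -- an element of a cofree comodule is recovered from its coaction: `p x₀ ⊗ x₁ = t x`
  have hpδ : ∀ x, p.rTensor H (δ x) = t x := by
    intro x
    have e1 : ∀ s : X ⊗[ℂ] H, p.rTensor H s = ((TensorProduct.rid ℂ V).toLinearMap ∘ₗ
        (Coalgebra.counit (R := ℂ)).lTensor V).rTensor H (t.toLinearMap.rTensor H s) := by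
      intro s
      induction s with
      | zero => simp
      | add x y hx hy => simp only [map_add, hx, hy]
      | tmul a b => simp [hp]
    have e2 : ∀ s : V ⊗[ℂ] H, ((TensorProduct.rid ℂ V).toLinearMap ∘ₗ
        (Coalgebra.counit (R := ℂ)).lTensor V).rTensor H ((TensorProduct.assoc ℂ V H H).symm
          ((comul (R := ℂ)).lTensor V s)) = s := by
      intro s
      induction s with
      | zero => simp
      | add x y hx hy => simp only [map_add, hx, hy]
      | tmul a b =>
        have e3 : ∀ r : H ⊗[ℂ] H, ((TensorProduct.rid ℂ V).toLinearMap ∘ₗ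
            (Coalgebra.counit (R := ℂ)).lTensor V).rTensor H ((TensorProduct.assoc ℂ V H H).symm
            (a ⊗ₜ[ℂ] r)) = a ⊗ₜ[ℂ] TensorProduct.lid ℂ H
              ((Coalgebra.counit (R := ℂ)).rTensor H r) := by
          intro r
          induction r with
          | zero => simp
          | add x y hx hy => simp only [TensorProduct.tmul_add, map_add, hx, hy]
          | tmul h k => simp [TensorProduct.smul_tmul]
        rw [LinearMap.lTensor_tmul, e3, rTensor_counit_comul]
        simp
    rw [e1, ht, e2]
  have e1 : ∀ z : X ⊗[ℂ] M, p.rTensor (H ⊗[ℂ] M) (TensorProduct.assoc ℂ X H M (δ.rTensor M z)) =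
      TensorProduct.assoc ℂ V H M (t.toLinearMap.rTensor M z) := by
    intro z
    induction z with
    | zero => simp
    | add x y hx hy => simp only [map_add, hx, hy]
    | tmul a m =>
      rw [LinearMap.rTensor_tmul, LinearMap.rTensor_tmul, LinearEquiv.coe_coe, ← hpδ]
      induction δ a with
      | zero => simp
      | add x y hx hy => simp only [TensorProduct.add_tmul, map_add, hx, hy]
      | tmul b h => simp
  -- on `X □_H M` the map `p ⊗ M` determines `t ⊗ M`, hence is injective
  have e2 : ∀ z ∈ cotensor δ ρ, TensorProduct.assoc ℂ V H M (t.toLinearMap.rTensor M z) =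
      ρ.lTensor V (p.rTensor M z) := by
    intro z hz
    have hz' : TensorProduct.assoc ℂ X H M (δ.rTensor M z) = ρ.lTensor X z := hz
    rw [← e1, hz', lTensor_rTensor_comm]
  constructor
  · intro z z' h
    apply Subtype.ext
    apply (LinearEquiv.rTensor M t).injective
    apply (TensorProduct.assoc ℂ V H M).injective
    refine (e2 z z.2).trans (Eq.trans ?_ (e2 z' z'.2).symm)
    exact congrArg _ h
  · intro y
    -- the preimage of `v ⊗ m` is `v ⊗ m₋₁ ⊗ m₀` under `X ≃ V ⊗ H`
    let z := t.symm.toLinearMap.rTensor M ((TensorProduct.assoc ℂ V H M).symm (ρ.lTensor V y))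
    have hz : t.toLinearMap.rTensor M z = (TensorProduct.assoc ℂ V H M).symm (ρ.lTensor V y) :=
      (LinearEquiv.rTensor M t).apply_symm_apply _
    have e3 : ∀ z : X ⊗[ℂ] M, t.toLinearMap.rTensor (H ⊗[ℂ] M)
        (TensorProduct.assoc ℂ X H M (δ.rTensor M z)) =
        TensorProduct.assoc ℂ (V ⊗[ℂ] H) H M (((TensorProduct.assoc ℂ V H H).symm.toLinearMap ∘ₗ
          (comul (R := ℂ)).lTensor V).rTensor M (t.toLinearMap.rTensor M z)) := by
      intro z
      induction z with
      | zero => simp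
      | add x y hx hy => simp only [map_add, hx, hy]
      | tmul a m =>
        simp only [LinearMap.rTensor_tmul, LinearMap.comp_apply, LinearEquiv.coe_coe, ← ht]
        induction δ a with
        | zero => simp
        | add x y hx hy => simp only [TensorProduct.add_tmul, map_add, hx, hy]
        | tmul b h => simp
    have e4 : ∀ y : V ⊗[ℂ] M, TensorProduct.assoc ℂ (V ⊗[ℂ] H) H M
        (((TensorProduct.assoc ℂ V H H).symm.toLinearMap ∘ₗ
          (comul (R := ℂ)).lTensor V).rTensor M
          ((TensorProduct.assoc ℂ V H M).symm (ρ.lTensor V y))) =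
        ρ.lTensor (V ⊗[ℂ] H) ((TensorProduct.assoc ℂ V H M).symm (ρ.lTensor V y)) := by
      intro y
      induction y with
      | zero => simp
      | add x y hx hy => simp only [map_add, hx, hy]
      | tmul v m =>
        let F : H ⊗[ℂ] (H ⊗[ℂ] M) →ₗ[ℂ] (V ⊗[ℂ] H) ⊗[ℂ] (H ⊗[ℂ] M) :=
          (TensorProduct.mk ℂ V H v).rTensor (H ⊗[ℂ] M)
        have e5 : ∀ s : H ⊗[ℂ] M, TensorProduct.assoc ℂ (V ⊗[ℂ] H) H M
            (((TensorProduct.assoc ℂ V H H).symm.toLinearMap ∘ₗ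
            (comul (R := ℂ)).lTensor V).rTensor M
            ((TensorProduct.assoc ℂ V H M).symm (v ⊗ₜ[ℂ] s))) =
            F (TensorProduct.assoc ℂ H H M ((comul (R := ℂ)).rTensor M s)) := by
          intro s
          induction s with
          | zero => simp
          | add x y hx hy => simp only [TensorProduct.tmul_add, map_add, hx, hy]
          | tmul h m =>
            simp only [TensorProduct.assoc_symm_tmul, LinearMap.rTensor_tmul,
              LinearMap.comp_apply, LinearMap.lTensor_tmul, LinearEquiv.coe_coe]
            induction comul (R := ℂ) h with
            | zero => simp
            | add x y hx hy =>
              simp only [TensorProduct.tmul_add, TensorProduct.add_tmul, map_add, hx, hy]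
            | tmul h k => simp [F]
        have e6 : ∀ s : H ⊗[ℂ] M, ρ.lTensor (V ⊗[ℂ] H)
            ((TensorProduct.assoc ℂ V H M).symm (v ⊗ₜ[ℂ] s)) = F (ρ.lTensor H s) := by
          intro s
          induction s with
          | zero => simp
          | add x y hx hy => simp only [TensorProduct.tmul_add, map_add, hx, hy]
          | tmul h m => simp [F]
        rw [LinearMap.lTensor_tmul, e5, e6, hc]
    have zmem : z ∈ cotensor δ ρ := by
      change TensorProduct.assoc ℂ X H M (δ.rTensor M z) = ρ.lTensor X z
      apply (LinearEquiv.rTensor (H ⊗[ℂ] M) t).injective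
      change t.toLinearMap.rTensor _ _ = t.toLinearMap.rTensor _ _
      rw [e3, hz, e4, ← hz, lTensor_rTensor_comm]
    refine ⟨⟨z, zmem⟩, ?_⟩
    have e5 : ∀ z : X ⊗[ℂ] M, p.rTensor M z = ((TensorProduct.rid ℂ V).toLinearMap ∘ₗ
        (Coalgebra.counit (R := ℂ)).lTensor V).rTensor M (t.toLinearMap.rTensor M z) := by
      intro z
      induction z with
      | zero => simp
      | add x y hx hy => simp only [map_add, hx, hy]
      | tmul a m => simp [hp]
    rw [LinearMap.comp_apply, Submodule.subtype_apply, e5, hz]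
    clear zmem hz z
    induction y with
    | zero => simp
    | add x y hx hy => simp only [map_add, hx, hy]
    | tmul v m =>
      rw [LinearMap.lTensor_tmul]
      conv_rhs => rw [← hu m]
      induction ρ m with
      | zero => simp
      | add x y hx hy => simp only [TensorProduct.tmul_add, map_add, hx, hy]
      | tmul h m => simp [TensorProduct.smul_tmul]

end RightCoaction

section Diagonal

variable {H : Type*} [Ring H] [HopfAlgebra ℂ H]

theorem isRightCoaction_comul : IsRightCoaction (comul (R := ℂ) (A := H)) where
  coassoc := coassoc_apply
  counit h := by simp

theorem diagCoact_cons (n : ℕ) (x : H ⊗[ℂ] ⨂[ℂ]^n H) :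
    diagCoact (n + 1) (cons n x) =
      (cons n).toLinearMap.rTensor H (tensorCoact comul (diagCoact n) x) := by
  simp only [diagCoact, tensorCoact, LinearMap.comp_apply, LinearEquiv.coe_coe,
    LinearEquiv.symm_apply_apply]
  rw [← LinearMap.comp_apply, LinearMap.rTensor_comp_lTensor]

theorem IsRightCoaction.congr {V W : Type*} [AddCommGroup V] [Module ℂ V]
    [AddCommGroup W] [Module ℂ W] {δ : V →ₗ[ℂ] V ⊗[ℂ] H} (hδ : IsRightCoaction δ)
    {δ' : W →ₗ[ℂ] W ⊗[ℂ] H} (e : V ≃ₗ[ℂ] W)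
    (h : ∀ v, δ' (e v) = e.toLinearMap.rTensor H (δ v)) : IsRightCoaction δ' where
  coassoc w := by
    obtain ⟨v, rfl⟩ := e.surjective w
    have e1 : ∀ t : V ⊗[ℂ] H, TensorProduct.assoc ℂ W H H (δ'.rTensor H
        (e.toLinearMap.rTensor H t)) = e.toLinearMap.rTensor (H ⊗[ℂ] H)
        (TensorProduct.assoc ℂ V H H (δ.rTensor H t)) := by
      intro t
      induction t with
      | zero => simp
      | add x y hx hy => simp only [map_add, hx, hy]
      | tmul v q =>
        simp only [LinearMap.rTensor_tmul, LinearEquiv.coe_coe, h]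
        induction δ v with
        | zero => simp
        | add x y hx hy => simp only [TensorProduct.add_tmul, map_add, hx, hy]
        | tmul v q => simp
    rw [h, e1, hδ.coassoc, lTensor_rTensor_comm]
  counit w := by
    obtain ⟨v, rfl⟩ := e.surjective w
    have e1 : ∀ t : V ⊗[ℂ] H, TensorProduct.rid ℂ W ((Coalgebra.counit (R := ℂ)).lTensor W
        (e.toLinearMap.rTensor H t)) =
        e (TensorProduct.rid ℂ V ((Coalgebra.counit (R := ℂ)).lTensor V t)) := by
      intro t
      induction t with
      | zero => simp
      | add x y hx hy => simp only [map_add, hx, hy]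
      | tmul v q => simp
    rw [h, e1, hδ.counit]

variable (H) in
theorem isRightCoaction_diagCoact (n : ℕ) : IsRightCoaction (diagCoact (H := H) n) := by
  induction n with
  | zero =>
    constructor
    · intro w
      simp [diagCoact, Algebra.TensorProduct.one_def]
    · intro w
      simp [diagCoact]
  | succ n ih => exact (isRightCoaction_comul.tensor ih).congr (cons n) (diagCoact_cons n)

/-- The diagonal coaction, defined by splitting off the first factor, computed by splitting off the
last one. -/
theorem diagCoact_snoc (n : ℕ) (x : (⨂[ℂ]^n H) ⊗[ℂ] H) :
    diagCoact (n + 1) (snoc n x) =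
      (snoc n).toLinearMap.rTensor H (tensorCoact (diagCoact n) comul x) := by
  induction n with
  | zero =>
    have h : ∀ x : (⨂[ℂ]^0 H) ⊗[ℂ] H, snoc 0 x = cons 0 (TensorProduct.comm ℂ _ H x) := by
      intro x
      induction x with
      | zero => simp
      | add x y hx hy => simp only [map_add, hx, hy]
      | tmul w g => exact snoc_zero_tmul w g
    have h' : (snoc 0).toLinearMap = (cons (V := H) 0).toLinearMap ∘ₗ
      (TensorProduct.comm ℂ _ H).toLinearMap := LinearMap.ext h
    rw [h, diagCoact_cons, h', LinearMap.rTensor_comp, LinearMap.comp_apply]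
    exact congrArg _ (tensorCoact_trivial_comm x)
  | succ n ih =>
    exact tensorCoact_snoc_step (diagCoact_cons n) ih (diagCoact_cons (n + 1))
      (LinearMap.congr_fun (TensorProduct.ext_threefold fun a w b => snoc_cons n a b w :
        (snoc (n + 1)).toLinearMap ∘ₗ (cons n).toLinearMap.rTensor H =
        (cons (n + 1)).toLinearMap ∘ₗ (snoc n).toLinearMap.lTensor H ∘ₗ
          (TensorProduct.assoc ℂ H (⨂[ℂ]^n H) H).toLinearMap)) x

/-- The inverse of `phi` is `appendCoact`, but bijectivity is read off from the fact that
`H^{⊗(n+1)}` is cofree. -/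
theorem phi_bijective {M : Type*} [AddCommGroup M] [Module ℂ M] {ρ : M →ₗ[ℂ] H ⊗[ℂ] M}
    (hc : ∀ m : M, TensorProduct.assoc ℂ H H M ((comul (R := ℂ)).rTensor M (ρ m)) =
      ρ.lTensor H (ρ m))
    (hu : ∀ m : M, TensorProduct.lid ℂ M ((Coalgebra.counit (R := ℂ)).rTensor M (ρ m)) = m)
    (n : ℕ) : Function.Bijective (phi ρ n) := by
  have hδ := isRightCoaction_diagCoact H n
  refine bijective_cotensor_cofree ((snoc n).symm ≪≫ₗ hδ.twistEquiv) (fun x => ?_) hc hu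
    (fun x => ?_)
  · obtain ⟨y, rfl⟩ := (snoc n).surjective x
    rw [diagCoact_snoc]
    have e : ∀ s : ((⨂[ℂ]^n H) ⊗[ℂ] H) ⊗[ℂ] H,
        ((snoc n).symm ≪≫ₗ hδ.twistEquiv).toLinearMap.rTensor H
        ((snoc n).toLinearMap.rTensor H s) = hδ.twistEquiv.toLinearMap.rTensor H s := by
      intro s
      rw [← LinearMap.comp_apply, ← LinearMap.rTensor_comp]
      congr 2
      ext
      simp
    rw [e, hδ.twistEquiv_tensorCoact, LinearEquiv.trans_apply, LinearEquiv.symm_apply_apply]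
  · rw [LinearEquiv.trans_apply, hδ.counit_twistEquiv]
    rfl

end Diagonal
end CocycHopf

namespace CocycHopf
namespace RightModuleCoalgebra

variable {H C : Type*} [Ring H] [HopfAlgebra ℂ H] [AddCommGroup C] [Module ℂ C] [Coalgebra ℂ C]
  (A : RightModuleCoalgebra H C)

/-! ### The stable anti-Yetter-Drinfeld module of a Hopf-Galois coextension -/

variable {A} in
theorem betaAmb_injective (hA : A.IsHopfGalois) : Function.Injective A.betaAmb :=
  fun _ _ h => hA.1 (Subtype.ext h)

theorem betaAmb_tmul (c : C) (h : H) :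
    A.betaAmb (c ⊗ₜ[ℂ] h) =
      (A.act ∘ₗ (TensorProduct.mk ℂ C H).flip h).lTensor C (comul (R := ℂ) c) := by
  simp only [betaAmb, LinearMap.comp_apply, LinearMap.rTensor_tmul, LinearEquiv.coe_coe]
  induction comul (R := ℂ) c with
  | zero => simp
  | add x y hx hy => simp only [TensorProduct.add_tmul, map_add, hx, hy]
  | tmul a b => simp

theorem counit_rTensor_betaAmb (x : C ⊗[ℂ] H) :
    TensorProduct.lid ℂ C ((counit (R := ℂ)).rTensor C (A.betaAmb x)) = A.act x := by
  induction x with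
  | zero => simp
  | add x y hx hy => simp only [map_add, hx, hy]
  | tmul c h =>
    have : ∀ s : C ⊗[ℂ] C, TensorProduct.lid ℂ C ((counit (R := ℂ)).rTensor C
        ((A.act ∘ₗ (TensorProduct.mk ℂ C H).flip h).lTensor C s)) =
        A.act (TensorProduct.lid ℂ C ((counit (R := ℂ)).rTensor C s) ⊗ₜ[ℂ] h) := by
      intro s
      induction s with
      | zero => simp
      | add x y hx hy => simp only [TensorProduct.add_tmul, map_add, hx, hy]
      | tmul a b => simp [← TensorProduct.smul_tmul']
    rw [betaAmb_tmul, this, rTensor_counit_comul]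
    simp

theorem counit_lTensor_betaAmb (x : C ⊗[ℂ] H) :
    TensorProduct.rid ℂ C ((counit (R := ℂ)).lTensor C (A.betaAmb x)) =
      TensorProduct.rid ℂ C ((counit (R := ℂ)).lTensor C x) := by
  induction x with
  | zero => simp
  | add x y hx hy => simp only [map_add, hx, hy]
  | tmul c h =>
    have : ∀ s : C ⊗[ℂ] C, TensorProduct.rid ℂ C ((counit (R := ℂ)).lTensor C
        ((A.act ∘ₗ (TensorProduct.mk ℂ C H).flip h).lTensor C s)) =
        counit (R := ℂ) h • TensorProduct.rid ℂ C ((counit (R := ℂ)).lTensor C s) := by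
      intro s
      induction s with
      | zero => simp
      | add x y hx hy => simp only [map_add, hx, hy, smul_add]
      | tmul a b => simp [A.counit_act, smul_smul, mul_comm]
    rw [betaAmb_tmul, this, lTensor_counit_comul]
    simp

/-- The Galois map is right `C`-colinear for the diagonal coaction: `c₁ ⊗ Δ(c₂ ◁ h)` is
`c₁ ⊗ c₂ ◁ h₁ ⊗ c₃ ◁ h₂`. -/
theorem lTensor_comul_betaAmb (c : C) (h : H) :
    (comul (R := ℂ)).lTensor C (A.betaAmb (c ⊗ₜ[ℂ] h)) =
      (TensorProduct.map A.act A.act ∘ₗ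
        (TensorProduct.tensorTensorTensorComm ℂ C C H H).toLinearMap ∘ₗ
        (TensorProduct.mk ℂ (C ⊗[ℂ] C) (H ⊗[ℂ] H)).flip (comul (R := ℂ) h)).lTensor C
        (comul3 c) := by
  rw [betaAmb_tmul, comul3, LinearMap.comp_apply]
  induction comul (R := ℂ) c with
  | zero => simp
  | add x y hx hy => simp only [map_add, hx, hy]
  | tmul a b => simp [A.comul_act]

/-- `(c ◁ b₁)₁ ⊗ (c ◁ b₁)₂ ◁ S(b₂) k = c₁ ◁ b ⊗ c₂ ◁ k`, by the antipode axiom. -/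
theorem betaAmb_act_antipode (c : C) (b k : H) :
    A.betaAmb (TensorProduct.map (A.act ∘ₗ TensorProduct.mk ℂ C H c)
        (LinearMap.mulRight ℂ k ∘ₗ HopfAlgebra.antipode ℂ) (comul (R := ℂ) b)) =
      TensorProduct.map (A.act ∘ₗ (TensorProduct.mk ℂ C H).flip b)
        (A.act ∘ₗ (TensorProduct.mk ℂ C H).flip k) (comul (R := ℂ) c) := by
  let L (u : C ⊗[ℂ] C) : H ⊗[ℂ] (H ⊗[ℂ] H) →ₗ[ℂ] C ⊗[ℂ] C :=
    TensorProduct.map A.act A.act ∘ₗ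
      (TensorProduct.tensorTensorTensorComm ℂ C C H H).toLinearMap ∘ₗ
      TensorProduct.mk ℂ (C ⊗[ℂ] C) (H ⊗[ℂ] H) u ∘ₗ
      (LinearMap.mulRight ℂ k ∘ₗ LinearMap.mul' ℂ H ∘ₗ
        (HopfAlgebra.antipode ℂ).lTensor H).lTensor H
  have e1 : ∀ t : H ⊗[ℂ] H, A.betaAmb (TensorProduct.map (A.act ∘ₗ TensorProduct.mk ℂ C H c)
      (LinearMap.mulRight ℂ k ∘ₗ HopfAlgebra.antipode ℂ) t) =
      L (comul c) (TensorProduct.assoc ℂ H H H ((comul (R := ℂ)).rTensor H t)) := by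
    intro t
    induction t with
    | zero => simp
    | add x y hx hy => simp only [map_add, hx, hy]
    | tmul x y =>
      simp only [TensorProduct.map_tmul, LinearMap.comp_apply, betaAmb_tmul,
        TensorProduct.mk_apply, A.comul_act, LinearMap.rTensor_tmul]
      generalize comul (R := ℂ) c = u
      generalize comul (R := ℂ) x = v
      induction v with
      | zero => simp
      | add x y hx hy => simp only [TensorProduct.tmul_add, TensorProduct.add_tmul, map_add, hx, hy]
      | tmul x x' =>
        induction u with
        | zero => simp [L]
        | add u u' hu hu' =>
          simp only [TensorProduct.add_tmul, map_add, hu, hu']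
          simp [L]
        | tmul p q => simp [L, ← A.act_mul, mul_assoc]
  have e2 : ∀ t : H ⊗[ℂ] H, L (comul c) ((comul (R := ℂ)).lTensor H t) =
      TensorProduct.map A.act A.act (TensorProduct.tensorTensorTensorComm ℂ C C H H
        (comul c ⊗ₜ[ℂ] (TensorProduct.rid ℂ H ((counit (R := ℂ)).lTensor H t) ⊗ₜ[ℂ] k))) := by
    intro t
    induction t with
    | zero => simp
    | add x y hx hy => simp only [TensorProduct.add_tmul, TensorProduct.tmul_add, map_add, hx, hy]
    | tmul x y =>
      simp [L, HopfAlgebra.mul_antipode_lTensor_comul_apply, Algebra.algebraMap_eq_smul_one,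
        TensorProduct.smul_tmul]
  rw [e1, coassoc_apply, e2, lTensor_counit_comul]
  induction comul (R := ℂ) c with
  | zero => simp
  | add x y hx hy => simp only [TensorProduct.add_tmul, map_add, hx, hy]
  | tmul p q => simp

section SAYD

variable {M : Type*} [AddCommGroup M] [Module ℂ M]

/-- The Galois map on `M`, viewed in `C` via `η`: `h ⊗ m ↦ η(m)₁ ⊗ η(m)₂ ◁ h`. -/
def betaVia (η : M →ₗ[ℂ] C) : H ⊗[ℂ] M →ₗ[ℂ] C ⊗[ℂ] C :=
  A.betaAmb ∘ₗ (TensorProduct.comm ℂ H C).toLinearMap ∘ₗ η.lTensor H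

theorem betaVia_tmul (η : M →ₗ[ℂ] C) (h : H) (m : M) :
    A.betaVia η (h ⊗ₜ[ℂ] m) = A.betaAmb (η m ⊗ₜ[ℂ] h) := by simp [betaVia]

variable {A} in
theorem betaVia_injective (hA : A.IsHopfGalois) {η : M →ₗ[ℂ] C} (hη : Function.Injective η) :
    Function.Injective (A.betaVia η) :=
  (betaAmb_injective hA).comp ((TensorProduct.comm ℂ H C).injective.comp
    (Module.Flat.lTensor_preserves_injective_linearMap (M := H) η hη))

/-- The twofold Galois map on `M`, viewed in `C` via `η`:
`g ⊗ h ⊗ m ↦ η(m)₁ ⊗ η(m)₂ ◁ g ⊗ η(m)₃ ◁ h`. -/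
def betaVia₂ (η : M →ₗ[ℂ] C) : H ⊗[ℂ] (H ⊗[ℂ] M) →ₗ[ℂ] (C ⊗[ℂ] C) ⊗[ℂ] C :=
  (A.betaVia LinearMap.id).rTensor C ∘ₗ (TensorProduct.assoc ℂ H C C).symm.toLinearMap ∘ₗ
    (A.betaVia η).lTensor H

variable {A} in
theorem betaVia₂_injective (hA : A.IsHopfGalois) {η : M →ₗ[ℂ] C} (hη : Function.Injective η) :
    Function.Injective (A.betaVia₂ η) :=
  (Module.Flat.rTensor_preserves_injective_linearMap (M := C) _
    (betaVia_injective hA Function.injective_id)).comp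
    ((TensorProduct.assoc ℂ H C C).symm.injective.comp
      (Module.Flat.lTensor_preserves_injective_linearMap (M := H) _ (betaVia_injective hA hη)))

theorem betaVia₂_comul (η : M →ₗ[ℂ] C) (s : H ⊗[ℂ] M) :
    A.betaVia₂ η (TensorProduct.assoc ℂ H H M ((comul (R := ℂ)).rTensor M s)) =
      (TensorProduct.assoc ℂ C C C).symm ((comul (R := ℂ)).lTensor C (A.betaVia η s)) := by
  induction s with
  | zero => simp
  | add x y hx hy => simp only [map_add, hx, hy]
  | tmul h m =>
    rw [betaVia_tmul, lTensor_comul_betaAmb, LinearMap.rTensor_tmul]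
    have e : ∀ r : H ⊗[ℂ] H, A.betaVia₂ η (TensorProduct.assoc ℂ H H M (r ⊗ₜ[ℂ] m)) =
        (TensorProduct.assoc ℂ C C C).symm ((TensorProduct.map A.act A.act ∘ₗ
          (TensorProduct.tensorTensorTensorComm ℂ C C H H).toLinearMap ∘ₗ
          (TensorProduct.mk ℂ (C ⊗[ℂ] C) (H ⊗[ℂ] H)).flip r).lTensor C (comul3 (η m))) := by
      intro r
      induction r with
      | zero => simp
      | add x y hx hy =>
        simp only [TensorProduct.add_tmul, map_add, hx, hy, LinearMap.comp_add,
          LinearMap.lTensor_add, LinearMap.add_apply]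
      | tmul g h =>
        simp only [betaVia₂, LinearMap.comp_apply, TensorProduct.assoc_tmul,
          LinearMap.lTensor_tmul, betaVia_tmul, betaAmb_tmul, LinearEquiv.coe_coe]
        rw [comul3, LinearMap.comp_apply, ← assoc_rTensor_comul]
        induction comul (R := ℂ) (η m) with
        | zero => simp
        | add x y hx hy => simp only [TensorProduct.tmul_add, map_add, hx, hy]
        | tmul a b =>
          simp only [LinearMap.lTensor_tmul, TensorProduct.assoc_symm_tmul,
            LinearMap.rTensor_tmul, betaVia_tmul, LinearMap.id_apply, betaAmb_tmul]
          induction comul (R := ℂ) a with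
          | zero => simp
          | add x y hx hy => simp only [TensorProduct.add_tmul, map_add, hx, hy]
          | tmul a a' => simp
    exact e _

/-- Both Galois maps turn a coaction with `m₀₁ ⊗ m₀₂ ◁ m₋₁ = m₂ ⊗ m₁` into a flip, so applying `ρ` to `m`
in `h ⊗ m` amounts to comultiplying the first factor of the image and rotating. -/
theorem betaVia₂_coact (η : M →ₗ[ℂ] C) {ρ : M →ₗ[ℂ] H ⊗[ℂ] M}
    (hρ : ∀ m, A.betaVia η (ρ m) = TensorProduct.comm ℂ C C (comul (R := ℂ) (η m)))
    (s : H ⊗[ℂ] M) :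
    A.betaVia₂ η (ρ.lTensor H s) = TensorProduct.comm ℂ C (C ⊗[ℂ] C)
      (TensorProduct.assoc ℂ C C C ((comul (R := ℂ)).rTensor C (A.betaVia η s))) := by
  induction s with
  | zero => simp
  | add x y hx hy => simp only [map_add, hx, hy]
  | tmul h m =>
    rw [betaVia_tmul, betaAmb_colinear, LinearMap.lTensor_tmul, betaVia₂, LinearMap.comp_apply,
      LinearMap.comp_apply, LinearMap.lTensor_tmul, hρ, LinearMap.rTensor_tmul]
    induction comul (R := ℂ) (η m) with
    | zero => simp
    | add x y hx hy =>
      simp only [TensorProduct.tmul_add, TensorProduct.add_tmul, map_add, hx, hy]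
    | tmul a b => simp [betaVia_tmul]

/-- `g ⊗ m ⊗ h ↦ S(h₃) g h₁ ⊗ m ◁ h₂`, followed by `betaVia`, simplifies to
`η(m)₁ ◁ h₂ ⊗ η(m)₂ ◁ g h₁`. -/
theorem betaVia_aydMap (η : M →ₗ[ℂ] C) {act' : M ⊗[ℂ] H →ₗ[ℂ] M}
    (hact : ∀ m h, η (act' (m ⊗ₜ[ℂ] h)) = A.act (η m ⊗ₜ[ℂ] h)) (s : H ⊗[ℂ] M) (h : H) :
    A.betaVia η (aydMap act' (s ⊗ₜ[ℂ] (comul (R := ℂ)).lTensor H (comul (R := ℂ) h))) =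
      TensorProduct.map A.act A.act (TensorProduct.tensorTensorTensorComm ℂ C C H H
        (A.betaVia η s ⊗ₜ[ℂ] TensorProduct.comm ℂ H H (comul (R := ℂ) h))) := by
  induction s with
  | zero => simp
  | add x y hx hy => simp only [TensorProduct.add_tmul, map_add, hx, hy]
  | tmul g m =>
    rw [betaVia_tmul, betaAmb_tmul]
    induction comul (R := ℂ) h with
    | zero => simp
    | add x y hx hy => simp only [TensorProduct.tmul_add, map_add, hx, hy]
    | tmul a b =>
      have e1 : ∀ t : H ⊗[ℂ] H, A.betaVia η (aydMap act' ((g ⊗ₜ[ℂ] m) ⊗ₜ[ℂ] (a ⊗ₜ[ℂ] t))) =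
          A.betaAmb (TensorProduct.map (A.act ∘ₗ TensorProduct.mk ℂ C H (η m))
            (LinearMap.mulRight ℂ (g * a) ∘ₗ HopfAlgebra.antipode ℂ) t) := by
        intro t
        induction t with
        | zero => simp
        | add x y hx hy => simp only [TensorProduct.tmul_add, map_add, hx, hy]
        | tmul x y => simp [aydMap, betaVia_tmul, hact, mul_assoc]
      rw [LinearMap.lTensor_tmul, e1, betaAmb_act_antipode]
      induction comul (R := ℂ) (η m) with
      | zero => simp
      | add x y hx hy => simp only [TensorProduct.add_tmul, map_add, hx, hy]
      | tmul p q => simp [A.act_mul]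

variable {A} in
/-- An `H`-submodule `M` of `C` (via `η`) with a left coaction `ρ` such that `m₀₁ ⊗ m₀₂ ◁ m₋₁ = m₂ ⊗ m₁` is stable
anti-Yetter-Drinfeld: each axiom becomes an identity in tensor powers of `C` after applying the
Galois map, which is injective. -/
theorem isSAYD_of_betaVia (hA : A.IsHopfGalois) {η : M →ₗ[ℂ] C} (hη : Function.Injective η)
    {act' : M ⊗[ℂ] H →ₗ[ℂ] M} (hact : ∀ m h, η (act' (m ⊗ₜ[ℂ] h)) = A.act (η m ⊗ₜ[ℂ] h))
    {ρ : M →ₗ[ℂ] H ⊗[ℂ] M}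
    (hρ : ∀ m, A.betaVia η (ρ m) = TensorProduct.comm ℂ C C (comul (R := ℂ) (η m))) :
    IsSAYD act' ρ where
  act_one m := hη (by rw [hact, A.act_one])
  act_mul m h k := hη (by rw [hact, hact, hact, A.act_mul])
  coassoc m := by
    apply betaVia₂_injective hA hη
    rw [betaVia₂_comul, betaVia₂_coact A η hρ, hρ]
    -- both sides are `c₃ ⊗ c₁ ⊗ c₂` for `c = η m`
    have e1 : ∀ s : C ⊗[ℂ] C, (TensorProduct.assoc ℂ C C C).symm ((comul (R := ℂ)).lTensor C
        (TensorProduct.comm ℂ C C s)) =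
        (TensorProduct.assoc ℂ C C C).symm (TensorProduct.comm ℂ (C ⊗[ℂ] C) C
          ((TensorProduct.assoc ℂ C C C).symm (TensorProduct.assoc ℂ C C C
            ((comul (R := ℂ)).rTensor C s)))) := by
      intro s
      induction s with
      | zero => simp
      | add x y hx hy => simp only [map_add, hx, hy]
      | tmul a b => simp
    have e2 : ∀ s : C ⊗[ℂ] C, TensorProduct.comm ℂ C (C ⊗[ℂ] C) (TensorProduct.assoc ℂ C C C
        ((comul (R := ℂ)).rTensor C (TensorProduct.comm ℂ C C s))) =
        (TensorProduct.assoc ℂ C C C).symm (TensorProduct.comm ℂ (C ⊗[ℂ] C) C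
          ((TensorProduct.assoc ℂ C C C).symm ((comul (R := ℂ)).lTensor C s))) := by
      intro s
      induction s with
      | zero => simp
      | add x y hx hy => simp only [map_add, hx, hy]
      | tmul a b =>
        simp only [TensorProduct.comm_tmul, LinearMap.rTensor_tmul, LinearMap.lTensor_tmul]
        induction comul (R := ℂ) b with
        | zero => simp
        | add x y hx hy =>
          simp only [TensorProduct.tmul_add, TensorProduct.add_tmul, map_add, hx, hy]
        | tmul p q => simp
    rw [e1, e2, assoc_rTensor_comul]
  counit m := by
    apply hη
    have e : ∀ s : H ⊗[ℂ] M, η (TensorProduct.lid ℂ M ((counit (R := ℂ)).rTensor M s)) =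
        TensorProduct.rid ℂ C ((counit (R := ℂ)).lTensor C (A.betaVia η s)) := by
      intro s
      induction s with
      | zero => simp
      | add x y hx hy => simp only [map_add, hx, hy]
      | tmul h m => rw [betaVia_tmul, counit_lTensor_betaAmb]; simp
    have e' : ∀ s : C ⊗[ℂ] C, TensorProduct.rid ℂ C ((counit (R := ℂ)).lTensor C
        (TensorProduct.comm ℂ C C s)) = TensorProduct.lid ℂ C ((counit (R := ℂ)).rTensor C s) := by
      intro s
      induction s with
      | zero => simp
      | add x y hx hy => simp only [map_add, hx, hy]
      | tmul a b => simp
    rw [e, hρ, e', rTensor_counit_comul]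
    simp
  anti_yetter_drinfeld m h := by
    apply betaVia_injective hA hη
    rw [hρ, hact, betaVia_aydMap A η hact, hρ, A.comul_act]
    generalize comul (R := ℂ) (η m) = s
    generalize comul (R := ℂ) h = t
    induction s with
    | zero => simp
    | add x y hx hy => simp only [TensorProduct.add_tmul, map_add, hx, hy]
    | tmul a b =>
      induction t with
      | zero => simp
      | add x y hx hy => simp only [TensorProduct.tmul_add, map_add, hx, hy]
      | tmul x y => simp
  stable m := by
    apply hη
    have e : ∀ s : H ⊗[ℂ] M, η (act' (TensorProduct.comm ℂ H M s)) =
        TensorProduct.lid ℂ C ((counit (R := ℂ)).rTensor C (A.betaVia η s)) := by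
      intro s
      induction s with
      | zero => simp
      | add x y hx hy => simp only [map_add, hx, hy]
      | tmul h m => rw [betaVia_tmul, counit_rTensor_betaAmb]; simp [hact]
    have e' : ∀ s : C ⊗[ℂ] C, TensorProduct.lid ℂ C ((counit (R := ℂ)).rTensor C
        (TensorProduct.comm ℂ C C s)) = TensorProduct.rid ℂ C ((counit (R := ℂ)).lTensor C s) := by
      intro s
      induction s with
      | zero => simp
      | add x y hx hy => simp only [map_add, hx, hy]
      | tmul a b => simp
    rw [e, hρ, e', lTensor_counit_comul]
    simp

end SAYD

/-- The embedding `d ⊗ c ↦ ε(d) c` of `M̃` into `C`. -/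
def tildeEmb : A.tildeM →ₗ[ℂ] C := A.invariants.subtype ∘ₗ A.xi.toLinearMap

theorem tildeEmb_injective : Function.Injective A.tildeEmb :=
  A.invariants.injective_subtype.comp A.xi.injective

theorem coL_tildeEmb (m : A.tildeM) : A.coL (A.tildeEmb m) = m := A.coL_epsD m m.2

theorem tildeEmb_act (m : A.tildeM) (h : H) :
    A.tildeEmb (A.tildeAct (m ⊗ₜ[ℂ] h)) = A.act (A.tildeEmb m ⊗ₜ[ℂ] h) := by
  change A.epsD C (A.act.lTensor A.D (TensorProduct.assoc ℂ A.D C H ((m : A.D ⊗[ℂ] C) ⊗ₜ[ℂ] h))) =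
    A.act (A.epsD C m ⊗ₜ[ℂ] h)
  induction (m : A.D ⊗[ℂ] C) with
  | zero => simp
  | add x y hx hy => simp only [TensorProduct.add_tmul, map_add, hx, hy]
  | tmul d c => simp [epsD_tmul, ← TensorProduct.smul_tmul']

variable {A} in
/-- The characterizing property `m₀₁ ⊗ m₀₂ ◁ m₋₁ = m₂ ⊗ m₁` of the coaction of `H` on `M̃`. -/
theorem betaVia_tildeCoact (hA : A.IsHopfGalois) (m : A.tildeM) :
    A.betaVia (M := A.tildeM) A.tildeEmb (tildeCoact hA m) =
      TensorProduct.comm ℂ C C (comul (R := ℂ) (A.tildeEmb m)) := by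
  have e : ∀ s : H ⊗[ℂ] A.invariants,
      A.tildeEmb.lTensor H (A.xi.symm.toLinearMap.lTensor H s) =
        A.invariants.subtype.lTensor H s := by
    intro s
    induction s with
    | zero => simp
    | add x y hx hy => simp only [map_add, hx, hy]
    | tmul h c => simp [tildeEmb]
  have e2 : A.invariants.subtype.lTensor H (coactInv hA (A.xi m)) =
      TensorProduct.comm ℂ C H (coactAux hA (A.xi m)) :=
    lTensor_subtype_liftEq _ _ _ (coactAux_mem hA) _
  have e3 := betaAmb_coactAux hA (A.xi m)
  simp only [betaVia, tildeCoact, LinearMap.comp_apply, e, LinearEquiv.coe_coe, e2]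
  rw [← TensorProduct.comm_symm, LinearEquiv.symm_apply_apply]
  exact e3

variable {A} in
theorem isSAYD_tilde (hA : A.IsHopfGalois) :
    IsSAYD (H := H) (M := A.tildeM) A.tildeAct (tildeCoact hA) :=
  isSAYD_of_betaVia hA A.tildeEmb_injective A.tildeEmb_act (betaVia_tildeCoact hA)

end RightModuleCoalgebra
end CocycHopf

namespace CocycHopf
namespace RightModuleCoalgebra

variable {H C : Type*} [Ring H] [HopfAlgebra ℂ H] [AddCommGroup C] [Module ℂ C] [Coalgebra ℂ C]
  (A : RightModuleCoalgebra H C)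

/-! ### The iterated Galois map -/

section ItComul

variable {V : Type*} [AddCommGroup V] [Module ℂ V] [Coalgebra ℂ V]

theorem itComul_zero (v : V) :
    itComul 0 v = counit (R := ℂ) v • PiTensorProduct.tprod ℂ (Fin.elim0 : Fin 0 → V) := rfl

theorem itComul_succ (n : ℕ) (v : V) :
    itComul (n + 1) v = cons n ((itComul n).lTensor V (comul (R := ℂ) v)) := rfl

end ItComul

/-- The factorwise action `C^{⊗n} ⊗ H^{⊗n} → C^{⊗n}`. -/
def powAct (n : ℕ) : (⨂[ℂ]^n C) ⊗[ℂ] (⨂[ℂ]^n H) →ₗ[ℂ] ⨂[ℂ]^n C :=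
  TensorProduct.lift (PiTensorProduct.map₂ fun _ : Fin n => TensorProduct.curry A.act)

theorem powAct_tprod (n : ℕ) (c : Fin n → C) (h : Fin n → H) :
    A.powAct n (PiTensorProduct.tprod ℂ c ⊗ₜ[ℂ] PiTensorProduct.tprod ℂ h) =
      PiTensorProduct.tprod ℂ fun i => A.act (c i ⊗ₜ[ℂ] h i) := by
  simp [powAct, PiTensorProduct.map₂_tprod_tprod]

theorem powAct_cons (n : ℕ) (a : C) (u : ⨂[ℂ]^n C) (h : H) (w : ⨂[ℂ]^n H) :
    A.powAct (n + 1) (cons n (a ⊗ₜ[ℂ] u) ⊗ₜ[ℂ] cons n (h ⊗ₜ[ℂ] w)) =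
      cons n (A.act (a ⊗ₜ[ℂ] h) ⊗ₜ[ℂ] A.powAct n (u ⊗ₜ[ℂ] w)) := by
  induction u using PiTensorProduct.induction_on with
  | add x y hx hy => simp only [TensorProduct.tmul_add, TensorProduct.add_tmul, map_add, hx, hy]
  | smul_tprod r f =>
    simp only [TensorProduct.tmul_smul, ← TensorProduct.smul_tmul', map_smul]
    congr 1
    induction w using PiTensorProduct.induction_on with
    | add x y hx hy => simp only [TensorProduct.tmul_add, map_add, hx, hy]
    | smul_tprod r g =>
      simp only [TensorProduct.tmul_smul, map_smul, cons_tmul_tprod, powAct_tprod]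
      congr 2
      funext i
      induction i using Fin.cases <;> simp

theorem powAct_mul (n : ℕ) (u : ⨂[ℂ]^n C) (w w' : ⨂[ℂ]^n H) :
    A.powAct n (u ⊗ₜ[ℂ] (w * w')) = A.powAct n (A.powAct n (u ⊗ₜ[ℂ] w) ⊗ₜ[ℂ] w') := by
  induction u using PiTensorProduct.induction_on with
  | add x y hx hy => simp only [TensorProduct.add_tmul, map_add, hx, hy]
  | smul_tprod r f =>
    simp only [← TensorProduct.smul_tmul', map_smul]
    congr 1
    induction w using PiTensorProduct.induction_on with
    | add x y hx hy =>
      simp only [add_mul, TensorProduct.tmul_add, TensorProduct.add_tmul, map_add, hx, hy]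
    | smul_tprod r g =>
      simp only [smul_mul_assoc, TensorProduct.tmul_smul, ← TensorProduct.smul_tmul', map_smul]
      congr 1
      induction w' using PiTensorProduct.induction_on with
      | add x y hx hy => simp only [mul_add, TensorProduct.tmul_add, map_add, hx, hy]
      | smul_tprod r g' =>
        simp only [mul_smul_comm, TensorProduct.tmul_smul, map_smul,
          PiTensorProduct.tprod_mul_tprod, powAct_tprod, Pi.mul_apply, A.act_mul]

theorem powAct_itComul (n : ℕ) (c : C) (h : H) :
    A.powAct n (itComul n c ⊗ₜ[ℂ] itComul n h) = itComul n (A.act (c ⊗ₜ[ℂ] h)) := by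
  induction n generalizing c h with
  | zero =>
    simp only [itComul_zero, TensorProduct.tmul_smul, ← TensorProduct.smul_tmul', map_smul,
      powAct_tprod, A.counit_act, smul_smul]
    rw [mul_comm]
    congr 2
    exact Subsingleton.elim _ _
  | succ n ih =>
    rw [itComul_succ, itComul_succ, itComul_succ, A.comul_act]
    induction comul (R := ℂ) c with
    | zero => simp
    | add x y hx hy => simp only [TensorProduct.add_tmul, map_add, hx, hy]
    | tmul a b =>
      induction comul (R := ℂ) h with
      | zero => simp
      | add x y hx hy => simp only [TensorProduct.tmul_add, map_add, hx, hy]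
      | tmul x y => simp [powAct_cons, ih]

/-- The iterated Galois map without its first factor:
`c ⊗ h₀ ⊗ ⋯ ⊗ hₙ₋₁ ↦ c₁ ◁ h₀₁ ⊗ c₂ ◁ h₀₂ h₁₁ ⊗ ⋯`, with values in `C^{⊗n}`. -/
def galoisTail (n : ℕ) : C ⊗[ℂ] (⨂[ℂ]^n H) →ₗ[ℂ] ⨂[ℂ]^n C :=
  A.powAct n ∘ₗ TensorProduct.map (itComul n) (cumulProd n)

/-- The iterated Galois map
`c ⊗ h₀ ⊗ ⋯ ⊗ hₙ₋₁ ↦ c₁ ⊗ c₂ ◁ h₀₁ ⊗ c₃ ◁ h₀₂ h₁₁ ⊗ ⋯`, with values in `C^{⊗(n+1)}`. -/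
def galoisPow (n : ℕ) : C ⊗[ℂ] (⨂[ℂ]^n H) →ₗ[ℂ] ⨂[ℂ]^(n + 1) C :=
  A.powAct (n + 1) ∘ₗ TensorProduct.map (itComul (n + 1)) (oneHead n ∘ₗ cumulProd n)

theorem galoisPow_tmul (n : ℕ) (c : C) (w : ⨂[ℂ]^n H) :
    A.galoisPow n (c ⊗ₜ[ℂ] w) =
      cons n ((A.galoisTail n ∘ₗ (TensorProduct.mk ℂ C _).flip w).lTensor C
        (comul (R := ℂ) c)) := by
  simp only [galoisPow, LinearMap.comp_apply, TensorProduct.map_tmul, itComul_succ, oneHead_apply]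
  induction comul (R := ℂ) c with
  | zero => simp
  | add x y hx hy => simp only [TensorProduct.add_tmul, map_add, hx, hy]
  | tmul a b => simp [powAct_cons, galoisTail, A.act_one]

theorem galoisTail_zero (c : C) (w : ⨂[ℂ]^0 H) :
    A.galoisTail 0 (c ⊗ₜ[ℂ] w) = counit (R := ℂ) c •
      A.powAct 0 (PiTensorProduct.tprod ℂ Fin.elim0 ⊗ₜ[ℂ] w) := by
  simp only [galoisTail, LinearMap.comp_apply, TensorProduct.map_tmul, itComul_zero,
    ← TensorProduct.smul_tmul', map_smul]
  rfl

theorem galoisPow_zero (c : C) (w : ⨂[ℂ]^0 H) :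
    A.galoisPow 0 (c ⊗ₜ[ℂ] w) =
      cons 0 (c ⊗ₜ[ℂ] A.powAct 0 (PiTensorProduct.tprod ℂ Fin.elim0 ⊗ₜ[ℂ] w)) := by
  have e : ∀ s : C ⊗[ℂ] C, cons 0 ((A.galoisTail 0 ∘ₗ
      (TensorProduct.mk ℂ C _).flip w).lTensor C s) =
      cons 0 (TensorProduct.rid ℂ C ((counit (R := ℂ)).lTensor C s) ⊗ₜ[ℂ]
        A.powAct 0 (PiTensorProduct.tprod ℂ Fin.elim0 ⊗ₜ[ℂ] w)) := by
    intro s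
    induction s with
    | zero => simp
    | add x y hx hy => simp only [TensorProduct.add_tmul, map_add, hx, hy]
    | tmul a b => simp [galoisTail_zero, TensorProduct.smul_tmul]
  rw [galoisPow_tmul, e, lTensor_counit_comul]
  simp

theorem cumulProd_cons (n : ℕ) (h : H) (w : ⨂[ℂ]^n H) :
    cumulProd (n + 1) (cons n (h ⊗ₜ[ℂ] w)) =
      cons n ((LinearMap.mulRight ℂ (cumulProd n w) ∘ₗ itComul n).lTensor H
        (comul (R := ℂ) h)) := by
  simp only [cumulProd, LinearMap.comp_apply, LinearEquiv.coe_coe, LinearEquiv.symm_apply_apply,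
    LinearMap.rTensor_tmul]
  induction comul (R := ℂ) h with
  | zero => simp
  | add x y hx hy => simp only [TensorProduct.add_tmul, map_add, hx, hy]
  | tmul a b => simp

/-- Because `Δ` is compatible with the action, the first factor `h` may be applied to `c` before
comultiplying. -/
theorem galoisTail_cons (n : ℕ) (c : C) (h : H) (w : ⨂[ℂ]^n H) :
    A.galoisTail (n + 1) (c ⊗ₜ[ℂ] cons n (h ⊗ₜ[ℂ] w)) =
      A.galoisPow n (A.act (c ⊗ₜ[ℂ] h) ⊗ₜ[ℂ] w) := by
  rw [galoisPow_tmul, A.comul_act, galoisTail, LinearMap.comp_apply, TensorProduct.map_tmul,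
    itComul_succ, cumulProd_cons]
  induction comul (R := ℂ) c with
  | zero => simp
  | add x y hx hy => simp only [TensorProduct.add_tmul, map_add, hx, hy]
  | tmul a b =>
    induction comul (R := ℂ) h with
    | zero => simp
    | add x y hx hy => simp only [TensorProduct.tmul_add, map_add, hx, hy]
    | tmul x y => simp [powAct_cons, powAct_mul, powAct_itComul, galoisTail]

/-- The iterated Galois map is built by applying the Galois map one factor at a time. -/
theorem galoisPow_cons (n : ℕ) (c : C) (h : H) (w : ⨂[ℂ]^n H) :
    A.galoisPow (n + 1) (c ⊗ₜ[ℂ] cons n (h ⊗ₜ[ℂ] w)) =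
      cons (n + 1) ((A.galoisPow n ∘ₗ (TensorProduct.mk ℂ C _).flip w).lTensor C
        (A.betaAmb (c ⊗ₜ[ℂ] h))) := by
  rw [galoisPow_tmul, betaAmb_tmul]
  induction comul (R := ℂ) c with
  | zero => simp
  | add x y hx hy => simp only [map_add, hx, hy]
  | tmul a b => simp [galoisTail_cons]

theorem counitAt_zero_galoisPow (n : ℕ) (x : C ⊗[ℂ] ⨂[ℂ]^n H) :
    counitAt n 0 (A.galoisPow n x) = A.galoisTail n x := by
  induction x with
  | zero => simp
  | add x y hx hy => simp only [map_add, hx, hy]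
  | tmul c w =>
    have : ∀ s : C ⊗[ℂ] C, counitAt n 0 (cons n ((A.galoisTail n ∘ₗ
        (TensorProduct.mk ℂ C _).flip w).lTensor C s)) =
        A.galoisTail n (TensorProduct.lid ℂ C ((counit (R := ℂ)).rTensor C s) ⊗ₜ[ℂ] w) := by
      intro s
      induction s with
      | zero => simp
      | add x y hx hy => simp only [TensorProduct.add_tmul, map_add, hx, hy]
      | tmul a b => simp [← TensorProduct.smul_tmul']
    rw [galoisPow_tmul, this, rTensor_counit_comul]
    simp

/-! ### The iterated Galois map and the cocyclic operators -/

/-- The first coface: since `β(c ⊗ 1) = Δ(c)`, prefixing `1` amounts to comultiplying the first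
factor. -/
theorem galoisPow_one_cons (n : ℕ) (c : C) (w : ⨂[ℂ]^n H) :
    A.galoisPow (n + 1) (c ⊗ₜ[ℂ] cons n ((1 : H) ⊗ₜ[ℂ] w)) =
      comulAt (n + 1) 0 (A.galoisPow n (c ⊗ₜ[ℂ] w)) := by
  have h1 : A.betaAmb (c ⊗ₜ[ℂ] (1 : H)) = comul (R := ℂ) c := by
    rw [betaAmb_tmul]
    have : A.act ∘ₗ (TensorProduct.mk ℂ C H).flip 1 = LinearMap.id :=
      LinearMap.ext fun c => A.act_one c
    simp [this]
  -- `a ⊗ b ⊗ b' ↦ a ⊗ b ⊗ galoisTail (b' ⊗ w)`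
  let K : C ⊗[ℂ] (C ⊗[ℂ] C) →ₗ[ℂ] ⨂[ℂ]^(n + 2) C := (cons (n + 1)).toLinearMap ∘ₗ
    ((cons n).toLinearMap ∘ₗ
      (A.galoisTail n ∘ₗ (TensorProduct.mk ℂ C _).flip w).lTensor C).lTensor C
  have e1 : ∀ s : C ⊗[ℂ] C, cons (n + 1) ((A.galoisPow n ∘ₗ
      (TensorProduct.mk ℂ C _).flip w).lTensor C s) = K (comul.lTensor C s) := by
    intro s
    induction s with
    | zero => simp
    | add x y hx hy => simp only [map_add, hx, hy]
    | tmul a b => simp [K, galoisPow_tmul]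
  have e2 : ∀ s : C ⊗[ℂ] C, comulAt (n + 1) 0 (cons n ((A.galoisTail n ∘ₗ
      (TensorProduct.mk ℂ C _).flip w).lTensor C s)) =
      K (TensorProduct.assoc ℂ C C C (comul.rTensor C s)) := by
    intro s
    induction s with
    | zero => simp
    | add x y hx hy => simp only [map_add, hx, hy]
    | tmul a b =>
      simp only [LinearMap.lTensor_tmul, comulAt_zero_cons, LinearMap.rTensor_tmul]
      induction comul (R := ℂ) a with
      | zero => simp
      | add x y hx hy => simp only [TensorProduct.add_tmul, map_add, hx, hy]
      | tmul x y => simp [K]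
  rw [galoisPow_cons, h1, e1, galoisPow_tmul, e2, assoc_rTensor_comul]

theorem galoisPow_insertOneAt (n : ℕ) (i : Fin (n + 1)) (c : C) (w : ⨂[ℂ]^n H) :
    A.galoisPow (n + 1) (c ⊗ₜ[ℂ] insertOneAt n i w) =
      comulAt (n + 1) i (A.galoisPow n (c ⊗ₜ[ℂ] w)) := by
  induction n generalizing c with
  | zero =>
    obtain rfl : i = 0 := Subsingleton.elim (α := Fin 1) _ _
    rw [insertOneAt_zero, galoisPow_one_cons]
  | succ n ih =>
    induction i using Fin.cases with
    | zero => rw [insertOneAt_zero, galoisPow_one_cons]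
    | succ j =>
      induction w using cons_induction with
      | add x y hx hy => simp only [TensorProduct.tmul_add, map_add, hx, hy]
      | tmul h w =>
        rw [insertOneAt_succ_cons, galoisPow_cons, galoisPow_cons]
        induction A.betaAmb (c ⊗ₜ[ℂ] h) with
        | zero => simp
        | add x y hx hy => simp only [map_add, hx, hy]
        | tmul a b => simp [ih]

theorem galoisPow_mulAt (n : ℕ) (i : Fin n) (c : C) (w : ⨂[ℂ]^(n + 1) H) :
    A.galoisPow n (c ⊗ₜ[ℂ] mulAt n i w) =
      counitAt (n + 1) i.castSucc.succ (A.galoisPow (n + 1) (c ⊗ₜ[ℂ] w)) := by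
  induction n generalizing c with
  | zero => exact i.elim0
  | succ n ih =>
    induction w using cons_induction with
    | add x y hx hy => simp only [TensorProduct.tmul_add, map_add, hx, hy]
    | tmul h w =>
      induction i using Fin.cases with
      | zero =>
        induction w using cons_induction with
        | add x y hx hy => simp only [TensorProduct.tmul_add, map_add, hx, hy]
        | tmul g w =>
          rw [mulAt_zero_cons, galoisPow_cons, galoisPow_cons, betaAmb_tmul, betaAmb_tmul]
          induction comul (R := ℂ) c with
          | zero => simp
          | add x y hx hy => simp only [map_add, hx, hy]
          | tmul a b =>
            simp only [LinearMap.lTensor_tmul, counitAt_succ_cons, Fin.castSucc_zero,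
              LinearMap.comp_apply, LinearMap.flip_apply, TensorProduct.mk_apply,
              counitAt_zero_galoisPow, galoisTail_cons, A.act_mul]
      | succ j =>
        rw [mulAt_succ_cons, galoisPow_cons, galoisPow_cons]
        induction A.betaAmb (c ⊗ₜ[ℂ] h) with
        | zero => simp
        | add x y hx hy => simp only [map_add, hx, hy]
        | tmul a b => simp [ih, Fin.castSucc_succ]

theorem galoisPow_counitLast (n : ℕ) (c : C) (w : ⨂[ℂ]^(n + 1) H) :
    A.galoisPow n (c ⊗ₜ[ℂ] counitLast n w) =
      counitAt (n + 1) (Fin.last n).succ (A.galoisPow (n + 1) (c ⊗ₜ[ℂ] w)) := by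
  induction n generalizing c with
  | zero =>
    induction w using cons_induction with
    | add x y hx hy => simp only [TensorProduct.tmul_add, map_add, hx, hy]
    | tmul h w =>
      rw [← counitAt_last, galoisPow_cons, galoisPow_tmul, betaAmb_tmul]
      change cons 0 ((A.galoisTail 0 ∘ₗ (TensorProduct.mk ℂ C _).flip
        (counitAt 0 0 (cons 0 (h ⊗ₜ[ℂ] w)))).lTensor C (comul (R := ℂ) c)) =
        counitAt 1 (Fin.succ 0) _
      induction comul (R := ℂ) c with
      | zero => simp
      | add x y hx hy => simp only [map_add, hx, hy]
      | tmul a b =>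
        rw [counitAt_zero_cons]
        simp only [LinearMap.lTensor_tmul, counitAt_succ_cons, LinearMap.comp_apply,
          LinearMap.flip_apply, TensorProduct.mk_apply, counitAt_zero_galoisPow,
          galoisTail_zero, A.counit_act, TensorProduct.tmul_smul, map_smul, smul_smul,
          LinearMap.smul_apply, mul_comm]
  | succ n ih =>
    induction w using cons_induction with
    | add x y hx hy => simp only [TensorProduct.tmul_add, map_add, hx, hy]
    | tmul h w =>
      rw [← counitAt_last, ← Fin.succ_last, counitAt_succ_cons, counitAt_last, galoisPow_cons,
        galoisPow_cons]
      induction A.betaAmb (c ⊗ₜ[ℂ] h) with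
      | zero => simp
      | add x y hx hy => simp only [map_add, hx, hy]
      | tmul a b =>
        simp only [LinearMap.lTensor_tmul, LinearMap.comp_apply,
          LinearMap.flip_apply, TensorProduct.mk_apply, ih, counitAt_succ_cons]

/-- The inductive step of `galoisTail_snoc`, with `V = H^{⊗n}`, `W = H^{⊗(n+1)}`, `X = C^{⊗n}` and
`Y = C^{⊗(n+1)}`. -/
theorem galoisTail_snoc_step {V W X Y : Type*} [AddCommGroup V] [Module ℂ V] [AddCommGroup W]
    [Module ℂ W] [AddCommGroup X] [Module ℂ X] [AddCommGroup Y] [Module ℂ Y]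
    {t : C ⊗[ℂ] V →ₗ[ℂ] X} {t' : C ⊗[ℂ] W →ₗ[ℂ] Y} {e : H ⊗[ℂ] V →ₗ[ℂ] W} {j : C ⊗[ℂ] X →ₗ[ℂ] Y}
    (ht : ∀ c h v, t' (c ⊗ₜ[ℂ] e (h ⊗ₜ[ℂ] v)) =
      j ((t ∘ₗ (TensorProduct.mk ℂ C V).flip v).lTensor C
        (comul (R := ℂ) (A.act (c ⊗ₜ[ℂ] h)))))
    (c : C) (h : H) (y : V ⊗[ℂ] H) :
    TensorProduct.map t' A.act (TensorProduct.tensorTensorTensorComm ℂ C C W H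
        (comul (R := ℂ) c ⊗ₜ[ℂ] TensorProduct.map e (LinearMap.mul' ℂ H)
          (TensorProduct.tensorTensorTensorComm ℂ H H V H (comul (R := ℂ) h ⊗ₜ[ℂ] y)))) =
      j.rTensor C ((TensorProduct.assoc ℂ C X C).symm ((TensorProduct.map t A.act ∘ₗ
        (TensorProduct.tensorTensorTensorComm ℂ C C V H).toLinearMap ∘ₗ
        (TensorProduct.mk ℂ (C ⊗[ℂ] C) (V ⊗[ℂ] H)).flip y ∘ₗ comul (R := ℂ)).lTensor C
          (comul (R := ℂ) (A.act (c ⊗ₜ[ℂ] h))))) := by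
  induction y with
  | zero => simp
  | add x y hx hy =>
    simp only [TensorProduct.tmul_add, map_add, hx, hy, LinearMap.add_comp, LinearMap.comp_add,
      LinearMap.lTensor_add, LinearMap.add_apply]
  | tmul v q =>
    let K : C ⊗[ℂ] (C ⊗[ℂ] C) →ₗ[ℂ] Y ⊗[ℂ] C := j.rTensor C ∘ₗ
      (TensorProduct.assoc ℂ C X C).symm.toLinearMap ∘ₗ
      (TensorProduct.map (t ∘ₗ (TensorProduct.mk ℂ C V).flip v)
        (A.act ∘ₗ (TensorProduct.mk ℂ C H).flip q)).lTensor C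
    have e1 : ∀ s : C ⊗[ℂ] C, j.rTensor C ((TensorProduct.assoc ℂ C X C).symm
        ((TensorProduct.map t A.act ∘ₗ
        (TensorProduct.tensorTensorTensorComm ℂ C C V H).toLinearMap ∘ₗ
        (TensorProduct.mk ℂ (C ⊗[ℂ] C) (V ⊗[ℂ] H)).flip (v ⊗ₜ[ℂ] q) ∘ₗ
          comul (R := ℂ)).lTensor C s)) = K (comul.lTensor C s) := by
      intro s
      induction s with
      | zero => simp
      | add x y hx hy => simp only [map_add, hx, hy]
      | tmul a b =>
        simp only [LinearMap.lTensor_tmul, LinearMap.comp_apply, LinearMap.flip_apply,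
          TensorProduct.mk_apply]
        induction comul (R := ℂ) b with
        | zero => simp
        | add x y hx hy =>
          simp only [TensorProduct.tmul_add, TensorProduct.add_tmul, map_add, hx, hy]
        | tmul x y => simp [K]
    have e2 : ∀ (s : C ⊗[ℂ] C) (r : H ⊗[ℂ] H),
        TensorProduct.map t' A.act (TensorProduct.tensorTensorTensorComm ℂ C C W H
        (s ⊗ₜ[ℂ] TensorProduct.map e (LinearMap.mul' ℂ H)
          (TensorProduct.tensorTensorTensorComm ℂ H H V H (r ⊗ₜ[ℂ] (v ⊗ₜ[ℂ] q))))) =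
        K (TensorProduct.assoc ℂ C C C (comul.rTensor C (TensorProduct.map A.act A.act
          (TensorProduct.tensorTensorTensorComm ℂ C C H H (s ⊗ₜ[ℂ] r))))) := by
      intro s r
      induction s with
      | zero => simp
      | add x y hx hy => simp only [TensorProduct.add_tmul, map_add, hx, hy]
      | tmul a b =>
        induction r with
        | zero => simp
        | add x y hx hy =>
          simp only [TensorProduct.add_tmul, TensorProduct.tmul_add, map_add, hx, hy]
        | tmul x y =>
          simp only [TensorProduct.tensorTensorTensorComm_tmul, TensorProduct.map_tmul,
            LinearMap.mul'_apply, ht, LinearMap.rTensor_tmul, A.act_mul]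
          induction comul (R := ℂ) (A.act (a ⊗ₜ[ℂ] x)) with
          | zero => simp
          | add x y hx hy => simp only [TensorProduct.add_tmul, map_add, hx, hy]
          | tmul p p' => simp [K]
    rw [e1, e2, ← A.comul_act, assoc_rTensor_comul]

/-- The last factor of the iterated Galois map:
`c ⊗ w ⊗ g ↦ galoisTail(c₁ ⊗ w₁) ⊗ c₂ ◁ (w₂ g)`. -/
theorem galoisTail_snoc (n : ℕ) (c : C) (w : ⨂[ℂ]^n H) (g : H) :
    A.galoisTail (n + 1) (c ⊗ₜ[ℂ] snoc n (w ⊗ₜ[ℂ] g)) =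
      snoc n (TensorProduct.map (A.galoisTail n) A.act
        (TensorProduct.tensorTensorTensorComm ℂ C C (⨂[ℂ]^n H) H (comul (R := ℂ) c ⊗ₜ[ℂ]
          (isRightCoaction_diagCoact H n).twistEquiv (w ⊗ₜ[ℂ] g)))) := by
  induction n generalizing c with
  | zero =>
    have e1 : (isRightCoaction_diagCoact H 0).twistEquiv (w ⊗ₜ[ℂ] g) = w ⊗ₜ[ℂ] g := by
      rw [IsRightCoaction.twistEquiv_tmul]
      change (LinearMap.mulRight ℂ g).lTensor _ (w ⊗ₜ[ℂ] (1 : H)) = _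
      simp
    have e2 : ∀ s : C ⊗[ℂ] C, snoc 0 (TensorProduct.map (A.galoisTail 0) A.act
        (TensorProduct.tensorTensorTensorComm ℂ C C (⨂[ℂ]^0 H) H (s ⊗ₜ[ℂ] (w ⊗ₜ[ℂ] g)))) =
        snoc 0 (A.powAct 0 (PiTensorProduct.tprod ℂ Fin.elim0 ⊗ₜ[ℂ] w) ⊗ₜ[ℂ]
          A.act (TensorProduct.lid ℂ C ((counit (R := ℂ)).rTensor C s) ⊗ₜ[ℂ] g)) := by
      intro s
      induction s with
      | zero => simp
      | add x y hx hy => simp only [TensorProduct.add_tmul, TensorProduct.tmul_add, map_add, hx, hy]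
      | tmul a b => simp [galoisTail_zero, ← TensorProduct.smul_tmul']
    rw [snoc_zero_tmul, galoisTail_cons, galoisPow_zero, e1, e2, snoc_zero_tmul,
      rTensor_counit_comul]
    simp
  | succ n ih =>
    induction w using cons_induction with
    | add x y hx hy =>
      simp only [TensorProduct.add_tmul, TensorProduct.tmul_add, map_add, hx, hy]
    | tmul h w =>
      have e1 : (isRightCoaction_diagCoact H (n + 1)).twistEquiv (cons n (h ⊗ₜ[ℂ] w) ⊗ₜ[ℂ] g) =
          TensorProduct.map (cons n).toLinearMap (LinearMap.mul' ℂ H)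
            (TensorProduct.tensorTensorTensorComm ℂ H H (⨂[ℂ]^n H) H (comul (R := ℂ) h ⊗ₜ[ℂ]
              (isRightCoaction_diagCoact H n).twistEquiv (w ⊗ₜ[ℂ] g))) :=
        twist_id_tensorCoact (diagCoact_cons n) h g w
      have e2 := A.galoisTail_snoc_step (t := A.galoisTail n) (t' := A.galoisTail (n + 1))
        (e := (cons n).toLinearMap) (j := (cons n).toLinearMap)
        (fun c h v => (A.galoisTail_cons n c h v).trans (A.galoisPow_tmul n _ v)) c h
        ((isRightCoaction_diagCoact H n).twistEquiv (w ⊗ₜ[ℂ] g))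
      rw [snoc_cons, galoisTail_cons, galoisPow_tmul, e1, e2]
      induction comul (R := ℂ) (A.act (c ⊗ₜ[ℂ] h)) with
      | zero => simp
      | add x y hx hy => simp only [map_add, hx, hy]
      | tmul a b =>
        simp only [LinearMap.lTensor_tmul, LinearMap.comp_apply, LinearMap.flip_apply,
          TensorProduct.mk_apply, ih, LinearEquiv.coe_coe]
        generalize TensorProduct.map (A.galoisTail n) A.act _ = y
        induction y with
        | zero => simp
        | add x y hx hy => simp only [TensorProduct.tmul_add, map_add, hx, hy]
        | tmul x y => simp [snoc_cons]

end RightModuleCoalgebra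
end CocycHopf

namespace CocycHopf

/-! ### Sliding a tensor factor past a map -/

section Slide

variable {V X W E E' : Type*} [AddCommGroup V] [Module ℂ V] [AddCommGroup X] [Module ℂ X]
  [AddCommGroup W] [Module ℂ W] [AddCommGroup E] [Module ℂ E] [AddCommGroup E'] [Module ℂ E']

/-- For `g : V ⊗ X → W`, the map `V ⊗ (E ⊗ X) → E ⊗ W`, `v ⊗ e ⊗ x ↦ e ⊗ g(v ⊗ x)`. -/
def slide (g : V ⊗[ℂ] X →ₗ[ℂ] W) (E : Type*) [AddCommGroup E] [Module ℂ E] :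
    V ⊗[ℂ] (E ⊗[ℂ] X) →ₗ[ℂ] E ⊗[ℂ] W :=
  g.lTensor E ∘ₗ (TensorProduct.leftComm ℂ V E X).toLinearMap

@[simp] theorem slide_tmul (g : V ⊗[ℂ] X →ₗ[ℂ] W) (v : V) (e : E) (x : X) :
    slide g E (v ⊗ₜ[ℂ] (e ⊗ₜ[ℂ] x)) = e ⊗ₜ[ℂ] g (v ⊗ₜ[ℂ] x) := by
  simp [slide]

theorem slide_injective {g : V ⊗[ℂ] X →ₗ[ℂ] W} (hg : Function.Injective g) :
    Function.Injective (slide g E) :=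
  (Module.Flat.lTensor_preserves_injective_linearMap (M := E) _ hg).comp
    (TensorProduct.leftComm ℂ V E X).injective

theorem range_slide (g : V ⊗[ℂ] X →ₗ[ℂ] W) :
    LinearMap.range (slide g E) = LinearMap.range ((LinearMap.range g).subtype.lTensor E) := by
  rw [slide, LinearMap.range_comp_of_range_eq_top _ (LinearEquiv.range _), LinearMap.lTensor_range]

theorem tensor₃_induction {p : V ⊗[ℂ] (E ⊗[ℂ] X) → Prop} (zero : p 0)
    (add : ∀ x y, p x → p y → p (x + y)) (tmul : ∀ v e x, p (v ⊗ₜ[ℂ] (e ⊗ₜ[ℂ] x))) (z) : p z := by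
  induction z with
  | zero => exact zero
  | add x y hx hy => exact add _ _ hx hy
  | tmul v y =>
    induction y with
    | zero => simpa using zero
    | add x y hx hy => rw [TensorProduct.tmul_add]; exact add _ _ hx hy
    | tmul e x => exact tmul v e x

theorem lTensor_slide {X' W' : Type*} [AddCommGroup X'] [Module ℂ X'] [AddCommGroup W']
    [Module ℂ W'] {g : V ⊗[ℂ] X →ₗ[ℂ] W} {g' : V ⊗[ℂ] X' →ₗ[ℂ] W'} {p : W →ₗ[ℂ] W'}
    {q : X →ₗ[ℂ] X'} (h : ∀ x, p (g x) = g' (q.lTensor V x)) (y : V ⊗[ℂ] (E ⊗[ℂ] X)) :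
    p.lTensor E (slide g E y) = slide g' E ((q.lTensor E).lTensor V y) := by
  induction y using tensor₃_induction with
  | zero => simp
  | add x y hx hy => simp only [map_add, hx, hy]
  | tmul v e x => simp [h]

theorem rTensor_slide (g : V ⊗[ℂ] X →ₗ[ℂ] W) (k : E →ₗ[ℂ] E') (y : V ⊗[ℂ] (E ⊗[ℂ] X)) :
    k.rTensor W (slide g E y) = slide g E' ((k.rTensor X).lTensor V y) := by
  induction y using tensor₃_induction with
  | zero => simp
  | add x y hx hy => simp only [map_add, hx, hy]
  | tmul v e x => simp

theorem assoc_slide (g : V ⊗[ℂ] X →ₗ[ℂ] W) (y : V ⊗[ℂ] ((E ⊗[ℂ] E') ⊗[ℂ] X)) :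
    TensorProduct.assoc ℂ E E' W (slide g (E ⊗[ℂ] E') y) =
      slide (slide g E') E ((TensorProduct.assoc ℂ E E' X).toLinearMap.lTensor V y) := by
  induction y using tensor₃_induction with
  | zero => simp
  | add x y hx hy => simp only [map_add, hx, hy]
  | tmul v e x =>
    induction e with
    | zero => simp
    | add x y hx hy => simp only [TensorProduct.tmul_add, TensorProduct.add_tmul, map_add, hx, hy]
    | tmul e e' => simp

theorem leftComm_slide (g : V ⊗[ℂ] X →ₗ[ℂ] W) (y : V ⊗[ℂ] (E ⊗[ℂ] (E' ⊗[ℂ] X))) :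
    TensorProduct.leftComm ℂ E E' W (slide (slide g E') E y) =
      slide (slide g E) E' ((TensorProduct.leftComm ℂ E E' X).toLinearMap.lTensor V y) := by
  induction y using tensor₃_induction with
  | zero => simp
  | add x y hx hy => simp only [map_add, hx, hy]
  | tmul v e x =>
    induction x with
    | zero => simp
    | add x y hx hy => simp only [TensorProduct.tmul_add, map_add, hx, hy]
    | tmul e e' => simp

theorem assoc_symm_slide (g : V ⊗[ℂ] X →ₗ[ℂ] W) (y : V ⊗[ℂ] (E ⊗[ℂ] (E' ⊗[ℂ] X))) :
    (TensorProduct.assoc ℂ E E' W).symm (slide (slide g E') E y) =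
      slide g (E ⊗[ℂ] E') ((TensorProduct.assoc ℂ E E' X).symm.toLinearMap.lTensor V y) := by
  obtain ⟨y, rfl⟩ := ((TensorProduct.assoc ℂ E E' X).lTensor V).surjective y
  rw [LinearEquiv.symm_apply_eq, assoc_slide]
  congr 1
  induction y with
  | zero => simp
  | add x y hx hy => simp only [map_add] at hx hy ⊢; rw [← hx, ← hy]
  | tmul v x =>
    change _ = (LinearMap.lTensor V _) (LinearMap.lTensor V _ (v ⊗ₜ[ℂ] _))
    rw [LinearMap.lTensor_tmul, LinearMap.lTensor_tmul]
    simp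

end Slide

/-! ### Tensoring with intersections of equalizers -/

section EqLocus

variable {M V W : Type*} [AddCommGroup M] [Module ℂ M] [AddCommGroup V] [Module ℂ V]
  [AddCommGroup W] [Module ℂ W]

/-- Over a field, `M ⊗ -` preserves arbitrary intersections of equalizers. -/
theorem mem_range_lTensor_iInf_eqLocus {ι : Type*} (f g : ι → V →ₗ[ℂ] W) (y : M ⊗[ℂ] V) :
    y ∈ LinearMap.range ((⨅ i, LinearMap.eqLocus (f i) (g i)).subtype.lTensor M) ↔
      ∀ i, (f i).lTensor M y = (g i).lTensor M y := by
  constructor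
  · rintro ⟨z, rfl⟩ i
    rw [← LinearMap.comp_apply, ← LinearMap.comp_apply, ← LinearMap.lTensor_comp,
      ← LinearMap.lTensor_comp]
    congr 2
    exact LinearMap.ext fun x => (Submodule.mem_iInf _).1 x.2 i
  · intro h
    let b := Module.Free.chooseBasis ℂ M
    let e : M ⊗[ℂ] V ≃ₗ[ℂ] _ →₀ V := TensorProduct.equivFinsuppOfBasisLeft b
    let e' : M ⊗[ℂ] W ≃ₗ[ℂ] _ →₀ W := TensorProduct.equivFinsuppOfBasisLeft b
    have he : ∀ (k : V →ₗ[ℂ] W) (y : M ⊗[ℂ] V) j, e' (k.lTensor M y) j = k (e y j) := by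
      intro k y j
      induction y with
      | zero => simp
      | add x y hx hy => simp only [map_add, Finsupp.add_apply, hx, hy]
      | tmul m v => simp [e, e']
    have hy : (e y).sum (fun j v => b j ⊗ₜ[ℂ] v) = y := by
      have := e.symm_apply_apply y
      rwa [TensorProduct.equivFinsuppOfBasisLeft_symm_apply] at this
    rw [← hy, Finsupp.sum]
    refine Submodule.sum_mem _ fun j _ => ?_
    have hj : e y j ∈ ⨅ i, LinearMap.eqLocus (f i) (g i) := by
      refine (Submodule.mem_iInf _).2 fun i => ?_
      rw [LinearMap.mem_eqLocus, ← he, ← he, h i]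
    exact ⟨b j ⊗ₜ[ℂ] ⟨_, hj⟩, rfl⟩

theorem mem_range_lTensor_eqLocus (f g : V →ₗ[ℂ] W) (y : M ⊗[ℂ] V) :
    y ∈ LinearMap.range ((LinearMap.eqLocus f g).subtype.lTensor M) ↔
      f.lTensor M y = g.lTensor M y := by
  have := mem_range_lTensor_iInf_eqLocus (fun _ : Unit => f) (fun _ => g) y
  rwa [iInf_const, forall_const] at this

end EqLocus

namespace RightModuleCoalgebra

variable {H C : Type*} [Ring H] [HopfAlgebra ℂ H] [AddCommGroup C] [Module ℂ C] [Coalgebra ℂ C]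
  (A : RightModuleCoalgebra H C)

/-! ### Coactions on the iterated Galois map -/

/-- The iterated Galois map with its arguments in the order `H^{⊗n} ⊗ C`. -/
def galoisSwap (n : ℕ) : (⨂[ℂ]^n H) ⊗[ℂ] C →ₗ[ℂ] ⨂[ℂ]^(n + 1) C :=
  A.galoisPow n ∘ₗ (TensorProduct.comm ℂ (⨂[ℂ]^n H) C).toLinearMap

@[simp] theorem galoisSwap_tmul (n : ℕ) (w : ⨂[ℂ]^n H) (c : C) :
    A.galoisSwap n (w ⊗ₜ[ℂ] c) = A.galoisPow n (c ⊗ₜ[ℂ] w) := rfl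

theorem galoisSwap_cons (n : ℕ) (h : H) (w : ⨂[ℂ]^n H) (c : C) :
    A.galoisSwap (n + 1) (cons n (h ⊗ₜ[ℂ] w) ⊗ₜ[ℂ] c) =
      cons (n + 1) (slide (A.galoisSwap n) C (w ⊗ₜ[ℂ] A.betaAmb (c ⊗ₜ[ℂ] h))) := by
  rw [galoisSwap_tmul, galoisPow_cons]
  induction A.betaAmb (c ⊗ₜ[ℂ] h) with
  | zero => simp
  | add x y hx hy => simp only [TensorProduct.tmul_add, map_add, hx, hy]
  | tmul a b => simp

/-- The iterated Galois map is left `D`-colinear for the coactions on the first factor. -/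
theorem coactAt_coL_galoisSwap (n : ℕ) (x : (⨂[ℂ]^n H) ⊗[ℂ] C) :
    coactAt A.coL (n + 1) 0 (A.galoisSwap n x) =
      slide (A.galoisSwap n) A.D (A.coL.lTensor _ x) := by
  induction x with
  | zero => simp
  | add x y hx hy => simp only [map_add, hx, hy]
  | tmul w c =>
    let K : C ⊗[ℂ] (C ⊗[ℂ] C) →ₗ[ℂ] A.D ⊗[ℂ] ⨂[ℂ]^(n + 1) C :=
      TensorProduct.map A.proj ((cons n).toLinearMap ∘ₗ
        (A.galoisTail n ∘ₗ (TensorProduct.mk ℂ C _).flip w).lTensor C)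
    have e1 : ∀ s : C ⊗[ℂ] C, coactAt A.coL (n + 1) 0 (cons n ((A.galoisTail n ∘ₗ
        (TensorProduct.mk ℂ C _).flip w).lTensor C s)) =
        K (TensorProduct.assoc ℂ C C C (comul.rTensor C s)) := by
      intro s
      induction s with
      | zero => simp
      | add x y hx hy => simp only [map_add, hx, hy]
      | tmul a b =>
        simp only [LinearMap.lTensor_tmul, coactAt_zero_cons, LinearMap.rTensor_tmul, coL,
          LinearMap.comp_apply]
        induction comul (R := ℂ) a with
        | zero => simp
        | add x y hx hy => simp only [TensorProduct.add_tmul, map_add, hx, hy]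
        | tmul x y => simp [K]
    have e2 : ∀ s : C ⊗[ℂ] C, slide (A.galoisSwap n) A.D (w ⊗ₜ[ℂ] A.proj.rTensor C s) =
        K (comul.lTensor C s) := by
      intro s
      induction s with
      | zero => simp
      | add x y hx hy => simp only [TensorProduct.tmul_add, map_add, hx, hy]
      | tmul a b => simp [K, galoisPow_tmul]
    rw [galoisSwap_tmul, galoisPow_tmul, e1, assoc_rTensor_comul, ← e2]
    rfl

/-- The iterated Galois map carries the right `D`-coaction on `C` to the one on the last factor. -/
theorem coactAt_coR'_galoisSwap (n : ℕ) (x : (⨂[ℂ]^n H) ⊗[ℂ] C) :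
    coactAt A.coR' (n + 1) (Fin.last n) (A.galoisSwap n x) =
      slide (A.galoisSwap n) A.D (A.coR'.lTensor _ x) := by
  induction n with
  | zero =>
    induction x with
    | zero => simp
    | add x y hx hy => simp only [map_add, hx, hy]
    | tmul w c =>
      rw [galoisSwap_tmul, galoisPow_zero]
      change coactAt A.coR' 1 0 _ = _
      rw [coactAt_zero_cons, LinearMap.lTensor_tmul]
      induction A.coR' c with
      | zero => simp
      | add x y hx hy => simp only [TensorProduct.add_tmul, TensorProduct.tmul_add, map_add, hx, hy]
      | tmul x y =>
        rw [slide_tmul, galoisSwap_tmul, galoisPow_zero]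
        simp
  | succ n ih =>
    induction x with
    | zero => simp
    | add x y hx hy => simp only [map_add, hx, hy]
    | tmul w c =>
      induction w using cons_induction with
      | add x y hx hy => simp only [TensorProduct.add_tmul, map_add, hx, hy]
      | tmul h w =>
        let K : C ⊗[ℂ] C →ₗ[ℂ] ⨂[ℂ]^(n + 2) C := (cons (n + 1)).toLinearMap ∘ₗ
          slide (A.galoisSwap n) C ∘ₗ TensorProduct.mk ℂ _ _ w
        have e1 : ∀ s : C ⊗[ℂ] C, coactAt A.coR' (n + 1 + 1) (Fin.last (n + 1))
            (cons (n + 1) (slide (A.galoisSwap n) C (w ⊗ₜ[ℂ] s))) =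
            K.lTensor A.D (TensorProduct.leftComm ℂ C A.D C (A.coR'.lTensor C s)) := by
          intro s
          induction s with
          | zero => simp
          | add x y hx hy => simp only [TensorProduct.tmul_add, map_add, hx, hy]
          | tmul a b =>
            rw [slide_tmul, ← Fin.succ_last, coactAt_succ_cons, ih, LinearMap.lTensor_tmul,
              LinearMap.lTensor_tmul]
            induction A.coR' b with
            | zero => simp
            | add x y hx hy => simp only [TensorProduct.tmul_add, map_add, hx, hy]
            | tmul x y => simp [K]
        have e2 : ∀ s : A.D ⊗[ℂ] C, slide (A.galoisSwap (n + 1)) A.D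
            (cons n (h ⊗ₜ[ℂ] w) ⊗ₜ[ℂ] s) = K.lTensor A.D (A.betaAmb.lTensor A.D
              (TensorProduct.assoc ℂ A.D C H (s ⊗ₜ[ℂ] h))) := by
          intro s
          induction s with
          | zero => simp
          | add x y hx hy => simp only [TensorProduct.tmul_add, TensorProduct.add_tmul, map_add, hx, hy]
          | tmul a b =>
            rw [slide_tmul, galoisSwap_cons]
            simp [K]
        rw [galoisSwap_cons, e1, ← betaAmb_coR', LinearMap.rTensor_tmul, ← e2,
          LinearMap.lTensor_tmul]

/-! ### The image of the iterated Galois map -/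

/-- The reindexing `H^{⊗n} ⊗ (C ⊗ H) ≃ H^{⊗(n+1)} ⊗ C`, `w ⊗ c ⊗ h ↦ (h ⊗ w) ⊗ c`. -/
def consSwap (n : ℕ) : (⨂[ℂ]^n H) ⊗[ℂ] (C ⊗[ℂ] H) ≃ₗ[ℂ] (⨂[ℂ]^(n + 1) H) ⊗[ℂ] C :=
  (TensorProduct.comm ℂ C H).lTensor (⨂[ℂ]^n H) ≪≫ₗ
    TensorProduct.leftComm ℂ (⨂[ℂ]^n H) H C ≪≫ₗ
    (TensorProduct.assoc ℂ H (⨂[ℂ]^n H) C).symm ≪≫ₗ (cons n).rTensor C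

/-- The iterated Galois map is a composite of `β` on the first factor and the shorter iterated Galois
map on the remaining ones. -/
theorem galoisSwap_consSwap (n : ℕ) (x : (⨂[ℂ]^n H) ⊗[ℂ] (C ⊗[ℂ] H)) :
    A.galoisSwap (n + 1) (consSwap n x) =
      cons (n + 1) (slide (A.galoisSwap n) C (A.betaAmb.lTensor _ x)) := by
  induction x using tensor₃_induction with
  | zero => simp
  | add x y hx hy => simp only [map_add, hx, hy]
  | tmul w c h => rw [LinearMap.lTensor_tmul, ← galoisSwap_cons]; simp [consSwap]

/-- `H^{⊗0} ⊗ C → C^{⊗1}` is the identification of both sides with `C`. -/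
theorem galoisSwap_zero_bijective : Function.Bijective (A.galoisSwap 0) := by
  let p : (⨂[ℂ]^0 H) ≃ₗ[ℂ] ⨂[ℂ]^0 C := PiTensorProduct.isEmptyEquiv (Fin 0) ≪≫ₗ
    (PiTensorProduct.isEmptyEquiv (R := ℂ) (s := fun _ : Fin 0 => C) (Fin 0)).symm
  have hp : A.powAct 0 ∘ₗ TensorProduct.mk ℂ _ _ (PiTensorProduct.tprod ℂ Fin.elim0) =
      p.toLinearMap := by
    refine zero_hom_ext ?_
    rw [LinearMap.comp_apply, TensorProduct.mk_apply, powAct_tprod]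
    simp only [p, LinearEquiv.coe_coe, LinearEquiv.trans_apply,
      PiTensorProduct.isEmptyEquiv_apply_tprod, PiTensorProduct.isEmptyEquiv_symm_apply, one_smul]
    congr 1
    exact Subsingleton.elim _ _
  have h : A.galoisSwap 0 = (TensorProduct.comm ℂ (⨂[ℂ]^0 H) C ≪≫ₗ p.lTensor C ≪≫ₗ
      cons 0).toLinearMap := by
    refine TensorProduct.ext' fun w c => ?_
    rw [galoisSwap_tmul, galoisPow_zero]
    have := LinearMap.congr_fun hp w
    simp only [LinearMap.comp_apply, TensorProduct.mk_apply] at this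
    simp [this]
  rw [h]
  exact LinearEquiv.bijective _

variable {A} in
theorem galoisSwap_injective (hA : A.IsHopfGalois) (n : ℕ) :
    Function.Injective (A.galoisSwap n) := by
  induction n with
  | zero => exact A.galoisSwap_zero_bijective.1
  | succ n ih =>
    intro x y hxy
    obtain ⟨x, rfl⟩ := (consSwap n).surjective x
    obtain ⟨y, rfl⟩ := (consSwap n).surjective y
    rw [galoisSwap_consSwap, galoisSwap_consSwap] at hxy
    exact congrArg _ (Module.Flat.lTensor_preserves_injective_linearMap (M := ⨂[ℂ]^n H) _
      (betaAmb_injective hA) (slide_injective ih ((cons (n + 1)).injective hxy)))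

/-- `C □_D C` is the image of the Galois map, with the factor in `D` of the two coactions written
first. -/
theorem range_betaAmb (hA : A.IsHopfGalois) :
    LinearMap.range A.betaAmb = LinearMap.eqLocus
      ((TensorProduct.assoc ℂ A.D C C).toLinearMap ∘ₗ A.coR'.rTensor C)
      ((TensorProduct.leftComm ℂ C A.D C).toLinearMap ∘ₗ A.coL.lTensor C) := by
  have e : ∀ s : C ⊗[ℂ] C, TensorProduct.assoc ℂ A.D C C (A.coR'.rTensor C s) =
      TensorProduct.leftComm ℂ C A.D C (TensorProduct.assoc ℂ C A.D C (A.coR.rTensor C s)) := by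
    intro s
    induction s with
    | zero => simp
    | add x y hx hy => simp only [map_add, hx, hy]
    | tmul a b =>
      simp only [LinearMap.rTensor_tmul, coR', LinearMap.comp_apply]
      induction A.coR a with
      | zero => simp
      | add x y hx hy => simp only [TensorProduct.add_tmul, map_add, hx, hy]
      | tmul x y => simp
  have e' : LinearMap.range A.betaAmb = A.cotensorSq := by
    have : A.betaAmb = A.cotensorSq.subtype ∘ₗ A.beta := rfl
    rw [this, LinearMap.range_comp, LinearMap.range_eq_top.2 hA.2, Submodule.map_top,
      Submodule.range_subtype]
  rw [e']
  ext s
  change _ = _ ↔ TensorProduct.assoc ℂ A.D C C (A.coR'.rTensor C s) =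
    TensorProduct.leftComm ℂ C A.D C _
  rw [e, (TensorProduct.leftComm ℂ C A.D C).injective.eq_iff]
  rfl

/-- `C^{□(n+2)}` is the part of `C ⊗ C^{□(n+1)}` on which the coactions at the first junction agree. -/
theorem cons_mem_cotensorPow (n : ℕ) (z : C ⊗[ℂ] ⨂[ℂ]^(n + 1) C) :
    cons (n + 1) z ∈ A.cotensorPow (n + 1) ↔
      TensorProduct.assoc ℂ A.D C _ (A.coR'.rTensor _ z) =
        TensorProduct.leftComm ℂ C A.D _ ((coactAt A.coL (n + 1) 0).lTensor C z) ∧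
      z ∈ LinearMap.range ((A.cotensorPow n).subtype.lTensor C) := by
  have h0 : ∀ f : C →ₗ[ℂ] A.D ⊗[ℂ] C, coactAt f (n + 2) 0 (cons (n + 1) z) =
      (cons (n + 1)).toLinearMap.lTensor A.D
        (TensorProduct.assoc ℂ A.D C _ (f.rTensor _ z)) := by
    intro f
    induction z with
    | zero => simp
    | add x y hx hy => simp only [map_add, hx, hy]
    | tmul a b => rw [coactAt_zero_cons, LinearMap.rTensor_tmul]
  have h1 : ∀ (f : C →ₗ[ℂ] A.D ⊗[ℂ] C) (i : Fin (n + 1)), coactAt f (n + 2) i.succ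
      (cons (n + 1) z) = (cons (n + 1)).toLinearMap.lTensor A.D
        (TensorProduct.leftComm ℂ C A.D _ ((coactAt f (n + 1) i).lTensor C z)) := by
    intro f i
    clear h0
    induction z with
    | zero => simp
    | add x y hx hy => simp only [map_add, hx, hy]
    | tmul a b => rw [coactAt_succ_cons, LinearMap.lTensor_tmul]
  have inj : Function.Injective ((cons (V := C) (n + 1)).toLinearMap.lTensor A.D) :=
    Module.Flat.lTensor_preserves_injective_linearMap _ (cons (n + 1)).injective
  rw [cotensorPow, Submodule.mem_iInf, Fin.forall_fin_succ]
  simp only [LinearMap.mem_eqLocus]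
  rw [cotensorPow, mem_range_lTensor_iInf_eqLocus]
  refine and_congr ?_ (forall_congr' fun j => ?_)
  · rw [Fin.castSucc_zero, h0, h1, inj.eq_iff]
  · rw [Fin.castSucc_succ, h1, h1, inj.eq_iff, (TensorProduct.leftComm ℂ C A.D _).injective.eq_iff]

variable {A} in
/-- The image of the iterated Galois map is the iterated cotensor product. -/
theorem range_galoisSwap (hA : A.IsHopfGalois) (n : ℕ) :
    LinearMap.range (A.galoisSwap n) = A.cotensorPow n := by
  induction n with
  | zero =>
    rw [LinearMap.range_eq_top.2 A.galoisSwap_zero_bijective.2, cotensorPow, iInf_of_empty]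
  | succ n ih =>
    ext y
    obtain ⟨z, rfl⟩ := (cons (n + 1)).surjective y
    rw [cons_mem_cotensorPow, ← ih, ← range_slide]
    -- by colinearity and injectivity of the shorter map, the condition at the first junction can be
    -- tested on the two factors in `C` before that map is applied
    have key : ∀ x : (⨂[ℂ]^n H) ⊗[ℂ] (C ⊗[ℂ] C),
        TensorProduct.assoc ℂ A.D C _ (A.coR'.rTensor _ (slide (A.galoisSwap n) C x)) =
          TensorProduct.leftComm ℂ C A.D _ ((coactAt A.coL (n + 1) 0).lTensor C
            (slide (A.galoisSwap n) C x)) ↔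
        x ∈ LinearMap.range (A.betaAmb.lTensor (⨂[ℂ]^n H)) := by
      intro x
      rw [LinearMap.lTensor_range, range_betaAmb A hA, mem_range_lTensor_eqLocus,
        rTensor_slide, assoc_slide, lTensor_slide (A.coactAt_coL_galoisSwap n), leftComm_slide,
        (slide_injective (slide_injective (galoisSwap_injective hA n))).eq_iff,
        LinearMap.lTensor_comp, LinearMap.lTensor_comp]
      rfl
    constructor
    · rintro ⟨x, hx⟩
      obtain ⟨x, rfl⟩ := (consSwap n).surjective x
      rw [galoisSwap_consSwap] at hx
      obtain rfl := (cons (n + 1)).injective hx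
      exact ⟨(key _).2 ⟨x, rfl⟩, _, rfl⟩
    · rintro ⟨h, x, rfl⟩
      obtain ⟨x, rfl⟩ := (key x).1 h
      exact ⟨_, A.galoisSwap_consSwap n x⟩

/-! ### The space `D □_{D^e} C^{□(n+1)}` as the image of `ω` -/

theorem coCe_eq : A.coCe = (TensorProduct.assoc ℂ A.D A.D C).symm.toLinearMap ∘ₗ
    A.coR'.lTensor A.D ∘ₗ A.coL := by
  have e : ∀ s : C ⊗[ℂ] C, TensorProduct.map A.proj (A.proj.rTensor C ∘ₗ
      (TensorProduct.comm ℂ C C).toLinearMap) (comul.lTensor C s) =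
      A.coR'.lTensor A.D (A.proj.rTensor C s) := by
    intro s
    induction s with
    | zero => simp
    | add x y hx hy => simp only [map_add, hx, hy]
    | tmul a b =>
      simp only [LinearMap.lTensor_tmul, LinearMap.rTensor_tmul, TensorProduct.map_tmul, coR',
        coR, LinearMap.comp_apply]
      congr 1
      induction comul (R := ℂ) b with
      | zero => simp
      | add x y hx hy => simp only [map_add, hx, hy]
      | tmul x y => simp
  exact LinearMap.ext fun c => congrArg (TensorProduct.assoc ℂ A.D A.D C).symm (e _)

/-- The iterated Galois map is `D^e`-colinear. -/
theorem powCoact_galoisSwap (n : ℕ) (x : (⨂[ℂ]^n H) ⊗[ℂ] C) :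
    A.powCoact n (A.galoisSwap n x) =
      slide (A.galoisSwap n) (A.D ⊗[ℂ] A.D) (A.coCe.lTensor _ x) := by
  rw [coCe_eq, powCoact, LinearMap.comp_apply, LinearMap.comp_apply, LinearEquiv.coe_coe,
    coactAt_coL_galoisSwap, lTensor_slide (A.coactAt_coR'_galoisSwap n), assoc_symm_slide,
    LinearMap.lTensor_comp, LinearMap.lTensor_comp]
  rfl

/-- `ωₙ` is the iterated Galois map on the factor in `C` of `M̃ ⊆ D ⊗ C`. -/
theorem omega_eq (n : ℕ) :
    A.omega n = slide (A.galoisSwap n) A.D ∘ₗ A.tildeM.subtype.lTensor (⨂[ℂ]^n H) := rfl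

variable {A} in
theorem omega_injective (hA : A.IsHopfGalois) (n : ℕ) : Function.Injective (A.omega n) := by
  rw [omega_eq]
  exact (slide_injective (galoisSwap_injective hA n)).comp
    (Module.Flat.lTensor_preserves_injective_linearMap (M := ⨂[ℂ]^n H) _
      A.tildeM.subtype_injective)

variable {A} in
/-- The image of `ωₙ` is `D □_{D^e} C^{□(n+1)}`: the condition over `D^e` can be tested on `D ⊗ C`, before
the iterated Galois map is applied, and there it cuts out `M̃`. -/
theorem range_omega (hA : A.IsHopfGalois) (n : ℕ) :
    LinearMap.range (A.omega n) = A.coextObj n := by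
  rw [coextObj, ← range_galoisSwap hA, ← range_slide, omega_eq]
  have key : ∀ x : (⨂[ℂ]^n H) ⊗[ℂ] (A.D ⊗[ℂ] C),
      slide (A.galoisSwap n) A.D x ∈ cotensor A.coDe (A.powCoact n) ↔
      x ∈ LinearMap.range (A.tildeM.subtype.lTensor (⨂[ℂ]^n H)) := by
    intro x
    have hp := lTensor_slide (E := A.D) (X' := (A.D ⊗[ℂ] A.D) ⊗[ℂ] C)
      (W' := (A.D ⊗[ℂ] A.D) ⊗[ℂ] ⨂[ℂ]^(n + 1) C) (g := A.galoisSwap n)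
      (g' := slide (A.galoisSwap n) (A.D ⊗[ℂ] A.D)) (p := A.powCoact n) (q := A.coCe)
      (A.powCoact_galoisSwap n) x
    rw [tildeM, cotensor, cotensor, mem_range_lTensor_eqLocus, LinearMap.mem_eqLocus,
      LinearMap.comp_apply, LinearEquiv.coe_coe, rTensor_slide, assoc_slide,
      hp,
      (slide_injective (slide_injective (galoisSwap_injective hA n))).eq_iff,
      LinearMap.lTensor_comp]
    rfl
  ext y
  constructor
  · rintro ⟨x, rfl⟩
    exact ⟨⟨_, rfl⟩, (key _).2 ⟨x, rfl⟩⟩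
  · rintro ⟨⟨x, rfl⟩, h⟩
    obtain ⟨x, rfl⟩ := (key x).1 h
    exact ⟨x, rfl⟩

end RightModuleCoalgebra
end CocycHopf

namespace CocycHopf

/-! ### Cofaces and cyclic operators of `Cⁿ(H, M)` -/

section HopfOperators

theorem twist_rTensor {H V W : Type*} [Ring H] [HopfAlgebra ℂ H] [AddCommGroup V] [Module ℂ V]
    [AddCommGroup W] [Module ℂ W] {δ : V →ₗ[ℂ] V ⊗[ℂ] H} {δ' : W →ₗ[ℂ] W ⊗[ℂ] H}
    {e : V →ₗ[ℂ] W} (he : ∀ v, δ' (e v) = e.rTensor H (δ v)) (f : H →ₗ[ℂ] H) (y : V ⊗[ℂ] H) :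
    twist δ' f (e.rTensor H y) = e.rTensor H (twist δ f y) := by
  induction y with
  | zero => simp
  | add x y hx hy => simp only [map_add, hx, hy]
  | tmul v g => rw [LinearMap.rTensor_tmul, twist_tmul, twist_tmul, he, lTensor_rTensor_comm]

theorem tensorCoact_one_tmul {H V : Type*} [Ring H] [HopfAlgebra ℂ H] [AddCommGroup V] [Module ℂ V]
    (δ : V →ₗ[ℂ] V ⊗[ℂ] H) (v : V) :
    tensorCoact comul δ ((1 : H) ⊗ₜ[ℂ] v) = (TensorProduct.mk ℂ H V 1).rTensor H (δ v) := by
  rw [tensorCoact_tmul, Bialgebra.comul_one]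
  induction δ v with
  | zero => simp
  | add x y hx hy => simp only [TensorProduct.tmul_add, map_add, hx, hy]
  | tmul a b => simp [Algebra.TensorProduct.one_def]

variable {H M : Type*} [Ring H] [HopfAlgebra ℂ H] [AddCommGroup M] [Module ℂ M]

/-- Comparison of `appendCoact` with the inverse twist, with `V = H^{⊗n}` and `W = H^{⊗(n+1)}`. -/
theorem appendCoact_step {V W : Type*} [AddCommGroup V] [Module ℂ V] [AddCommGroup W] [Module ℂ W]
    (δ : V →ₗ[ℂ] V ⊗[ℂ] H) (s : V ⊗[ℂ] H →ₗ[ℂ] W) (v : V) (y : H ⊗[ℂ] M) :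
    s.rTensor M ((TensorProduct.assoc ℂ V H M).symm (((LinearMap.mul' ℂ H ∘ₗ
      (HopfAlgebra.antipode ℂ).rTensor H).rTensor M ∘ₗ
      (TensorProduct.assoc ℂ H H M).symm.toLinearMap ∘ₗ
        (TensorProduct.mk ℂ H (H ⊗[ℂ] M)).flip y).lTensor V (δ v))) =
      (s ∘ₗ twist δ (HopfAlgebra.antipode ℂ)).rTensor M
        ((TensorProduct.assoc ℂ V H M).symm (v ⊗ₜ[ℂ] y)) := by
  induction y with
  | zero => simp
  | add x y hx hy =>
    simp only [map_add, hx, hy, LinearMap.comp_add, LinearMap.lTensor_add, LinearMap.add_apply,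
      TensorProduct.tmul_add]
  | tmul g m =>
    rw [TensorProduct.assoc_symm_tmul, LinearMap.rTensor_tmul, LinearMap.comp_apply, twist_tmul]
    induction δ v with
    | zero => simp
    | add x y hx hy => simp only [map_add, hx, hy, TensorProduct.add_tmul]
    | tmul a b => simp

/-- `appendCoact` applies the inverse twist `w ⊗ g ↦ w₀ ⊗ S(w₁) g` to `w ⊗ m₋₁`. -/
theorem appendCoact_tmul (ρ : M →ₗ[ℂ] H ⊗[ℂ] M) (n : ℕ) (w : ⨂[ℂ]^n H) (m : M) :
    appendCoact ρ n (w ⊗ₜ[ℂ] m) =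
      ((snoc n).toLinearMap ∘ₗ twist (diagCoact n) (HopfAlgebra.antipode ℂ)).rTensor M
        ((TensorProduct.assoc ℂ (⨂[ℂ]^n H) H M).symm (w ⊗ₜ[ℂ] ρ m)) := by
  rw [← appendCoact_step]
  simp only [appendCoact, LinearMap.comp_apply, LinearMap.rTensor_tmul, LinearEquiv.coe_coe]
  congr 2
  induction diagCoact n w with
  | zero => simp
  | add x y hx hy => simp only [TensorProduct.add_tmul, map_add, hx, hy]
  | tmul a b => rfl

theorem actByFirst_cons (act : M ⊗[ℂ] H →ₗ[ℂ] M) (n : ℕ) (h : H) (w : ⨂[ℂ]^n H) (m : M) :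
    actByFirst act n (cons n (h ⊗ₜ[ℂ] w) ⊗ₜ[ℂ] m) = w ⊗ₜ[ℂ] act (m ⊗ₜ[ℂ] h) := by
  simp [actByFirst]

theorem insertOneAt_zero_eq (n : ℕ) : insertOneAt (H := H) n 0 = oneHead n := by
  cases n <;> rfl

theorem appendCoact_oneHead (ρ : M →ₗ[ℂ] H ⊗[ℂ] M) (n : ℕ) (x : (⨂[ℂ]^n H) ⊗[ℂ] M) :
    appendCoact ρ (n + 1) ((oneHead n).rTensor M x) =
      (oneHead (n + 1)).rTensor M (appendCoact ρ n x) := by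
  induction x with
  | zero => simp
  | add x y hx hy => simp only [map_add, hx, hy]
  | tmul w m =>
    have h1 : ∀ w : ⨂[ℂ]^n H, diagCoact (n + 1) (oneHead n w) =
        (oneHead n).rTensor H (diagCoact n w) := by
      intro w
      rw [oneHead_apply, diagCoact_cons, tensorCoact_one_tmul, oneHead, LinearMap.rTensor_comp]
      rfl
    have h2 : ∀ y : (⨂[ℂ]^n H) ⊗[ℂ] H, snoc (n + 1) ((oneHead n).rTensor H y) =
        oneHead (n + 1) (snoc n y) := by
      intro y
      induction y with
      | zero => simp
      | add x y hx hy => simp only [map_add, hx, hy]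
      | tmul a b => rw [LinearMap.rTensor_tmul, oneHead_apply, snoc_cons, oneHead_apply]
    rw [LinearMap.rTensor_tmul, appendCoact_tmul, appendCoact_tmul]
    induction ρ m with
    | zero => simp
    | add x y hx hy => simp only [TensorProduct.tmul_add, map_add, hx, hy]
    | tmul g m =>
      simp only [TensorProduct.assoc_symm_tmul, LinearMap.rTensor_tmul, LinearMap.comp_apply,
        LinearEquiv.coe_coe]
      rw [← LinearMap.rTensor_tmul, twist_rTensor h1, h2]

/-- The last coface is the cyclic operator applied after the first coface. -/
theorem actByFirst_appendCoact_insertOneAt {act : M ⊗[ℂ] H →ₗ[ℂ] M}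
    (hact : ∀ m, act (m ⊗ₜ[ℂ] (1 : H)) = m) (ρ : M →ₗ[ℂ] H ⊗[ℂ] M) (n : ℕ)
    (x : (⨂[ℂ]^n H) ⊗[ℂ] M) :
    actByFirst act (n + 1) (appendCoact ρ (n + 1) ((insertOneAt n 0).rTensor M x)) =
      appendCoact ρ n x := by
  rw [insertOneAt_zero_eq, appendCoact_oneHead]
  induction appendCoact ρ n x with
  | zero => simp
  | add x y hx hy => simp only [map_add, hx, hy]
  | tmul w m => rw [LinearMap.rTensor_tmul, oneHead_apply, actByFirst_cons, hact]

end HopfOperators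

namespace RightModuleCoalgebra

variable {H C : Type*} [Ring H] [HopfAlgebra ℂ H] [AddCommGroup C] [Module ℂ C] [Coalgebra ℂ C]
  (A : RightModuleCoalgebra H C)

/-! ### The iterated Galois map and the cyclic operator -/

section Cyclic

variable {M : Type*} [AddCommGroup M] [Module ℂ M] {η : M →ₗ[ℂ] C}

theorem galoisSwap_actByFirst {act' : M ⊗[ℂ] H →ₗ[ℂ] M}
    (hact : ∀ m h, η (act' (m ⊗ₜ[ℂ] h)) = A.act (η m ⊗ₜ[ℂ] h)) (n : ℕ)
    (y : (⨂[ℂ]^(n + 1) H) ⊗[ℂ] M) :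
    A.galoisSwap n (η.lTensor _ (actByFirst act' n y)) =
      A.galoisTail (n + 1) (TensorProduct.comm ℂ _ C (η.lTensor _ y)) := by
  induction y with
  | zero => simp
  | add x y hx hy => simp only [map_add, hx, hy]
  | tmul w m =>
    induction w using cons_induction with
    | add x y hx hy => simp only [TensorProduct.add_tmul, map_add, hx, hy]
    | tmul h w =>
      rw [actByFirst_cons, LinearMap.lTensor_tmul, LinearMap.lTensor_tmul, galoisSwap_tmul, hact,
        TensorProduct.comm_tmul, galoisTail_cons]

/-- The inverse twist cancels the accumulated factors in the last component of the iterated Galois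
map. -/
theorem galoisTail_snoc_twist (n : ℕ) (c : C) (w : ⨂[ℂ]^n H) (g : H) :
    A.galoisTail (n + 1) (c ⊗ₜ[ℂ] snoc n
        (twist (diagCoact n) (HopfAlgebra.antipode ℂ) (w ⊗ₜ[ℂ] g))) =
      snoc n ((A.galoisTail n ∘ₗ (TensorProduct.mk ℂ C _).flip w).rTensor C
        (A.betaAmb (c ⊗ₜ[ℂ] g))) := by
  have h1 : ∀ y : (⨂[ℂ]^n H) ⊗[ℂ] H, A.galoisTail (n + 1) (c ⊗ₜ[ℂ] snoc n y) =
      snoc n (TensorProduct.map (A.galoisTail n) A.act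
        (TensorProduct.tensorTensorTensorComm ℂ C C (⨂[ℂ]^n H) H (comul (R := ℂ) c ⊗ₜ[ℂ]
          (isRightCoaction_diagCoact H n).twistEquiv y))) := by
    intro y
    induction y with
    | zero => simp
    | add x y hx hy => simp only [TensorProduct.tmul_add, map_add, hx, hy]
    | tmul w g => exact A.galoisTail_snoc n c w g
  rw [h1, ← (isRightCoaction_diagCoact H n).twistEquiv_symm_apply, LinearEquiv.apply_symm_apply,
    betaAmb_tmul]
  induction comul (R := ℂ) c with
  | zero => simp
  | add x y hx hy => simp only [TensorProduct.add_tmul, map_add, hx, hy]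
  | tmul a b => simp

/-- The iterated Galois map carries the cyclic operator with coefficients in `M` to the rotation,
provided that `m₀₁ ⊗ m₀₂ ◁ m₋₁ = m₂ ⊗ m₁`. -/
theorem galoisSwap_cyclic {act' : M ⊗[ℂ] H →ₗ[ℂ] M} {ρ : M →ₗ[ℂ] H ⊗[ℂ] M}
    (hact : ∀ m h, η (act' (m ⊗ₜ[ℂ] h)) = A.act (η m ⊗ₜ[ℂ] h))
    (hρ : ∀ m, A.betaVia η (ρ m) = TensorProduct.comm ℂ C C (comul (R := ℂ) (η m))) (n : ℕ)
    (x : (⨂[ℂ]^n H) ⊗[ℂ] M) :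
    A.galoisSwap n (η.lTensor _ (actByFirst act' n (appendCoact ρ n x))) =
      rotate n (A.galoisSwap n (η.lTensor _ x)) := by
  rw [galoisSwap_actByFirst A hact]
  induction x with
  | zero => simp
  | add x y hx hy => simp only [map_add, hx, hy]
  | tmul w m =>
    have e1 : ∀ s : H ⊗[ℂ] M, A.galoisTail (n + 1) (TensorProduct.comm ℂ _ C (η.lTensor _
        (((snoc n).toLinearMap ∘ₗ twist (diagCoact n) (HopfAlgebra.antipode ℂ)).rTensor M
        ((TensorProduct.assoc ℂ (⨂[ℂ]^n H) H M).symm (w ⊗ₜ[ℂ] s))))) =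
        snoc n ((A.galoisTail n ∘ₗ (TensorProduct.mk ℂ C _).flip w).rTensor C
          (A.betaVia η s)) := by
      intro s
      induction s with
      | zero => simp
      | add x y hx hy => simp only [TensorProduct.tmul_add, map_add, hx, hy]
      | tmul g m =>
        rw [TensorProduct.assoc_symm_tmul, LinearMap.rTensor_tmul, LinearMap.lTensor_tmul,
          TensorProduct.comm_tmul, LinearMap.comp_apply, LinearEquiv.coe_coe,
          galoisTail_snoc_twist, betaVia_tmul]
    rw [appendCoact_tmul, e1, hρ, LinearMap.lTensor_tmul, galoisSwap_tmul, galoisPow_tmul]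
    induction comul (R := ℂ) (η m) with
    | zero => simp
    | add x y hx hy => simp only [map_add, hx, hy]
    | tmul a b => simp

end Cyclic

end RightModuleCoalgebra
end CocycHopf

namespace CocycHopf

/-! ### Transport of cocyclic structures and cyclic cohomology -/

namespace CocyclicData

/-- A family of injections that commute with the operators pulls back the cocyclic identities. -/
theorem IsCocyclic.of_injective {X Z : CocyclicData} (hZ : Z.IsCocyclic)
    (f : ∀ n, X.obj n →ₗ[ℂ] Z.obj n) (hf : ∀ n, Function.Injective (f n))
    (hδ : ∀ n i x, f (n + 1) (X.δ n i x) = Z.δ n i (f n x))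
    (hσ : ∀ n i x, f n (X.σ n i x) = Z.σ n i (f (n + 1) x))
    (hτ : ∀ n x, f n (X.τ n x) = Z.τ n (f n x)) : X.IsCocyclic where
  δ_comp_δ n i j h := LinearMap.ext fun x => hf _ <| by
    simpa [hδ] using LinearMap.congr_fun (hZ.δ_comp_δ n i j h) (f n x)
  σ_comp_δ_of_le n i j h := LinearMap.ext fun x => hf _ <| by
    simpa [hδ, hσ] using LinearMap.congr_fun (hZ.σ_comp_δ_of_le n i j h) (f _ x)
  σ_comp_δ_self n i := LinearMap.ext fun x => hf _ <| by
    simpa [hδ, hσ] using LinearMap.congr_fun (hZ.σ_comp_δ_self n i) (f _ x)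
  σ_comp_δ_succ n i := LinearMap.ext fun x => hf _ <| by
    simpa [hδ, hσ] using LinearMap.congr_fun (hZ.σ_comp_δ_succ n i) (f _ x)
  σ_comp_δ_of_gt n i j h := LinearMap.ext fun x => hf _ <| by
    simpa [hδ, hσ] using LinearMap.congr_fun (hZ.σ_comp_δ_of_gt n i j h) (f _ x)
  σ_comp_σ n i j h := LinearMap.ext fun x => hf _ <| by
    simpa [hσ] using LinearMap.congr_fun (hZ.σ_comp_σ n i j h) (f _ x)
  τ_comp_δ_succ n i := LinearMap.ext fun x => hf _ <| by
    simpa [hδ, hτ] using LinearMap.congr_fun (hZ.τ_comp_δ_succ n i) (f _ x)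
  τ_comp_δ_zero n := LinearMap.ext fun x => hf _ <| by
    simpa [hδ, hτ] using LinearMap.congr_fun (hZ.τ_comp_δ_zero n) (f _ x)
  τ_comp_σ_succ n j := LinearMap.ext fun x => hf _ <| by
    simpa [hσ, hτ] using LinearMap.congr_fun (hZ.τ_comp_σ_succ n j) (f _ x)
  τ_comp_σ_zero n := LinearMap.ext fun x => hf _ <| by
    simpa [hσ, hτ] using LinearMap.congr_fun (hZ.τ_comp_σ_zero n) (f _ x)
  τ_pow n := LinearMap.ext fun x => hf _ <| by
    have h : ∀ k, f n ((X.τ n ^ k) x) = (Z.τ n ^ k) (f n x) := by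
      intro k
      induction k with
      | zero => rfl
      | succ k ih => rw [pow_succ', pow_succ', Module.End.mul_apply, hτ, ih]; rfl
    rw [h, hZ.τ_pow]
    rfl

variable {X Y : CocyclicData} {f : ∀ n, X.obj n →ₗ[ℂ] Y.obj n}

theorem IsIso.isCocyclic (hf : IsIso X Y f) (hX : X.IsCocyclic) : Y.IsCocyclic := by
  let g : ∀ n, X.obj n ≃ₗ[ℂ] Y.obj n := fun n => LinearEquiv.ofBijective (f n) (hf.bijective n)
  have hg : ∀ n x, g n x = f n x := fun _ _ => rfl
  refine hX.of_injective (fun n => (g n).symm.toLinearMap) (fun n => (g n).symm.injective)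
    (fun n i y => ?_) (fun n i y => ?_) fun n y => ?_
  · obtain ⟨x, rfl⟩ := (g n).surjective y
    have := LinearMap.congr_fun (hf.comm_δ n i) x
    simp only [LinearMap.comp_apply, ← hg] at this
    simp [← this]
  · obtain ⟨x, rfl⟩ := (g (n + 1)).surjective y
    have := LinearMap.congr_fun (hf.comm_σ n i) x
    simp only [LinearMap.comp_apply, ← hg] at this
    simp [← this]
  · obtain ⟨x, rfl⟩ := (g n).surjective y
    have := LinearMap.congr_fun (hf.comm_τ n) x
    simp only [LinearMap.comp_apply, ← hg] at this
    simp [← this]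

theorem IsIso.comm_b (hf : IsIso X Y f) (n : ℕ) (x : X.obj n) :
    f (n + 1) (X.b n x) = Y.b n (f n x) := by
  simp only [b, LinearMap.sum_apply, LinearMap.smul_apply, map_sum, map_smul]
  exact Finset.sum_congr rfl fun i _ => congrArg _ (LinearMap.congr_fun (hf.comm_δ n i) x)

theorem IsIso.mem_cyclicCochains_iff (hf : IsIso X Y f) (n : ℕ) (x : X.obj n) :
    f n x ∈ Y.cyclicCochains n ↔ x ∈ X.cyclicCochains n := by
  have := LinearMap.congr_fun (hf.comm_τ n) x
  simp only [LinearMap.comp_apply] at this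
  simp only [cyclicCochains, LinearMap.mem_eqLocus, LinearMap.smul_apply, LinearMap.id_apply]
  rw [← this, ← map_smul, (hf.bijective n).1.eq_iff]

theorem IsIso.mem_cocycles_iff (hf : IsIso X Y f) (n : ℕ) (x : X.obj n) :
    f n x ∈ Y.cocycles n ↔ x ∈ X.cocycles n := by
  simp only [cocycles, Submodule.mem_inf, LinearMap.mem_ker]
  rw [hf.mem_cyclicCochains_iff, ← hf.comm_b, map_eq_zero_iff _ (hf.bijective (n + 1)).1]

theorem IsIso.mem_coboundaries_iff (hf : IsIso X Y f) (n : ℕ) (x : X.obj n) :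
    f n x ∈ Y.coboundaries n ↔ x ∈ X.coboundaries n := by
  cases n with
  | zero =>
    simp only [coboundaries, Submodule.mem_bot]
    exact map_eq_zero_iff _ (hf.bijective 0).1
  | succ n =>
    simp only [coboundaries, Submodule.mem_map]
    constructor
    · rintro ⟨y, hy, h⟩
      obtain ⟨z, rfl⟩ := (hf.bijective n).2 y
      rw [← hf.comm_b] at h
      exact ⟨z, (hf.mem_cyclicCochains_iff n z).1 hy, (hf.bijective (n + 1)).1 h⟩
    · rintro ⟨z, hz, rfl⟩
      exact ⟨f n z, (hf.mem_cyclicCochains_iff n z).2 hz, (hf.comm_b n z).symm⟩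

/-- An isomorphism of cocyclic modules induces isomorphisms in cyclic cohomology. -/
theorem IsIso.exists_HC_equiv (hf : IsIso X Y f) (n : ℕ) :
    ∃ e : X.HC n ≃ₗ[ℂ] Y.HC n, ∀ z : X.cocycles n, ∃ h : f n z ∈ Y.cocycles n,
      e (Submodule.Quotient.mk z) = Submodule.Quotient.mk ⟨f n z, h⟩ := by
  have hmem : ∀ z : X.cocycles n, f n z ∈ Y.cocycles n := fun z =>
    (hf.mem_cocycles_iff n z).2 z.2
  let g : X.cocycles n →ₗ[ℂ] Y.cocycles n := (f n).restrict fun z hz => hmem ⟨z, hz⟩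
  have hg : Function.Bijective g := by
    refine ⟨fun x y h => Subtype.ext ((hf.bijective n).1 (congrArg Subtype.val h)), fun y => ?_⟩
    obtain ⟨x, hx⟩ := (hf.bijective n).2 y
    exact ⟨⟨x, (hf.mem_cocycles_iff n x).1 (hx ▸ y.2)⟩, Subtype.ext hx⟩
  let ge : X.cocycles n ≃ₗ[ℂ] Y.cocycles n := LinearEquiv.ofBijective g hg
  refine ⟨Submodule.Quotient.equiv _ _ ge ?_, fun z => ⟨hmem z, rfl⟩⟩
  ext y
  obtain ⟨x, rfl⟩ := ge.surjective y
  rw [Submodule.mem_map]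
  constructor
  · rintro ⟨x', hx', h⟩
    obtain rfl := ge.injective h
    exact (hf.mem_coboundaries_iff n x').2 hx'
  · intro h
    exact ⟨x, (hf.mem_coboundaries_iff n x).1 h, rfl⟩

end CocyclicData

namespace RightModuleCoalgebra

variable {H C : Type*} [Ring H] [HopfAlgebra ℂ H] [AddCommGroup C] [Module ℂ C] [Coalgebra ℂ C]
  (A : RightModuleCoalgebra H C)

/-! ### `ω` is an isomorphism of cocyclic modules -/

/-- The composite of `ωₙ` with `d ⊗ c₀ ⊗ ⋯ ⊗ cₙ ↦ ε(d) c₀ ⊗ ⋯ ⊗ cₙ`. It embeds `Cⁿ(H, M̃)` into the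
cocyclic module `C^{⊗(n+1)}` of the coalgebra `C`. -/
def tildeGalois (n : ℕ) : (⨂[ℂ]^n H) ⊗[ℂ] A.tildeM →ₗ[ℂ] ⨂[ℂ]^(n + 1) C :=
  A.galoisSwap n ∘ₗ A.tildeEmb.lTensor (⨂[ℂ]^n H)

theorem epsD_omega (n : ℕ) (x : (⨂[ℂ]^n H) ⊗[ℂ] A.tildeM) :
    A.epsD _ (A.omega n x) = A.tildeGalois n x := by
  have e : ∀ y : (⨂[ℂ]^n H) ⊗[ℂ] (A.D ⊗[ℂ] C), A.epsD _ (slide (A.galoisSwap n) A.D y) =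
      A.galoisSwap n ((A.epsD C).lTensor _ y) := by
    intro y
    induction y using tensor₃_induction with
    | zero => simp
    | add x y hx hy => simp only [map_add, hx, hy]
    | tmul w d c => simp [epsD_tmul]
  rw [omega_eq, LinearMap.comp_apply, e, ← LinearMap.lTensor_comp_apply]
  rfl

/-- `ωₙ` is recovered from its image in `C^{⊗(n+1)}` by the left `D`-coaction. -/
theorem coactAt_coL_tildeGalois (n : ℕ) (x : (⨂[ℂ]^n H) ⊗[ℂ] A.tildeM) :
    coactAt A.coL (n + 1) 0 (A.tildeGalois n x) = A.omega n x := by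
  rw [tildeGalois, LinearMap.comp_apply, coactAt_coL_galoisSwap, omega_eq, LinearMap.comp_apply,
    ← LinearMap.lTensor_comp_apply]
  congr 3
  exact LinearMap.ext A.coL_tildeEmb

variable {A} in
theorem tildeGalois_injective (hA : A.IsHopfGalois) (n : ℕ) :
    Function.Injective (A.tildeGalois n) :=
  (galoisSwap_injective hA n).comp
    (Module.Flat.lTensor_preserves_injective_linearMap (M := ⨂[ℂ]^n H) _ A.tildeEmb_injective)

theorem omega_rTensor {n k : ℕ} {p : (⨂[ℂ]^(n + 1) C) →ₗ[ℂ] ⨂[ℂ]^(k + 1) C}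
    {q : (⨂[ℂ]^n H) →ₗ[ℂ] ⨂[ℂ]^k H}
    (h : ∀ c w, A.galoisPow k (c ⊗ₜ[ℂ] q w) = p (A.galoisPow n (c ⊗ₜ[ℂ] w)))
    (x : (⨂[ℂ]^n H) ⊗[ℂ] A.tildeM) :
    A.omega k (q.rTensor A.tildeM x) = p.lTensor A.D (A.omega n x) := by
  have e : ∀ (w : ⨂[ℂ]^n H) (s : A.D ⊗[ℂ] C), slide (A.galoisSwap k) A.D (q w ⊗ₜ[ℂ] s) =
      p.lTensor A.D (slide (A.galoisSwap n) A.D (w ⊗ₜ[ℂ] s)) := by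
    intro w s
    induction s with
    | zero => simp
    | add x y hx hy => simp only [TensorProduct.tmul_add, map_add, hx, hy]
    | tmul d c => simp [h]
  induction x with
  | zero => simp
  | add x y hx hy => simp only [map_add, hx, hy]
  | tmul w m => exact e w m

theorem epsD_lTensor {V W : Type*} [AddCommGroup V] [Module ℂ V] [AddCommGroup W] [Module ℂ W]
    (p : V →ₗ[ℂ] W) (y : A.D ⊗[ℂ] V) : A.epsD W (p.lTensor A.D y) = p (A.epsD V y) := by
  induction y with
  | zero => simp
  | add x y hx hy => simp only [map_add, hx, hy]
  | tmul d c => simp [epsD_tmul]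

theorem tildeGalois_rTensor {n k : ℕ} {p : (⨂[ℂ]^(n + 1) C) →ₗ[ℂ] ⨂[ℂ]^(k + 1) C}
    {q : (⨂[ℂ]^n H) →ₗ[ℂ] ⨂[ℂ]^k H}
    (h : ∀ c w, A.galoisPow k (c ⊗ₜ[ℂ] q w) = p (A.galoisPow n (c ⊗ₜ[ℂ] w)))
    (x : (⨂[ℂ]^n H) ⊗[ℂ] A.tildeM) :
    A.tildeGalois k (q.rTensor A.tildeM x) = p (A.tildeGalois n x) := by
  rw [← epsD_omega, A.omega_rTensor h, epsD_lTensor, epsD_omega]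

variable {A} in
theorem tildeGalois_cyclic (hA : A.IsHopfGalois) (n : ℕ) (x : (⨂[ℂ]^n H) ⊗[ℂ] A.tildeM) :
    A.tildeGalois n (actByFirst (M := A.tildeM) A.tildeAct n
      (appendCoact (M := A.tildeM) (tildeCoact hA) n x)) = rotate n (A.tildeGalois n x) :=
  A.galoisSwap_cyclic (M := A.tildeM) A.tildeEmb_act (betaVia_tildeCoact hA) n x

variable {A} in
theorem tildeGalois_appendCoact (hA : A.IsHopfGalois) (n : ℕ) (x : (⨂[ℂ]^n H) ⊗[ℂ] A.tildeM) :
    A.tildeGalois (n + 1) (appendCoact (M := A.tildeM) (tildeCoact hA) n x) =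
      rotate (n + 1) (comulAt (n + 1) 0 (A.tildeGalois n x)) := by
  rw [← actByFirst_appendCoact_insertOneAt (M := A.tildeM) (isSAYD_tilde hA).act_one,
    tildeGalois_cyclic, A.tildeGalois_rTensor (A.galoisPow_insertOneAt n 0)]

variable {A} in
theorem omega_coface (hA : A.IsHopfGalois) (n : ℕ) (i : Fin (n + 2))
    (x : (⨂[ℂ]^n H) ⊗[ℂ] A.tildeM) :
    A.omega (n + 1) ((hopfCyclic (H := H) (M := A.tildeM) A.tildeAct (tildeCoact hA)).δ n i x) =
      A.coface n i (A.omega n x) := by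
  induction i using Fin.lastCases with
  | last =>
    simp only [Fin.lastCases_last, coface, LinearMap.comp_apply]
    rw [← coactAt_coL_tildeGalois, tildeGalois_appendCoact, epsD_omega]
  | cast i =>
    simp only [Fin.lastCases_castSucc, coface]
    exact A.omega_rTensor (A.galoisPow_insertOneAt n i) x

variable {A} in
theorem omega_codegeneracy (hA : A.IsHopfGalois) (n : ℕ) (i : Fin (n + 1))
    (x : (⨂[ℂ]^(n + 1) H) ⊗[ℂ] A.tildeM) :
    A.omega n ((hopfCyclic (H := H) (M := A.tildeM) A.tildeAct (tildeCoact hA)).σ n i x) =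
      A.codegeneracy n i (A.omega (n + 1) x) := by
  induction i using Fin.lastCases with
  | last =>
    simp only [Fin.lastCases_last, codegeneracy]
    exact A.omega_rTensor (A.galoisPow_counitLast n) x
  | cast i =>
    simp only [Fin.lastCases_castSucc, codegeneracy]
    exact A.omega_rTensor (A.galoisPow_mulAt n i) x

variable {A} in
theorem omega_cyclicOp (hA : A.IsHopfGalois) (n : ℕ) (x : (⨂[ℂ]^n H) ⊗[ℂ] A.tildeM) :
    A.omega n ((hopfCyclic (H := H) (M := A.tildeM) A.tildeAct (tildeCoact hA)).τ n x) =
      A.cyclicOp n (A.omega n x) := by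
  rw [← coactAt_coL_tildeGalois, cyclicOp, LinearMap.comp_apply, LinearMap.comp_apply,
    LinearMap.comp_apply, epsD_omega]
  exact congrArg _ (tildeGalois_cyclic hA n x)

variable {A} in
/-- The spaces `D □_{D^e} C^{□(n+1)}` are the images of `ω`, and `ω` commutes with the operators. -/
theorem operatorsWellDefined (hA : A.IsHopfGalois) : A.OperatorsWellDefined where
  coface_mem n i x hx := by
    rw [← range_omega hA] at hx ⊢
    obtain ⟨x, rfl⟩ := hx
    exact ⟨_, omega_coface hA n i x⟩
  codegeneracy_mem n i x hx := by
    rw [← range_omega hA] at hx ⊢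
    obtain ⟨x, rfl⟩ := hx
    exact ⟨_, omega_codegeneracy hA n i x⟩
  cyclicOp_mem n x hx := by
    rw [← range_omega hA] at hx ⊢
    obtain ⟨x, rfl⟩ := hx
    exact ⟨_, omega_cyclicOp hA n x⟩

variable {A} in
theorem omega_mem (hA : A.IsHopfGalois) (n : ℕ) (x : (⨂[ℂ]^n H) ⊗[ℂ] A.tildeM) :
    A.omega n x ∈ A.coextObj n := by
  rw [← range_omega hA]
  exact ⟨x, rfl⟩

variable {A} in
theorem hopfCyclic_isCocyclic (hA : A.IsHopfGalois) :
    (hopfCyclic (H := H) (M := A.tildeM) A.tildeAct (tildeCoact hA)).IsCocyclic := by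
  refine (coalgebraCyclic_isCocyclic C).of_injective A.tildeGalois (tildeGalois_injective hA)
    (fun n i x => ?_) (fun n i x => ?_) (tildeGalois_cyclic hA)
  · induction i using Fin.lastCases with
    | last =>
      simp only [Fin.lastCases_last, coalgebraCyclic, LinearMap.comp_apply]
      exact tildeGalois_appendCoact hA n x
    | cast i =>
      simp only [Fin.lastCases_castSucc, coalgebraCyclic]
      exact A.tildeGalois_rTensor (A.galoisPow_insertOneAt n i) x
  · induction i using Fin.lastCases with
    | last =>
      simp only [Fin.lastCases_last, coalgebraCyclic]
      exact A.tildeGalois_rTensor (A.galoisPow_counitLast n) x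
    | cast i =>
      simp only [Fin.lastCases_castSucc, coalgebraCyclic]
      exact A.tildeGalois_rTensor (A.galoisPow_mulAt n i) x

theorem bijective_codRestrict {V W : Type*} [AddCommGroup V] [Module ℂ V] [AddCommGroup W]
    [Module ℂ W] {f : V →ₗ[ℂ] W} {p : Submodule ℂ W} (h : ∀ x, f x ∈ p)
    (hf : Function.Injective f) (hp : LinearMap.range f = p) :
    Function.Bijective (f.codRestrict p h) := by
  subst hp
  exact ⟨LinearMap.injective_codRestrict_iff h |>.2 hf, f.surjective_rangeRestrict⟩

variable {A} in
theorem omegaHom_isIso (hA : A.IsHopfGalois) (hX : A.OperatorsWellDefined)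
    (hω : ∀ n x, A.omega n x ∈ A.coextObj n) :
    let Y := hopfCyclic (H := H) (M := A.tildeM) A.tildeAct (tildeCoact hA)
    let X := coextCyclic hX
    let ω := omegaHom hA hX hω
    CocyclicData.IsIso Y X ω where
  bijective n := bijective_codRestrict (hω n) (omega_injective hA n) (range_omega hA n)
  comm_δ n i := by
    refine LinearMap.ext fun x => Subtype.ext ?_
    exact omega_coface hA n i x
  comm_σ n i := by
    refine LinearMap.ext fun x => Subtype.ext ?_
    exact omega_codegeneracy hA n i x
  comm_τ n := by
    refine LinearMap.ext fun x => Subtype.ext ?_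
    exact omega_cyclicOp hA n x

end RightModuleCoalgebra
end CocycHopf

end

theorem mainTheorem3 {H C : Type*} [Ring H] [HopfAlgebra ℂ H] [AddCommGroup C] [Module ℂ C]
    [Coalgebra ℂ C] (A : CocycHopf.RightModuleCoalgebra H C) (hA : A.IsHopfGalois) :
    CocycHopf.IsSAYD (H := H) (M := A.tildeM) A.tildeAct
      (CocycHopf.RightModuleCoalgebra.tildeCoact hA) ∧
    ∃ (hX : A.OperatorsWellDefined) (hω : ∀ n x, A.omega n x ∈ A.coextObj n),
      let Y := CocycHopf.hopfCyclic (H := H) (M := A.tildeM) A.tildeAct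
        (CocycHopf.RightModuleCoalgebra.tildeCoact hA)
      let X := CocycHopf.RightModuleCoalgebra.coextCyclic hX
      let ω := CocycHopf.RightModuleCoalgebra.omegaHom hA hX hω
      Y.IsCocyclic ∧ X.IsCocyclic ∧ CocycHopf.CocyclicData.IsIso Y X ω ∧
      (∀ n, ∃ e : Y.HC n ≃ₗ[ℂ] X.HC n, ∀ z : Y.cocycles n, ∃ h : ω n z ∈ X.cocycles n,
        e (Submodule.Quotient.mk z) = Submodule.Quotient.mk ⟨ω n z, h⟩) ∧
      (∀ n, Function.Bijective (CocycHopf.phi (H := H) (M := A.tildeM)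
        (CocycHopf.RightModuleCoalgebra.tildeCoact hA) n)) := by
  have hM := CocycHopf.RightModuleCoalgebra.isSAYD_tilde hA
  have hX := CocycHopf.RightModuleCoalgebra.operatorsWellDefined hA
  have hω := CocycHopf.RightModuleCoalgebra.omega_mem hA
  have hY := CocycHopf.RightModuleCoalgebra.hopfCyclic_isCocyclic hA
  have hiso := CocycHopf.RightModuleCoalgebra.omegaHom_isIso hA hX hω
  exact ⟨hM, hX, hω, hY, hiso.isCocyclic hY, hiso, hiso.exists_HC_equiv,
    CocycHopf.phi_bijective (M := A.tildeM) hM.coassoc hM.counit⟩
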